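/- Let $q:\mathbb R\to\mathbb R$ be bounded, measurable and even, with $\operatorname{supp} q\subset[-r,r]$ for some $r<\tfrac12$, and put $d_{\max}:=\tfrac12-r$. Let $\mu$ be a Borel probability measure on $\mathbb R$ with $\{-d_{\max},d_{\max}\}\subset\operatorname{supp}\mu\subset[-d_{\max},d_{\max}]$. For $\omega=(\omega_n)_{n\in\mathbb Z}$ let $H_\omega=-\frac{d^2}{dx^2}+\sum_{n\in\mathbb Z}q(x-n-\omega_n)$ in $L^2(\mathbb R)$ with domain $H^2(\mathbb R)$. Let $\Sigma$ be the almost sure spectrum of $H_\omega$ when the $\omega_n$ are independent with common distribution $\mu$, i.e. the set of all $E\in\mathbb R$ such that $E\in\sigma(H_\omega)$ for almost every $\omega$. For $a\in[-d_{\max},d_{\max}]$ let $E_0(a)$ be the lowest eigenvalue of $-\frac{d^2}{dx^2}+q(x-a)$ on $L^2(-\tfrac12,\tfrac12)$ with Neumann boundary conditions. Assume that $E_0(a)$ is strictly maximized at $a=0$ and strictly minimized at $a=\pm d_{\max}$, i.e. $E_0(a)<E_0(0)$ for all $a\in[-d_{\max},d_{\max}]\setminus\{0\}$ and $E_0(\pm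 d_{\max})<E_0(a)$ for all $a\in(-d_{\max},d_{\max})$. Then $E_0:=\min\Sigma$ exists, and for every integer $L\ge1$ and every $L$-periodic configuration $\omega:\mathbb Z\to\operatorname{supp}\mu$ (that is, $\omega_{n+L}=\omega_n$ for all $n\in\mathbb Z$), one has $\min\sigma(H_\omega)=E_0$ if and only if all of the following hold: (i) all $\omega_n$ are maximally displaced, i.e. $\omega_n=\pm d_{\max}$ for all $n\in\mathbb Z$; (ii) $L$ is even; (iii) in each period of length $L$, i.e. among $\omega_m,\dots,\omega_{m+L-1}$ for each $m\in\mathbb Z$, equally many $\omega_n$ are displaced to the left ($\omega_n<0$) and to the right ($\omega_n>0$). -/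

import Mathlib

noncomputable section

namespace RDM

open MeasureTheory Set

/-! ### Spectrum of an unbounded operator -/

section Spectrum

variable {E : Type*} [NormedAddCommGroup E] [NormedSpace ℂ E]

/-- The resolvent set of a (partially defined) linear operator `T` on `E`: all `z` for which
`T - z` is a bijection from the domain of `T` onto `E` with bounded inverse `R`. -/
def resolventSet (T : E →ₗ.[ℂ] E) : Set ℂ :=
  {z | ∃ R : E →L[ℂ] E,
    (∀ x : T.domain, R (T x - z • (x : E)) = x) ∧
    (∀ y : E, ∃ x : T.domain, (x : E) = R y ∧ T x - z • (x : E) = y)}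

/-- The real points of the spectrum (the complement of the resolvent set) of `T`.
For a self-adjoint operator this is the whole spectrum. -/
def realSpectrum (T : E →ₗ.[ℂ] E) : Set ℝ :=
  {t | (t : ℂ) ∉ resolventSet T}

end Spectrum

section SobolevOperators

open scoped ContDiff

/-! ### Weak derivatives in `L²(U)` for `U ⊆ ℝ` -/

/-- The complex Hilbert space `L²(U)` with respect to Lebesgue measure. -/
abbrev L2 (U : Set ℝ) := Lp ℂ 2 (volume.restrict U)

/-- `g ∈ L²(U)` is the weak derivative of `u ∈ L²(U)` on the open set `U`. -/
def HasWeakDeriv (U : Set ℝ) (u g : L2 U) : Prop :=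
  ∀ φ : ℝ → ℝ, ContDiff ℝ ∞ φ → HasCompactSupport φ → tsupport φ ⊆ U →
    ∫ x in U, deriv φ x • u x = - ∫ x in U, φ x • g x

lemma integrable_test_smul {U : Set ℝ} {φ : ℝ → ℝ} (hφ : Continuous φ)
    (hc : HasCompactSupport φ) (u : L2 U) :
    Integrable (fun x => φ x • u x) (volume.restrict U) := by
  have h1 : MemLp φ 2 (volume.restrict U) := hφ.memLp_of_hasCompactSupport hc
  have h2 : MemLp (fun x => φ x • u x) 1 (volume.restrict U) := (Lp.memLp u).smul h1
  exact memLp_one_iff_integrable.1 h2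

lemma contDiff_deriv_continuous {φ : ℝ → ℝ} (h : ContDiff ℝ ∞ φ) : Continuous (deriv φ) :=
  h.continuous_deriv (by simp)

lemma integral_test_add {U : Set ℝ} {φ : ℝ → ℝ} (hφ : Continuous φ)
    (hc : HasCompactSupport φ) (u v : L2 U) :
    ∫ x in U, φ x • (u + v : L2 U) x = (∫ x in U, φ x • u x) + ∫ x in U, φ x • v x := by
  rw [← integral_add (integrable_test_smul hφ hc u) (integrable_test_smul hφ hc v)]
  refine integral_congr_ae ?_
  filter_upwards [Lp.coeFn_add u v] with x hx
  rw [hx, Pi.add_apply, smul_add]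

lemma integral_test_smul {U : Set ℝ} {φ : ℝ → ℝ} (c : ℂ) (u : L2 U) :
    ∫ x in U, φ x • (c • u : L2 U) x = c * ∫ x in U, φ x • u x := by
  rw [← integral_const_mul]
  refine integral_congr_ae ?_
  filter_upwards [Lp.coeFn_smul c u] with x hx
  simp [hx]
  ring

lemma integral_test_zero {U : Set ℝ} {φ : ℝ → ℝ} :
    ∫ x in U, φ x • (0 : L2 U) x = 0 := by
  rw [← integral_zero ℝ ℂ (μ := volume.restrict U)]
  refine integral_congr_ae ?_
  filter_upwards [Lp.coeFn_zero ℂ 2 (volume.restrict U)] with x hx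
  rw [hx, Pi.zero_apply, smul_zero]

lemma HasWeakDeriv.add {U : Set ℝ} {u g v h : L2 U} (h1 : HasWeakDeriv U u g)
    (h2 : HasWeakDeriv U v h) : HasWeakDeriv U (u + v) (g + h) := by
  intro φ hφ hc hs
  rw [integral_test_add (contDiff_deriv_continuous hφ) hc.deriv,
    integral_test_add hφ.continuous hc, h1 φ hφ hc hs, h2 φ hφ hc hs]
  ring

lemma HasWeakDeriv.smul {U : Set ℝ} {u g : L2 U} (c : ℂ) (h1 : HasWeakDeriv U u g) :
    HasWeakDeriv U (c • u) (c • g) := by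
  intro φ hφ hc hs
  rw [integral_test_smul, integral_test_smul, h1 φ hφ hc hs]
  ring

lemma HasWeakDeriv.zero (U : Set ℝ) : HasWeakDeriv U 0 0 := by
  intro φ _ _ _
  rw [integral_test_zero, integral_test_zero, neg_zero]

lemma eq_zero_of_test {U : Set ℝ} (hU : IsOpen U) {g : L2 U}
    (h : ∀ φ : ℝ → ℝ, ContDiff ℝ ∞ φ → HasCompactSupport φ → tsupport φ ⊆ U →
      ∫ x in U, φ x • g x = 0) : g = 0 := by
  have hloc : LocallyIntegrable (fun x => g x) (volume.restrict U) :=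
    (Lp.memLp g).locallyIntegrable (by norm_num)
  have h1 := hU.ae_eq_zero_of_integral_contDiff_smul_eq_zero (hloc.locallyIntegrableOn U)
    (μ := volume.restrict U) h
  rw [Lp.eq_zero_iff_ae_eq_zero]
  filter_upwards [h1, ae_restrict_mem hU.measurableSet] with x hx hxU
  exact hx hxU

lemma HasWeakDeriv.eq_zero {U : Set ℝ} (hU : IsOpen U) {g : L2 U}
    (h : HasWeakDeriv U 0 g) : g = 0 := by
  refine eq_zero_of_test hU fun φ hφ hc hs => ?_
  have := h φ hφ hc hs
  rw [integral_test_zero] at this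
  exact neg_eq_zero.1 this.symm

/-! ### The Laplacian on the line -/

/-- The graph of `-d²/dx²` on the Sobolev space `H²(ℝ)`, as an operator in `L²(ℝ)`. -/
def negLaplacianGraph : Submodule ℂ (L2 univ × L2 univ) where
  carrier := {p | ∃ g : L2 univ, HasWeakDeriv univ p.1 g ∧ HasWeakDeriv univ g (-p.2)}
  add_mem' := by
    rintro p q ⟨g, h1, h2⟩ ⟨h, h3, h4⟩
    refine ⟨g + h, h1.add h3, ?_⟩
    have := h2.add h4
    rwa [← neg_add] at this
  zero_mem' := ⟨0, HasWeakDeriv.zero _, by simpa using HasWeakDeriv.zero _⟩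
  smul_mem' := by
    rintro c p ⟨g, h1, h2⟩
    refine ⟨c • g, h1.smul c, ?_⟩
    have := h2.smul c
    rwa [smul_neg] at this

lemma negLaplacianGraph_single (p : L2 univ × L2 univ) (hp : p ∈ negLaplacianGraph)
    (h0 : p.1 = 0) : p.2 = 0 := by
  obtain ⟨g, h1, h2⟩ := hp
  rw [h0] at h1
  rw [h1.eq_zero isOpen_univ] at h2
  exact neg_eq_zero.1 (h2.eq_zero isOpen_univ)

/-- `-d²/dx²` with domain `H²(ℝ)`, as an unbounded operator in `L²(ℝ)`. -/
def negLaplacian : L2 univ →ₗ.[ℂ] L2 univ := negLaplacianGraph.toLinearPMap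

lemma negLaplacian_graph : negLaplacian.graph = negLaplacianGraph :=
  Submodule.toLinearPMap_graph_eq _ negLaplacianGraph_single

/-! ### The Neumann Laplacian -/

/-- The graph of the operator in `L²(U)` associated with the quadratic form `∫_U |f'|²`
with form domain `H¹(U)`: the pair `(u, f)` belongs to it when `u ∈ H¹(U)` and
`⟨v', u'⟩ = ⟨v, f⟩` for all `v ∈ H¹(U)`. -/
def neumannGraph (U : Set ℝ) : Submodule ℂ (L2 U × L2 U) where
  carrier := {p | ∃ g : L2 U, HasWeakDeriv U p.1 g ∧
    ∀ v w : L2 U, HasWeakDeriv U v w → inner ℂ w g = inner ℂ v p.2}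
  add_mem' := by
    rintro p q ⟨g, h1, h2⟩ ⟨h, h3, h4⟩
    refine ⟨g + h, h1.add h3, fun v w hvw => ?_⟩
    rw [inner_add_right, h2 v w hvw, h4 v w hvw, Prod.snd_add, inner_add_right]
  zero_mem' := ⟨0, HasWeakDeriv.zero _, fun v w _ => by simp⟩
  smul_mem' := by
    rintro c p ⟨g, h1, h2⟩
    refine ⟨c • g, h1.smul c, fun v w hvw => ?_⟩
    rw [inner_smul_right, h2 v w hvw, Prod.smul_snd, inner_smul_right]

/-- A test function, as an element of `L²(U)`. -/
def testL2 (U : Set ℝ) (φ : ℝ → ℝ) (hφ : Continuous φ) (hc : HasCompactSupport φ) : L2 U :=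
  MemLp.toLp (fun x => (φ x : ℂ))
    ((hφ.memLp_of_hasCompactSupport hc : MemLp φ 2 (volume.restrict U)).ofReal)

lemma testL2_coe {U : Set ℝ} {φ : ℝ → ℝ} (hφ : Continuous φ) (hc : HasCompactSupport φ) :
    ∀ᵐ x ∂(volume.restrict U), testL2 U φ hφ hc x = (φ x : ℂ) :=
  MemLp.coeFn_toLp _

lemma testL2_hasWeakDeriv {U : Set ℝ} {φ : ℝ → ℝ} (hφ : ContDiff ℝ ∞ φ)
    (hc : HasCompactSupport φ) :
    HasWeakDeriv U (testL2 U φ hφ.continuous hc)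
      (testL2 U (deriv φ) (contDiff_deriv_continuous hφ) hc.deriv) := by
  intro ψ hψ hcψ hsψ
  have e1 : ∫ x in U, deriv ψ x • (testL2 U φ hφ.continuous hc) x
      = ∫ x in U, ((deriv ψ x * φ x : ℝ) : ℂ) := by
    refine integral_congr_ae ?_
    filter_upwards [testL2_coe (U := U) hφ.continuous hc] with x hx
    rw [hx]
    simp
  have e2 : ∫ x in U, ψ x • (testL2 U (deriv φ) (contDiff_deriv_continuous hφ) hc.deriv) x
      = ∫ x in U, ((ψ x * deriv φ x : ℝ) : ℂ) := by
    refine integral_congr_ae ?_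
    filter_upwards [testL2_coe (U := U) (contDiff_deriv_continuous hφ) hc.deriv] with x hx
    rw [hx]
    simp
  rw [e1, e2, integral_complex_ofReal, integral_complex_ofReal, ← Complex.ofReal_neg]
  congr 1
  have z1 : ∀ x, x ∉ U → ψ x = 0 := fun x hx =>
    image_eq_zero_of_notMem_tsupport fun h => hx (hsψ h)
  have z2 : ∀ x, x ∉ U → deriv ψ x = 0 := fun x hx =>
    image_eq_zero_of_notMem_tsupport fun h => hx (hsψ (tsupport_deriv_subset h))
  rw [setIntegral_eq_integral_of_forall_compl_eq_zero (fun x hx => by simp [z2 x hx]),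
    setIntegral_eq_integral_of_forall_compl_eq_zero (fun x hx => by simp [z1 x hx])]
  have dψ := contDiff_deriv_continuous hψ
  have dφ := contDiff_deriv_continuous hφ
  have := integral_mul_deriv_eq_deriv_mul_of_integrable (u := ψ) (v := φ) (u' := deriv ψ)
    (v' := deriv φ)
    (fun x _ => (hψ.differentiable (by simp) x).hasDerivAt)
    (fun x _ => (hφ.differentiable (by simp) x).hasDerivAt)
    ((hψ.continuous.mul dφ).integrable_of_hasCompactSupport hcψ.mul_right)
    ((dψ.mul hφ.continuous).integrable_of_hasCompactSupport hcψ.deriv.mul_right)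
    ((hψ.continuous.mul hφ.continuous).integrable_of_hasCompactSupport hcψ.mul_right)
  rw [this, neg_neg]

lemma neumannGraph_single {U : Set ℝ} (hU : IsOpen U) (p : L2 U × L2 U)
    (hp : p ∈ neumannGraph U) (h0 : p.1 = 0) : p.2 = 0 := by
  obtain ⟨g, h1, h2⟩ := hp
  rw [h0] at h1
  rw [h1.eq_zero hU] at h2
  refine eq_zero_of_test hU fun φ hφ hc _ => ?_
  have := h2 _ _ (testL2_hasWeakDeriv (U := U) hφ hc)
  rw [inner_zero_right, L2.inner_def] at this
  rw [this]
  refine integral_congr_ae ?_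
  filter_upwards [testL2_coe (U := U) hφ.continuous hc] with x hx
  rw [hx]
  simp [mul_comm]

/-- The (negative) Neumann Laplacian on `L²(U)`. -/
def neumannLaplacian (U : Set ℝ) : L2 U →ₗ.[ℂ] L2 U := (neumannGraph U).toLinearPMap

lemma neumannLaplacian_graph {U : Set ℝ} (hU : IsOpen U) :
    (neumannLaplacian U).graph = neumannGraph U :=
  Submodule.toLinearPMap_graph_eq _ (neumannGraph_single hU)

end SobolevOperators

/-! ### Multiplication operators -/

/-- Multiplication by the real function `V` in `L²(U)`, on its maximal domain. -/
def mulOp (U : Set ℝ) (V : ℝ → ℝ) : L2 U →ₗ.[ℂ] L2 U where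
  domain :=
    { carrier := {u | MemLp (fun x => (V x : ℂ) * u x) 2 (volume.restrict U)}
      add_mem' := by
        intro u v hu hv
        refine (MemLp.add hu hv).ae_eq ?_
        filter_upwards [Lp.coeFn_add u v] with x hx
        rw [hx, Pi.add_apply, Pi.add_apply, mul_add]
      zero_mem' := by
        refine (MemLp.zero' (ε := ℂ)).ae_eq ?_
        filter_upwards [Lp.coeFn_zero ℂ 2 (volume.restrict U)] with x hx
        rw [hx, Pi.zero_apply, mul_zero]
      smul_mem' := by
        intro c u hu
        refine (MemLp.const_mul hu c).ae_eq ?_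
        filter_upwards [Lp.coeFn_smul c u] with x hx
        simp [hx]
        ring }
  toFun :=
    { toFun := fun u => MemLp.toLp _ u.2
      map_add' := by
        intro u v
        rw [← MemLp.toLp_add]
        refine MemLp.toLp_congr _ _ ?_
        filter_upwards [Lp.coeFn_add (u : L2 U) v] with x hx
        simp only [Submodule.coe_add, Pi.add_apply]
        rw [hx, Pi.add_apply, mul_add]
      map_smul' := by
        intro c u
        rw [RingHom.id_apply, ← MemLp.toLp_const_smul]
        refine MemLp.toLp_congr _ _ ?_
        filter_upwards [Lp.coeFn_smul c (u : L2 U)] with x hx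
        simp [hx]
        ring }

/-! ### The random displacement model in dimension one -/

/-- The potential `V_ω(x) = ∑_n q(x - n - ω_n)`. -/
def potential (q : ℝ → ℝ) (ω : ℤ → ℝ) (x : ℝ) : ℝ :=
  ∑' n : ℤ, q (x - n - ω n)

/-- The Schrödinger operator `H_ω = -d²/dx² + V_ω` in `L²(ℝ)`. -/
def hamiltonian (q : ℝ → ℝ) (ω : ℤ → ℝ) : L2 univ →ₗ.[ℂ] L2 univ :=
  negLaplacian + mulOp univ (potential q ω)

/-- The open unit cell `(-1/2, 1/2)`. -/
def unitCell : Set ℝ := Ioo (-1 / 2) (1 / 2)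

/-- The single-site operator `-d²/dx² + q(x - a)` in `L²(-1/2, 1/2)` with Neumann boundary
conditions. -/
def neumannHamiltonian (q : ℝ → ℝ) (a : ℝ) : L2 unitCell →ₗ.[ℂ] L2 unitCell :=
  neumannLaplacian unitCell + mulOp unitCell (fun x => q (x - a))

/-- The lowest spectral value `E_0(a)` of the single-site Neumann operator. -/
def neumannEnergy (q : ℝ → ℝ) (a : ℝ) : ℝ :=
  sInf (realSpectrum (neumannHamiltonian q a))

/-- The almost sure spectrum `Σ` of `H_ω`, when the `ω_n` are independent with
common distribution `μ`. -/
def almostSureSpectrum (q : ℝ → ℝ) (μ : Measure ℝ) : Set ℝ :=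
  {E | ∀ᵐ ω ∂(Measure.infinitePi fun _ : ℤ => μ), E ∈ realSpectrum (hamiltonian q ω)}

/-- If the spectrum is almost surely equal to a fixed set `S`, then `S` is
`almostSureSpectrum`. -/
lemma almostSureSpectrum_eq {q : ℝ → ℝ} {μ : Measure ℝ} [IsProbabilityMeasure μ] {S : Set ℝ}
    (h : ∀ᵐ ω ∂(Measure.infinitePi fun _ : ℤ => μ), realSpectrum (hamiltonian q ω) = S) :
    almostSureSpectrum q μ = S := by
  ext E
  constructor
  · intro hE
    obtain ⟨ω, h1, h2⟩ := (h.and hE).exists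
    exact h1 ▸ h2
  · intro hE
    change ∀ᵐ ω ∂_, _
    filter_upwards [h] with ω hω
    exact hω.symm ▸ hE

/-- Assumptions on the single-site potential: bounded, measurable, reflection-symmetric,
supported in `[-r, r]` with `r < 1/2`. -/
structure SingleSite (q : ℝ → ℝ) (r : ℝ) : Prop where
  bounded : ∃ C : ℝ, ∀ x, |q x| ≤ C
  measurable : Measurable q
  symmetric : ∀ x, q (-x) = q x
  support_subset : tsupport q ⊆ Icc (-r) r
  r_lt : r < 1 / 2

/-- The maximal displacement `d_max = 1/2 - r`. -/
def dmax (r : ℝ) : ℝ := 1 / 2 - r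

/-- Assumption on the displacement distribution:
`{±d_max} ⊆ supp μ ⊆ [-d_max, d_max]`. -/
structure Displacement (μ : Measure ℝ) (r : ℝ) : Prop where
  corners : {-dmax r, dmax r} ⊆ μ.support
  support_subset : μ.support ⊆ Icc (-dmax r) (dmax r)

/-- `E_0(a)`, `a ∈ [-d_max, d_max]`, is strictly maximized at `a = 0` and strictly minimized
at `a = ±d_max`. -/
structure StrictExtrema (q : ℝ → ℝ) (r : ℝ) : Prop where
  max_zero : ∀ a ∈ Icc (-dmax r) (dmax r), a ≠ 0 → neumannEnergy q a < neumannEnergy q 0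
  min_corners : ∀ c ∈ ({-dmax r, dmax r} : Set ℝ), ∀ a ∈ Ioo (-dmax r) (dmax r),
    neumannEnergy q c < neumannEnergy q a

end RDM

end

/-!
Write `E₀` for the lowest Neumann energy of a cell whose bump is maximally displaced.

**Lower bound.** `IsRiccati V E p` says that `p` is the logarithmic derivative of a positive Neumann
solution `φ` of `-φ'' + V φ = E φ` on the unit cell. Completing the square,
`∫ |u' - p u|² ≥ 0` (`boundary_le_form`), shows that `E` bounds the form of the cell from below, so `E` is
the lowest point of the spectrum (`IsRiccati.sInf_realSpectrum`); such solutions exist for every bounded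
potential (`exists_isRiccati`). Each cell contains exactly one bump, so adding up the bounds of the cells
(`SingleSite.form_bound_line`) gives `H_ω ≥ E₀` for all admissible `ω`
(`SingleSite.neumannEnergy_le_of_mem_realSpectrum`). The passage from forms to operators is the
Lax–Milgram argument in `not_mem_realSpectrum_of_form_bound`.

**When the bound is attained.** Let `c = ∫ p` for the cell with bump at `d_max`, so that `exp c` is the
quotient of the values of the ground state at the two ends. By reflection, the cell with bump at `-d_max`
has the quotient `exp (-c)`. Moreover `c ≠ 0` (`SingleSite.integral_ne_zero`): if `c = 0`, the periodic
extension of the ground state could be recentred at the bump and would be a trial function for the cell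
with the bump at `0`, so that `E_0(0) ≤ E_0(d_max)`, against the assumption that `E_0(0)` is the strict
maximum. For a configuration of bumps at `±d_max`, the ground states of the cells, suitably scaled, fit
together to a positive solution of `H_ω Ψ = E₀ Ψ` on the line, whose logarithm grows by `±c` in each cell.

If `ω` is periodic and balanced, meaning that the growth over a period vanishes, then `Ψ` is bounded from
above and below (`SingleSite.exists_bounded_solution`), and its cutoffs are approximate eigenfunctions, so
`E₀` belongs to the spectrum (`SingleSite.mem_realSpectrum_of_balanced`). The same cutoffs serve for every
configuration that contains approximate copies of all finite pieces of `ω`. By the Borel–Cantelli lemma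
almost every configuration contains approximate copies of all finite pieces of the alternating
configuration (`ae_forall_exists_shift_near`), which identifies `E₀` as the minimum of the almost sure
spectrum.

If `ω` is periodic and some bump is not maximally displaced, or if the growth over a period does not
vanish, then the bound is strict (`SingleSite.not_mem_realSpectrum_of_periodic`). There are bounded
periodic weights `w n`, attached to the boundaries of the cells, that grow faster than the inverse square
of `Ψ` in every cell, except in cells of energy above `E₀` where they may drop (`exists_periodic_weights`).
Perturbing `p` by a small multiple of a function interpolating these weights before the square is completed
gives a uniform gain in every cell (`IsRiccati.eventually_cell_gap`), while the boundary terms telescope.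

Balance means equal numbers of left and right displacements, since `c ≠ 0`
(`SingleSite.sum_integral_eq`); in particular the period is even.
-/

namespace RDM

open MeasureTheory Set Filter Topology

/-! ### Primitives of locally integrable functions -/

/-- `f` is a primitive of the locally integrable function `f'` on the whole line; equivalently,
`f` is locally absolutely continuous with derivative `f'` almost everywhere. -/
structure IsPrim {E : Type*} [NormedAddCommGroup E] [NormedSpace ℝ E] (f f' : ℝ → E) : Prop where
  intervalIntegrable : ∀ a b, IntervalIntegrable f' volume a b
  integral_eq : ∀ a b, ∫ x in a..b, f' x = f b - f a

namespace IsPrim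

section General

variable {E : Type*} [NormedAddCommGroup E] [NormedSpace ℝ E] {f g f' g' : ℝ → E}

lemma eq_add (h : IsPrim f f') (a x : ℝ) : f x = f a + ∫ t in a..x, f' t := by
  rw [h.integral_eq]; abel

lemma continuous (h : IsPrim f f') : Continuous f := by
  have : f = fun x => f 0 + ∫ t in (0 : ℝ)..x, f' t := funext fun x => h.eq_add 0 x
  rw [this]
  exact continuous_const.add (intervalIntegral.continuous_primitive h.intervalIntegrable 0)

lemma of_hasDerivAt [CompleteSpace E] (h : ∀ x, HasDerivAt f (f' x) x) (hc : Continuous f') :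
    IsPrim f f' where
  intervalIntegrable a b := hc.intervalIntegrable a b
  integral_eq a b := intervalIntegral.integral_eq_sub_of_hasDerivAt (fun x _ => h x)
    (hc.intervalIntegrable a b)

lemma primitive (h : ∀ a b, IntervalIntegrable f' volume a b) (c : ℝ) :
    IsPrim (fun x => ∫ t in c..x, f' t) f' where
  intervalIntegrable := h
  integral_eq a b := by
    rw [intervalIntegral.integral_interval_sub_left (h _ _) (h _ _)]

lemma add (hf : IsPrim f f') (hg : IsPrim g g') :
    IsPrim (fun x => f x + g x) (fun x => f' x + g' x) where
  intervalIntegrable a b := (hf.intervalIntegrable a b).add (hg.intervalIntegrable a b)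
  integral_eq a b := by
    rw [intervalIntegral.integral_add (hf.intervalIntegrable a b) (hg.intervalIntegrable a b),
      hf.integral_eq, hg.integral_eq]
    abel

lemma neg (hf : IsPrim f f') : IsPrim (fun x => -f x) (fun x => -f' x) where
  intervalIntegrable a b := (hf.intervalIntegrable a b).neg
  integral_eq a b := by
    rw [intervalIntegral.integral_neg, hf.integral_eq]
    abel

lemma sub (hf : IsPrim f f') (hg : IsPrim g g') :
    IsPrim (fun x => f x - g x) (fun x => f' x - g' x) := by
  simpa only [sub_eq_add_neg] using hf.add hg.neg

lemma comp_sub_right (hf : IsPrim f f') (c : ℝ) :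
    IsPrim (fun x => f (x - c)) (fun x => f' (x - c)) where
  intervalIntegrable a b := by
    have := (hf.intervalIntegrable (a - c) (b - c)).comp_sub_right c
    simpa using this
  integral_eq a b := by
    rw [intervalIntegral.integral_comp_sub_right, hf.integral_eq]

lemma comp_add_right (hf : IsPrim f f') (c : ℝ) :
    IsPrim (fun x => f (x + c)) (fun x => f' (x + c)) := by
  simpa using hf.comp_sub_right (-c)

lemma comp_neg (hf : IsPrim f f') : IsPrim (fun x => f (-x)) (fun x => -f' (-x)) where
  intervalIntegrable a b := by
    have := (hf.intervalIntegrable (-a) (-b)).comp_sub_left 0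
    simp only [zero_sub, neg_neg] at this
    exact this.neg
  integral_eq a b := by
    rw [intervalIntegral.integral_neg, intervalIntegral.integral_comp_neg, hf.integral_eq]
    abel

/-- An integrable function with an integrable derivative tends to zero at `+∞`. -/
lemma tendsto_atTop (h : IsPrim f f') (hf : Integrable f) (hf' : Integrable f') :
    Tendsto f atTop (𝓝 0) := by
  have h1 : Tendsto (fun x => f 0 + ∫ t in (0 : ℝ)..x, f' t) atTop
      (𝓝 (f 0 + ∫ t in Ioi (0 : ℝ), f' t)) :=
    tendsto_const_nhds.add
      (intervalIntegral_tendsto_integral_Ioi 0 hf'.integrableOn tendsto_id)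
  have h2 : Tendsto f atTop (𝓝 (f 0 + ∫ t in Ioi (0 : ℝ), f' t)) :=
    h1.congr fun x => (h.eq_add 0 x).symm
  have h3 := (hf.integrableAtFilter atTop).eq_zero_of_tendsto (fun s hs => by
    obtain ⟨a, ha⟩ := mem_atTop_sets.1 hs
    exact measure_mono_top (show Ici a ⊆ s from ha) (by simp)) h2
  rwa [h3] at h2

lemma tendsto_atBot (h : IsPrim f f') (hf : Integrable f) (hf' : Integrable f') :
    Tendsto f atBot (𝓝 0) := by
  have := (h.comp_neg.tendsto_atTop hf.comp_neg hf'.comp_neg.neg).comp tendsto_neg_atBot_atTop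
  simpa [Function.comp_def] using this

/-- The integral over the line of an integrable derivative of an integrable function vanishes. -/
lemma integral_eq_zero (h : IsPrim f f') (hf : Integrable f) (hf' : Integrable f') :
    ∫ x, f' x = 0 := by
  have h1 := intervalIntegral_tendsto_integral hf' tendsto_neg_atTop_atBot tendsto_id
  have h2 := (h.tendsto_atTop hf hf').sub
    ((h.tendsto_atBot hf hf').comp tendsto_neg_atTop_atBot)
  rw [sub_zero] at h2
  exact tendsto_nhds_unique h1 (h2.congr fun x => (h.integral_eq _ _).symm)

end General

section Products

variable {f g f' g' : ℝ → ℝ}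

lemma const_mul (hf : IsPrim f f') (c : ℝ) : IsPrim (fun x => c * f x) (fun x => c * f' x) where
  intervalIntegrable a b := (hf.intervalIntegrable a b).const_mul c
  integral_eq a b := by
    rw [intervalIntegral.integral_const_mul, hf.integral_eq, mul_sub]

lemma ofReal (hf : IsPrim f f') : IsPrim (fun x => (f x : ℂ)) (fun x => (f' x : ℂ)) where
  intervalIntegrable a b := by
    have := hf.intervalIntegrable a b
    rw [intervalIntegrable_iff] at this ⊢
    exact this.ofReal
  integral_eq a b := by
    rw [intervalIntegral.integral_ofReal, hf.integral_eq, Complex.ofReal_sub]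

lemma absolutelyContinuous (hf : IsPrim f f') (a b : ℝ) :
    AbsolutelyContinuousOnInterval (fun x => f x - f a) a b := by
  have := (hf.intervalIntegrable a b).absolutelyContinuousOnInterval_intervalIntegral
    (c := a) left_mem_uIcc
  simpa only [hf.integral_eq] using this

lemma ae_hasDerivAt (hf : IsPrim f f') (a b : ℝ) :
    ∀ᵐ x, x ∈ uIcc a b → HasDerivAt f (f' x) x := by
  filter_upwards [(hf.intervalIntegrable a b).ae_hasDerivAt_integral] with x hx hxab
  have := hx hxab a left_mem_uIcc
  simp only [hf.integral_eq] at this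
  simpa using this.add_const (f a)

/-- Product rule. -/
lemma mul (hf : IsPrim f f') (hg : IsPrim g g') :
    IsPrim (fun x => f x * g x) (fun x => f' x * g x + f x * g' x) where
  intervalIntegrable a b :=
    ((hf.intervalIntegrable a b).mul_continuousOn hg.continuous.continuousOn).add
      ((hg.intervalIntegrable a b).continuousOn_mul hf.continuous.continuousOn)
  integral_eq a b := by
    have key := (hf.absolutelyContinuous a b).integral_deriv_mul_eq_sub
      (hg.absolutelyContinuous a b)
    have e : ∫ x in a..b, deriv (fun x => f x - f a) x * (g x - g a)
        + (f x - f a) * deriv (fun x => g x - g a) x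
        = ∫ x in a..b, (f' x * g x + f x * g' x) - (f' x * g a + f a * g' x) := by
      refine intervalIntegral.integral_congr_ae ?_
      filter_upwards [hf.ae_hasDerivAt a b, hg.ae_hasDerivAt a b] with x h1 h2 hx
      rw [((h1 (uIoc_subset_uIcc hx)).sub_const _).deriv,
        ((h2 (uIoc_subset_uIcc hx)).sub_const _).deriv]
      ring
    have i1 := hf.intervalIntegrable a b
    have i2 := hg.intervalIntegrable a b
    rw [e, intervalIntegral.integral_sub, intervalIntegral.integral_add (i1.mul_const _)
      (i2.const_mul _), intervalIntegral.integral_mul_const, intervalIntegral.integral_const_mul,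
      hf.integral_eq, hg.integral_eq] at key
    · linear_combination key
    · exact (i1.mul_continuousOn hg.continuous.continuousOn).add
        (i2.continuousOn_mul hf.continuous.continuousOn)
    · exact (i1.mul_const _).add (i2.const_mul _)

end Products

section Complex

variable {u v u' v' : ℝ → ℂ}

lemma re (hu : IsPrim u u') : IsPrim (fun x => (u x).re) (fun x => (u' x).re) where
  intervalIntegrable a b := by
    have := hu.intervalIntegrable a b
    rw [intervalIntegrable_iff] at this ⊢
    exact this.re
  integral_eq a b := by
    have := Complex.reCLM.intervalIntegral_comp_comm (hu.intervalIntegrable a b)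
    simp only [Complex.reCLM_apply] at this
    rw [this, hu.integral_eq, Complex.sub_re]

lemma im (hu : IsPrim u u') : IsPrim (fun x => (u x).im) (fun x => (u' x).im) where
  intervalIntegrable a b := by
    have := hu.intervalIntegrable a b
    rw [intervalIntegrable_iff] at this ⊢
    exact this.im
  integral_eq a b := by
    have := Complex.imCLM.intervalIntegral_comp_comm (hu.intervalIntegrable a b)
    simp only [Complex.imCLM_apply] at this
    rw [this, hu.integral_eq, Complex.sub_im]

lemma const_mul_complex (hu : IsPrim u u') (c : ℂ) :
    IsPrim (fun x => c * u x) (fun x => c * u' x) where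
  intervalIntegrable a b := (hu.intervalIntegrable a b).const_mul c
  integral_eq a b := by
    rw [intervalIntegral.integral_const_mul, hu.integral_eq, mul_sub]

lemma of_re_im (h1 : IsPrim (fun x => (u x).re) (fun x => (u' x).re))
    (h2 : IsPrim (fun x => (u x).im) (fun x => (u' x).im)) : IsPrim u u' := by
  have := h1.ofReal.add (h2.ofReal.const_mul_complex Complex.I)
  convert this using 2 with x x <;> rw [mul_comm, Complex.re_add_im]

/-- Product rule for complex-valued functions. -/
lemma mul_complex (hu : IsPrim u u') (hv : IsPrim v v') :
    IsPrim (fun x => u x * v x) (fun x => u' x * v x + u x * v' x) := by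
  refine of_re_im ?_ ?_
  · convert (hu.re.mul hv.re).sub (hu.im.mul hv.im) using 2 with x x
    · simp only [Complex.mul_re]
    · simp only [Complex.add_re, Complex.mul_re]
      ring
  · convert (hu.re.mul hv.im).add (hu.im.mul hv.re) using 2 with x x
    · simp only [Complex.mul_im]
    · simp only [Complex.add_im, Complex.mul_im]
      ring

lemma star (hu : IsPrim u u') :
    IsPrim (fun x => (starRingEnd ℂ) (u x)) (fun x => (starRingEnd ℂ) (u' x)) :=
  of_re_im (by simpa using hu.re) (by simpa using hu.im.neg)

end Complex

end IsPrim

end RDM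

namespace RDM

open MeasureTheory Set Filter Topology
open scoped ContDiff

/-! ### Weak derivatives and absolutely continuous representatives -/

lemma IsPrim.locallyIntegrable {E : Type*} [NormedAddCommGroup E] [NormedSpace ℝ E]
    {f f' : ℝ → E} (h : IsPrim f f') : LocallyIntegrable f' := by
  refine locallyIntegrable_iff.2 fun K hK => ?_
  obtain ⟨R, hR⟩ := hK.isBounded.subset_closedBall 0
  have h1 : K ⊆ uIcc (-R) R := fun x hx => by
    have := hR hx
    rw [Real.closedBall_eq_Icc, zero_sub, zero_add] at this
    exact Icc_subset_uIcc this
  exact ((intervalIntegrable_iff' (by finiteness)).1 (h.intervalIntegrable (-R) R)).mono_set h1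

/-- Integration by parts against a test function. -/
lemma IsPrim.integral_test {w w' : ℝ → ℂ} (h : IsPrim w w') {φ : ℝ → ℝ} (hφ : ContDiff ℝ ∞ φ)
    (hc : HasCompactSupport φ) : ∫ x, deriv φ x • w x = -∫ x, φ x • w' x := by
  have hd := contDiff_deriv_continuous hφ
  have h1 : IsPrim φ (deriv φ) :=
    IsPrim.of_hasDerivAt (fun x => (hφ.differentiable (by simp) x).hasDerivAt) hd
  have h2 := h1.ofReal.mul_complex h
  have i0 : Integrable fun x => φ x • w x :=
    h.continuous.locallyIntegrable.integrable_smul_left_of_hasCompactSupport hφ.continuous hc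
  have i1 : Integrable fun x => deriv φ x • w x :=
    h.continuous.locallyIntegrable.integrable_smul_left_of_hasCompactSupport hd hc.deriv
  have i2 : Integrable fun x => φ x • w' x :=
    h.locallyIntegrable.integrable_smul_left_of_hasCompactSupport hφ.continuous hc
  have h3 := h2.integral_eq_zero (by simpa using i0) (i1.add i2)
  have h4 := integral_add i1 i2
  simp only [Complex.real_smul] at h4 ⊢
  rw [h3] at h4
  exact eq_neg_of_add_eq_zero_left h4.symm

lemma setIntegral_test {U : Set ℝ} {φ : ℝ → ℝ} (hs : tsupport φ ⊆ U) (w : ℝ → ℂ) :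
    ∫ x in U, φ x • w x = ∫ x, φ x • w x :=
  setIntegral_eq_integral_of_forall_compl_eq_zero fun x hx => by
    rw [image_eq_zero_of_notMem_tsupport fun h => hx (hs h), zero_smul]

/-- A function with an absolutely continuous representative has the expected weak derivative. -/
lemma IsPrim.hasWeakDeriv {U : Set ℝ} {w w' : ℝ → ℂ} (h : IsPrim w w')
    {u g : L2 U} (hu : u =ᵐ[volume.restrict U] w) (hg : g =ᵐ[volume.restrict U] w') :
    HasWeakDeriv U u g := by
  intro φ hφ hc hs
  have e1 : ∫ x in U, deriv φ x • u x = ∫ x in U, deriv φ x • w x :=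
    integral_congr_ae (hu.mono fun x hx => by simp only [hx])
  have e2 : ∫ x in U, φ x • g x = ∫ x in U, φ x • w' x :=
    integral_congr_ae (hg.mono fun x hx => by simp only [hx])
  rw [e1, e2, setIntegral_test ((tsupport_deriv_subset).trans hs), setIntegral_test hs,
    h.integral_test hφ hc]

/-- A test function on an interval with vanishing integral is the derivative of a test function
on the same interval. -/
lemma exists_test_deriv_eq {U : Set ℝ} (hU : U.OrdConnected) {φ : ℝ → ℝ} (hφ : ContDiff ℝ ∞ φ)
    (hc : HasCompactSupport φ) (hs : tsupport φ ⊆ U) (h0 : ∫ x, φ x = 0) :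
    ∃ Φ : ℝ → ℝ, ContDiff ℝ ∞ Φ ∧ HasCompactSupport Φ ∧ tsupport Φ ⊆ U ∧ deriv Φ = φ := by
  rcases (tsupport φ).eq_empty_or_nonempty with he | hne
  · have hz : φ = 0 := tsupport_eq_empty_iff.1 he
    exact ⟨0, contDiff_const, HasCompactSupport.zero, by simp [tsupport], by
      rw [hz]; ext x; simp⟩
  have hK : IsCompact (tsupport φ) := hc
  set α := sInf (tsupport φ)
  set β := sSup (tsupport φ)
  have hα : α ∈ U := hs (hK.sInf_mem hne)
  have hβ : β ∈ U := hs (hK.sSup_mem hne)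
  have hsub : ∀ x, φ x ≠ 0 → x ∈ Icc α β := fun x hx =>
    have := subset_tsupport φ hx
    ⟨csInf_le hK.bddBelow this, le_csSup hK.bddAbove this⟩
  have hint : Integrable φ := hφ.continuous.integrable_of_hasCompactSupport hc
  set Φ : ℝ → ℝ := fun x => ∫ t in α..x, φ t
  have hd : ∀ x, HasDerivAt Φ (φ x) x := fun x =>
    intervalIntegral.integral_hasDerivAt_right (hφ.continuous.intervalIntegrable _ _)
      hφ.continuous.aestronglyMeasurable.stronglyMeasurableAtFilter hφ.continuous.continuousAt
  have hderiv : deriv Φ = φ := funext fun x => (hd x).deriv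
  have hzero : ∀ x, x ∉ Icc α β → Φ x = 0 := by
    intro x hx
    rcases lt_or_ge x α with h | h
    · refine intervalIntegral.integral_zero_ae (Eventually.of_forall fun t ht => ?_)
      by_contra hne
      rw [uIoc_of_ge h.le] at ht
      have hαt := (hsub t hne).1
      have htα : t = α := le_antisymm ht.2 hαt
      -- `α` is an endpoint of the support, so `φ α = 0` by continuity
      have : ∀ᶠ y in 𝓝 t, φ y ≠ 0 := hφ.continuous.continuousAt.eventually_ne hne
      obtain ⟨y, hy1, hy2⟩ := (this.filter_mono nhdsWithin_le_nhds |>.and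
        (self_mem_nhdsWithin : Iio t ∈ 𝓝[<] t)).exists
      exact absurd ((hsub y hy1).1) (not_le.2 (htα ▸ hy2))
    · have hxβ : β < x := by
        by_contra hle
        exact hx ⟨h, not_lt.1 hle⟩
      change ∫ t in α..x, φ t = 0
      rw [← h0, intervalIntegral.integral_of_le h,
        ← integral_Icc_eq_integral_Ioc]
      refine setIntegral_eq_integral_of_forall_compl_eq_zero fun t ht => ?_
      by_contra hne
      exact ht ⟨(hsub t hne).1, (hsub t hne).2.trans hxβ.le⟩
  have hts : tsupport Φ ⊆ Icc α β :=
    closure_minimal (fun x hx => by_contra fun h => hx (hzero x h)) isClosed_Icc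
  refine ⟨Φ, ?_, HasCompactSupport.of_support_subset_isCompact isCompact_Icc
    ((subset_tsupport Φ).trans hts), hts.trans (hU.out hα hβ), hderiv⟩
  rw [contDiff_infty_iff_deriv, hderiv]
  exact ⟨fun x => (hd x).differentiableAt, hφ⟩

/-- **Lemma of du Bois-Reymond**: a locally integrable function on an open interval whose weak
derivative vanishes is almost everywhere constant. -/
lemma ae_eq_const_of_integral_deriv_eq_zero {U : Set ℝ} (hU : IsOpen U) (hc : U.OrdConnected)
    (hne : U.Nonempty) {w : ℝ → ℂ} (hw : LocallyIntegrable w)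
    (h : ∀ φ : ℝ → ℝ, ContDiff ℝ ∞ φ → HasCompactSupport φ → tsupport φ ⊆ U →
      ∫ x, deriv φ x • w x = 0) : ∃ c : ℂ, ∀ᵐ x, x ∈ U → w x = c := by
  obtain ⟨x₀, hx₀⟩ := hne
  obtain ⟨ε, hε, hball⟩ := Metric.isOpen_iff.1 hU x₀ hx₀
  let b : ContDiffBump x₀ := ⟨ε / 4, ε / 2, by positivity, by linarith⟩
  set η : ℝ → ℝ := b.normed volume
  have hη : ContDiff ℝ ∞ η := b.contDiff_normed
  have hηc : HasCompactSupport η := b.hasCompactSupport_normed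
  have hηs : tsupport η ⊆ U := by
    rw [b.tsupport_normed_eq]
    exact (Metric.closedBall_subset_ball (by change ε / 2 < ε; linarith)).trans hball
  have hηi : ∫ x, η x = 1 := b.integral_normed
  set c : ℂ := ∫ x, η x • w x
  refine ⟨c, ?_⟩
  have hint : ∀ φ : ℝ → ℝ, ContDiff ℝ ∞ φ → HasCompactSupport φ →
      Integrable fun x => φ x • w x := fun φ hφ hc =>
    hw.integrable_smul_left_of_hasCompactSupport hφ.continuous hc
  have key := hU.ae_eq_zero_of_integral_contDiff_smul_eq_zero (f := fun x => w x - c)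
    (μ := volume)
    ((hw.sub (continuous_const.locallyIntegrable)).locallyIntegrableOn U) (by
      intro φ hφ hφc hφs
      set a := ∫ x, φ x
      have hφi : Integrable φ := hφ.continuous.integrable_of_hasCompactSupport hφc
      have hηint : Integrable η := hη.continuous.integrable_of_hasCompactSupport hηc
      have hsupp : tsupport (fun x => φ x - a * η x) ⊆ tsupport φ ∪ tsupport η := by
        refine closure_minimal (fun x hx => ?_)
          ((isClosed_tsupport φ).union (isClosed_tsupport η))
        by_contra hn
        rw [mem_union, not_or] at hn
        apply hx
        simp [image_eq_zero_of_notMem_tsupport hn.1, image_eq_zero_of_notMem_tsupport hn.2]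
      obtain ⟨Φ, h1, h2, h3, h4⟩ := exists_test_deriv_eq hc (φ := fun x => φ x - a * η x)
        (hφ.sub (contDiff_const.mul hη))
        (HasCompactSupport.intro (K := tsupport φ ∪ tsupport η)
          (hφc.isCompact.union hηc.isCompact) (fun x hx => by
            by_contra hn
            exact hx (hsupp (subset_tsupport _ hn))))
        (hsupp.trans (union_subset hφs hηs)) (by
          rw [integral_sub hφi (hηint.const_mul a), integral_const_mul, hηi, mul_one, sub_self])
      have h5 := h Φ h1 h2 h3
      rw [h4] at h5
      have e1 : ∀ x, (φ x - a * η x) • w x = φ x • w x - a • (η x • w x) := fun x => by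
        rw [sub_smul, mul_smul]
      simp only [e1] at h5
      rw [integral_sub (hint φ hφ hφc) ((hint η hη hηc).fun_smul a), integral_smul] at h5
      simp only [smul_sub]
      rw [integral_sub (hint φ hφ hφc) (hφi.smul_const c), integral_smul_const]
      exact h5)
  filter_upwards [key] with x hx hxU
  exact sub_eq_zero.1 (hx hxU)

lemma memLp_indicator_L2 {U : Set ℝ} (hU : MeasurableSet U) (g : L2 U) :
    MemLp (U.indicator g) 2 volume :=
  (memLp_indicator_iff_restrict hU).2 (Lp.memLp g)

lemma intervalIntegrable_of_memLp {E : Type*} [NormedAddCommGroup E] {g : ℝ → E}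
    (hg : MemLp g 2 volume) (a b : ℝ) : IntervalIntegrable g volume a b :=
  (intervalIntegrable_iff' (by finiteness)).2
    ((hg.locallyIntegrable (by norm_num)).integrableOn_isCompact isCompact_uIcc)

/-- A function with a weak derivative on an open interval has an absolutely continuous
representative. -/
lemma HasWeakDeriv.exists_isPrim {U : Set ℝ} (hU : IsOpen U) (hc : U.OrdConnected)
    (hne : U.Nonempty) {u g : L2 U} (h : HasWeakDeriv U u g) :
    ∃ v : ℝ → ℂ, IsPrim v (U.indicator g) ∧ u =ᵐ[volume.restrict U] v := by
  have hg := memLp_indicator_L2 hU.measurableSet g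
  have hu := memLp_indicator_L2 hU.measurableSet u
  have hG := IsPrim.primitive (intervalIntegrable_of_memLp hg) 0
  set G : ℝ → ℂ := fun x => ∫ t in (0 : ℝ)..x, U.indicator g t
  obtain ⟨c, hc⟩ := ae_eq_const_of_integral_deriv_eq_zero hU hc hne
    (w := fun x => U.indicator u x - G x)
    ((hu.locallyIntegrable (by norm_num)).sub hG.continuous.locallyIntegrable) (by
      intro φ hφ hφc hφs
      have hds : tsupport (deriv φ) ⊆ U := (tsupport_deriv_subset).trans hφs
      have hd := contDiff_deriv_continuous hφ
      have e1 : ∫ x, deriv φ x • U.indicator u x = ∫ x in U, deriv φ x • u x := by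
        rw [← setIntegral_test hds]
        exact setIntegral_congr_fun hU.measurableSet fun x hx => by simp [indicator_of_mem hx]
      have e2 : ∫ x, φ x • U.indicator g x = ∫ x in U, φ x • g x := by
        rw [← setIntegral_test hφs]
        exact setIntegral_congr_fun hU.measurableSet fun x hx => by simp [indicator_of_mem hx]
      simp only [smul_sub]
      rw [integral_sub, hG.integral_test hφ hφc, e1, e2, h φ hφ hφc hφs, sub_self]
      · exact (hu.locallyIntegrable (by norm_num)).integrable_smul_left_of_hasCompactSupport
          hd hφc.deriv
      · exact hG.continuous.locallyIntegrable.integrable_smul_left_of_hasCompactSupport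
          hd hφc.deriv)
  refine ⟨fun x => G x + c, ⟨hG.intervalIntegrable, fun a b => ?_⟩, ?_⟩
  · rw [hG.integral_eq]; ring
  · rw [EventuallyEq, ae_restrict_iff' hU.measurableSet]
    filter_upwards [hc] with x hx hxU
    rw [← hx hxU, indicator_of_mem hxU]
    ring

end RDM

namespace RDM

open MeasureTheory Set Filter Topology
open scoped ContDiff

/-! ### Resolvents of form-bounded Schrödinger operators -/

section Graph

variable {E : Type*} [NormedAddCommGroup E] [NormedSpace ℂ E]

lemma mem_resolventSet_iff {T : E →ₗ.[ℂ] E} {z : ℂ} :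
    z ∈ resolventSet T ↔ ∃ R : E →L[ℂ] E, (∀ p ∈ T.graph, R (p.2 - z • p.1) = p.1) ∧
      ∀ y, (R y, y + z • R y) ∈ T.graph := by
  constructor
  · rintro ⟨R, h1, h2⟩
    refine ⟨R, fun p hp => ?_, fun y => ?_⟩
    · obtain ⟨x, hx1, hx2⟩ := (LinearPMap.mem_graph_iff T).1 hp
      rw [← hx1, ← hx2, h1]
    · obtain ⟨x, hx1, hx2⟩ := h2 y
      refine (LinearPMap.mem_graph_iff T).2 ⟨x, hx1, ?_⟩
      rw [← hx1, ← hx2]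
      simp
  · rintro ⟨R, h1, h2⟩
    refine ⟨R, fun x => h1 _ (T.mem_graph x), fun y => ?_⟩
    obtain ⟨x, hx1, hx2⟩ := (LinearPMap.mem_graph_iff T).1 (h2 y)
    refine ⟨x, hx1, ?_⟩
    rw [hx2, hx1]
    simp

/-- Weyl's criterion (the easy half): approximate eigenvectors force spectrum. -/
lemma mem_realSpectrum_of_approx {T : E →ₗ.[ℂ] E} {t : ℝ}
    (h : ∀ ε > 0, ∃ p ∈ T.graph, ‖p.2 - (t : ℂ) • p.1‖ ≤ ε * ‖p.1‖ ∧ p.1 ≠ 0) :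
    t ∈ realSpectrum T := by
  intro ht
  obtain ⟨R, h1, -⟩ := mem_resolventSet_iff.1 ht
  obtain ⟨p, hp, h2, h3⟩ := h (1 / (2 * (‖R‖ + 1))) (by positivity)
  have h4 : ‖p.1‖ ≤ ‖R‖ * (1 / (2 * (‖R‖ + 1)) * ‖p.1‖) := by
    calc ‖p.1‖ = ‖R (p.2 - (t : ℂ) • p.1)‖ := by rw [h1 p hp]
      _ ≤ ‖R‖ * ‖p.2 - (t : ℂ) • p.1‖ := R.le_opNorm _
      _ ≤ _ := by gcongr
  have h5 : 0 < ‖p.1‖ := norm_pos_iff.2 h3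
  have h6 : ‖R‖ * (1 / (2 * (‖R‖ + 1)) * ‖p.1‖) < 1 * ‖p.1‖ := by
    rw [← mul_assoc]
    refine mul_lt_mul_of_pos_right ?_ h5
    rw [mul_one_div, div_lt_one (by positivity)]
    linarith [norm_nonneg R]
  linarith

end Graph

section Mul

variable {U : Set ℝ} {V : ℝ → ℝ} {C : ℝ}

/-- A bounded potential acts on `L²(U)` as an everywhere defined bounded operator. -/
lemma exists_mulOp_eq (hV : AEStronglyMeasurable V (volume.restrict U))
    (hC : ∀ᵐ x ∂volume.restrict U, |V x| ≤ C) :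
    ∃ M : L2 U →L[ℂ] L2 U, (∀ u f, (u, f) ∈ (mulOp U V).graph ↔ f = M u) ∧
      (∀ u, M u =ᵐ[volume.restrict U] fun x => (V x : ℂ) * u x) ∧
      ∀ u, ‖M u‖ ≤ C * ‖u‖ := by
  have hdom : ∀ u : L2 U, u ∈ (mulOp U V).domain := fun u => by
    refine MemLp.of_le_mul (c := C) (Lp.memLp u)
      ((Complex.continuous_ofReal.comp_aestronglyMeasurable hV).mul
        (Lp.aestronglyMeasurable u)) ?_
    filter_upwards [hC] with x hx
    rw [norm_mul, Complex.norm_real, Real.norm_eq_abs]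
    gcongr
  have hae : ∀ u : L2 U, mulOp U V ⟨u, hdom u⟩ =ᵐ[volume.restrict U]
      fun x => (V x : ℂ) * u x := fun u => MemLp.coeFn_toLp (hdom u)
  have hnorm : ∀ u : L2 U, ‖mulOp U V ⟨u, hdom u⟩‖ ≤ C * ‖u‖ := fun u => by
    refine Lp.norm_le_mul_norm_of_ae_le_mul ?_
    filter_upwards [hC, hae u] with x hx hx2
    rw [hx2, norm_mul, Complex.norm_real, Real.norm_eq_abs]
    gcongr
  let L : L2 U →ₗ[ℂ] L2 U :=
    (mulOp U V).toFun.comp (LinearMap.id.codRestrict (mulOp U V).domain hdom)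
  refine ⟨L.mkContinuous C hnorm, fun u f => ?_, hae, hnorm⟩
  rw [LinearPMap.mem_graph_iff]
  constructor
  · rintro ⟨y, rfl, rfl⟩
    rfl
  · rintro rfl
    exact ⟨⟨u, hdom u⟩, rfl, rfl⟩

lemma mem_graph_add_mulOp {A : L2 U →ₗ.[ℂ] L2 U} {M : L2 U →L[ℂ] L2 U}
    (hM : ∀ u f, (u, f) ∈ (mulOp U V).graph ↔ f = M u) {u f : L2 U} :
    (u, f) ∈ (A + mulOp U V).graph ↔ (u, f - M u) ∈ A.graph := by
  simp only [LinearPMap.mem_graph_iff] at *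
  constructor
  · rintro ⟨y, rfl, hy⟩
    refine ⟨⟨y, y.2.1⟩, rfl, ?_⟩
    rw [← (hM y _).1 ⟨⟨y, y.2.2⟩, rfl, rfl⟩]
    rw [LinearPMap.add_apply] at hy
    exact eq_sub_of_add_eq hy
  · rintro ⟨y, rfl, hy⟩
    obtain ⟨w, hw1, hw2⟩ := (hM y _).2 rfl
    have hw : (y : L2 U) ∈ (mulOp U V).domain := hw1 ▸ w.2
    refine ⟨⟨y, y.2, hw⟩, rfl, ?_⟩
    rw [LinearPMap.add_apply]
    have e : w = ⟨y, hw⟩ := Subtype.ext hw1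
    rw [e] at hw2
    change A y + mulOp U V ⟨y, hw⟩ = f
    rw [hw2, hy, sub_add_cancel]

/-- The quadratic form of a bounded potential. -/
lemma re_inner_eq_integral {M : L2 U →L[ℂ] L2 U}
    (hM : ∀ u, M u =ᵐ[volume.restrict U] fun x => (V x : ℂ) * u x) (u : L2 U) :
    (inner ℂ u (M u)).re = ∫ x in U, V x * ‖u x‖ ^ 2 := by
  rw [L2.inner_def]
  have : ∫ x in U, inner ℂ (u x) (M u x) = ∫ x in U, ((V x * ‖u x‖ ^ 2 : ℝ) : ℂ) := by
    refine integral_congr_ae ?_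
    filter_upwards [hM u] with x hx
    rw [hx, RCLike.inner_apply]
    push_cast
    rw [mul_assoc, Complex.mul_conj']
  rw [this, integral_complex_ofReal, Complex.ofReal_re]

end Mul

section LaxMilgram

lemma integral_test_eq_inner {U : Set ℝ} {φ : ℝ → ℝ} (hφ : Continuous φ)
    (hc : HasCompactSupport φ) (u : L2 U) :
    ∫ x in U, φ x • u x = inner ℂ (testL2 U φ hφ hc) u := by
  rw [L2.inner_def]
  refine integral_congr_ae ?_
  filter_upwards [testL2_coe (U := U) hφ hc] with x hx
  rw [hx]
  simp [mul_comm]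

/-- The Sobolev space `H¹(U)`, as the graph of the weak derivative in `L²(U) × L²(U)`. -/
def sobolev (U : Set ℝ) : Submodule ℂ (WithLp 2 (L2 U × L2 U)) where
  carrier := {p | HasWeakDeriv U p.ofLp.1 p.ofLp.2}
  add_mem' h1 h2 := h1.add h2
  zero_mem' := HasWeakDeriv.zero U
  smul_mem' c _ h := h.smul c

lemma isClosed_sobolev (U : Set ℝ) : IsClosed (sobolev U : Set (WithLp 2 (L2 U × L2 U))) := by
  have : (sobolev U : Set (WithLp 2 (L2 U × L2 U))) = ⋂ (φ : ℝ → ℝ) (_ : ContDiff ℝ ∞ φ)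
      (_ : HasCompactSupport φ) (_ : tsupport φ ⊆ U), {p : WithLp 2 (L2 U × L2 U) |
        ∫ x in U, deriv φ x • p.ofLp.1 x = - ∫ x in U, φ x • p.ofLp.2 x} := by
    ext p
    simp only [mem_iInter]
    rfl
  rw [this]
  refine isClosed_iInter fun φ => isClosed_iInter fun hφ => isClosed_iInter fun hc =>
    isClosed_iInter fun hs => ?_
  simp only [integral_test_eq_inner (contDiff_deriv_continuous hφ) hc.deriv,
    integral_test_eq_inner hφ.continuous hc]
  have h1 : Continuous fun p : WithLp 2 (L2 U × L2 U) => p.ofLp.1 :=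
    (WithLp.fstL 2 ℂ (L2 U) (L2 U)).continuous
  have h2 : Continuous fun p : WithLp 2 (L2 U × L2 U) => p.ofLp.2 :=
    (WithLp.sndL 2 ℂ (L2 U) (L2 U)).continuous
  exact isClosed_eq (continuous_const.inner h1) (continuous_const.inner h2).neg

instance (U : Set ℝ) : CompleteSpace (sobolev U) :=
  (isClosed_sobolev U).completeSpace_coe

/-- If the form of `-d²/dx² + V` on `H¹(U)` is bounded below by `γ`, then every real number below
`γ` lies in the resolvent set. The resolvent is produced by the Lax–Milgram argument. -/
theorem not_mem_realSpectrum_of_form_bound {U : Set ℝ} (hU : IsOpen U) {V : ℝ → ℝ} {C γ : ℝ}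
    (hV : AEStronglyMeasurable V (volume.restrict U))
    (hC : ∀ᵐ x ∂volume.restrict U, |V x| ≤ C)
    (hγ : ∀ u g : L2 U, HasWeakDeriv U u g →
      γ * ‖u‖ ^ 2 ≤ ‖g‖ ^ 2 + ∫ x in U, V x * ‖u x‖ ^ 2) {t : ℝ} (ht : t < γ) :
    t ∉ realSpectrum (neumannLaplacian U + mulOp U V) := by
  obtain ⟨M, hM1, hM2, hM3⟩ := exists_mulOp_eq hV hC
  -- the sesquilinear form of `-d²/dx² + V - t`, as a bounded operator on `H¹(U)`
  let e := WithLp.prodContinuousLinearEquiv 2 ℂ (L2 U) (L2 U)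
  let T : WithLp 2 (L2 U × L2 U) →L[ℂ] WithLp 2 (L2 U × L2 U) :=
    (e.symm : (L2 U × L2 U) →L[ℂ] WithLp 2 (L2 U × L2 U)) ∘L
      ((M - (t : ℂ) • ContinuousLinearMap.id ℂ (L2 U)).prodMap
        (ContinuousLinearMap.id ℂ (L2 U))) ∘L (e : WithLp 2 (L2 U × L2 U) →L[ℂ] L2 U × L2 U)
  let P := (sobolev U).orthogonalProjectionOnto
  let B : sobolev U →L[ℂ] sobolev U := P ∘L T ∘L (sobolev U).subtypeL
  have hB : ∀ v w : sobolev U, inner ℂ v (B w)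
      = inner ℂ (v : WithLp 2 (L2 U × L2 U)).ofLp.1
          (M (w : WithLp 2 (L2 U × L2 U)).ofLp.1 - (t : ℂ) • (w : WithLp 2 (L2 U × L2 U)).ofLp.1)
        + inner ℂ (v : WithLp 2 (L2 U × L2 U)).ofLp.2 (w : WithLp 2 (L2 U × L2 U)).ofLp.2 := by
    intro v w
    change inner ℂ v ((sobolev U).orthogonalProjectionOnto (T w)) = _
    rw [Submodule.inner_orthogonalProjectionOnto_eq_of_mem_left, WithLp.prod_inner_apply]
    rfl
  have hsq : ∀ g : L2 U, (inner ℂ g g : ℂ).re = ‖g‖ ^ 2 := fun g =>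
    inner_self_eq_norm_sq (𝕜 := ℂ) g
  have hform : ∀ u g : L2 U, HasWeakDeriv U u g →
      (γ - t) * ‖u‖ ^ 2 ≤ (inner ℂ u (M u - (t : ℂ) • u)).re + ‖g‖ ^ 2 := by
    intro u g hug
    have h1 := hγ u g hug
    rw [← re_inner_eq_integral hM2 u] at h1
    rw [inner_sub_right, inner_smul_right, Complex.sub_re, Complex.re_ofReal_mul, hsq]
    linarith
  have hlow : ∀ u : L2 U, -(C + |t|) * ‖u‖ ^ 2 ≤ (inner ℂ u (M u - (t : ℂ) • u)).re := by
    intro u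
    have h1 : ‖(inner ℂ u (M u - (t : ℂ) • u) : ℂ)‖ ≤ ‖u‖ * (C * ‖u‖ + |t| * ‖u‖) := by
      refine (norm_inner_le_norm _ _).trans ?_
      gcongr
      refine (norm_sub_le _ _).trans ?_
      rw [norm_smul, Complex.norm_real, Real.norm_eq_abs]
      gcongr
      exact hM3 u
    have h2 := (abs_le.1 ((Complex.abs_re_le_norm _).trans h1)).1
    nlinarith
  set a := γ - t
  have ha : 0 < a := sub_pos.2 ht
  set K := |C| + |t|
  have hK : 0 ≤ K := by positivity
  set c : ℝ := a / (a + K + 1)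
  have hc : 0 < c := by positivity
  have hcoer : ∀ w : sobolev U, ‖w‖ ^ 2 * c ≤ ‖(inner ℂ (B w) w : ℂ)‖ := by
    intro w
    refine le_of_le_of_eq ?_ (norm_inner_symm (𝕜 := ℂ) w (B w))
    refine le_trans ?_ (Complex.re_le_norm _)
    rw [hB]
    set u := (w : WithLp 2 (L2 U × L2 U)).ofLp.1
    set g := (w : WithLp 2 (L2 U × L2 U)).ofLp.2
    have h1 := hform u g w.2
    have h2 := hlow u
    have h3 : ‖w‖ ^ 2 = ‖u‖ ^ 2 + ‖g‖ ^ 2 := WithLp.prod_norm_sq_eq_of_L2 _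
    rw [Complex.add_re, hsq, h3]
    set Q := (inner ℂ u (M u - (t : ℂ) • u)).re
    have h5 : -K * ‖u‖ ^ 2 ≤ Q := by
      refine le_trans ?_ h2
      have : C ≤ |C| := le_abs_self C
      nlinarith [sq_nonneg ‖u‖]
    change _ * (a / (a + K + 1)) ≤ _
    rw [← mul_div_assoc, div_le_iff₀ (by positivity)]
    nlinarith [sq_nonneg ‖u‖, sq_nonneg ‖g‖]
  obtain ⟨b, hb⟩ := ContinuousLinearMap.isUnit_of_forall_le_norm_inner_map B
    (c := ⟨c, hc.le⟩) hc hcoer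
  have hBinv : ∀ y, B ((b⁻¹ : (sobolev U →L[ℂ] sobolev U)ˣ).1 y) = y := fun y => by
    have := congrArg (fun f : sobolev U →L[ℂ] sobolev U => f y) b.mul_inv
    rw [hb] at this
    exact this
  let J : L2 U →L[ℂ] WithLp 2 (L2 U × L2 U) :=
    (e.symm : (L2 U × L2 U) →L[ℂ] WithLp 2 (L2 U × L2 U)) ∘L ContinuousLinearMap.inl ℂ _ _
  let S : L2 U →L[ℂ] sobolev U := (b⁻¹ : (sobolev U →L[ℂ] sobolev U)ˣ).1 ∘L P ∘L J
  let R : L2 U →L[ℂ] L2 U := (WithLp.fstL 2 ℂ (L2 U) (L2 U)) ∘L (sobolev U).subtypeL ∘L S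
  have hsurj : ∀ y, (R y, y + (t : ℂ) • R y) ∈ (neumannLaplacian U + mulOp U V).graph := by
    intro y
    rw [mem_graph_add_mulOp hM1, neumannLaplacian_graph hU]
    refine ⟨((S y : sobolev U) : WithLp 2 (L2 U × L2 U)).ofLp.2, (S y).2, fun v w hvw => ?_⟩
    have h1 := hB ⟨WithLp.toLp 2 (v, w), hvw⟩ (S y)
    have h2 : B (S y) = P (J y) := hBinv _
    rw [h2] at h1
    change inner ℂ _ ((sobolev U).orthogonalProjectionOnto (J y)) = _ at h1
    rw [Submodule.inner_orthogonalProjectionOnto_eq_of_mem_left, WithLp.prod_inner_apply] at h1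
    change inner ℂ v y + inner ℂ w (0 : L2 U)
      = inner ℂ v (M (R y) - (t : ℂ) • R y) + inner ℂ w _ at h1
    change inner ℂ w _ = inner ℂ v (y + (t : ℂ) • R y - M (R y))
    rw [inner_zero_right, add_zero] at h1
    rw [inner_sub_right] at h1 ⊢
    rw [inner_add_right]
    linear_combination -h1
  refine not_not.2 (mem_resolventSet_iff.2 ⟨R, ?_, hsurj⟩)
  · have hinj : ∀ p : L2 U × L2 U, p ∈ (neumannLaplacian U + mulOp U V).graph →
        p.2 - (t : ℂ) • p.1 = 0 → p.1 = 0 := by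
      rintro ⟨u, f⟩ hp h0
      rw [mem_graph_add_mulOp hM1, neumannLaplacian_graph hU] at hp
      obtain ⟨g, h1, h2⟩ := hp
      have h3 := h2 u g h1
      have h4 : f = (t : ℂ) • u := sub_eq_zero.1 h0
      have h5 := hform u g h1
      have h6 : (inner ℂ u (M u - (t : ℂ) • u)).re + ‖g‖ ^ 2 = 0 := by
        have e1 : inner ℂ u (M u - (t : ℂ) • u) = -inner ℂ g g := by
          rw [h3, h4, ← inner_neg_right, neg_sub]
        rw [e1, Complex.neg_re, hsq, neg_add_cancel]
      rw [h6] at h5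
      have h7 : ‖u‖ ^ 2 ≤ 0 := by
        by_contra hpos
        have := mul_pos ha (not_le.1 hpos)
        linarith
      exact norm_eq_zero.1 (pow_eq_zero_iff two_ne_zero |>.1 (le_antisymm h7 (sq_nonneg _)))
    intro p hp
    have h1 := Submodule.sub_mem _ hp (hsurj (p.2 - (t : ℂ) • p.1))
    have h2 := hinj _ h1 (by
      simp only [Prod.snd_sub, Prod.fst_sub, smul_sub]
      abel)
    exact (sub_eq_zero.1 h2).symm

end LaxMilgram

end RDM

namespace RDM

open MeasureTheory Set Filter Topology
open scoped ContDiff ComplexConjugate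

/-! ### The Laplacian on the line as a form operator -/

lemma ae_of_ae_restrict_univ {p : ℝ → Prop} (h : ∀ᵐ x ∂volume.restrict univ, p x) :
    ∀ᵐ x, p x := by
  rwa [Measure.restrict_univ] at h

/-- The absolutely continuous representative of an `H¹(ℝ)` function. -/
lemma HasWeakDeriv.exists_isPrim_univ {u g : L2 univ} (h : HasWeakDeriv univ u g) :
    ∃ v : ℝ → ℂ, IsPrim v g ∧ u =ᵐ[volume] v := by
  obtain ⟨v, h1, h2⟩ := h.exists_isPrim isOpen_univ ordConnected_univ univ_nonempty
  rw [indicator_univ] at h1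
  exact ⟨v, h1, ae_of_ae_restrict_univ h2⟩

lemma memLp_univ (u : L2 univ) : MemLp u 2 volume := by
  simpa only [Measure.restrict_univ] using Lp.memLp u

lemma integrable_conj_mul {u v : ℝ → ℂ} (hu : MemLp u 2) (hv : MemLp v 2) :
    Integrable fun x => conj (u x) * v x :=
  hu.star.integrable_mul hv

lemma inner_univ_eq (u v : L2 univ) : inner ℂ u v = ∫ x, conj (u x) * v x := by
  rw [L2.inner_def]
  simp only [Measure.restrict_univ, RCLike.inner_apply, mul_comm]

/-- On the line the operator domain `H²` and the form domain `H¹` define the same Laplacian. -/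
lemma negLaplacian_eq : negLaplacian = neumannLaplacian univ := by
  have : negLaplacianGraph = neumannGraph univ := by
    ext ⟨u, f⟩
    constructor
    · rintro ⟨g, h1, h2⟩
      refine ⟨g, h1, fun v w hvw => ?_⟩
      obtain ⟨v', hv1, hv2⟩ := hvw.exists_isPrim_univ
      obtain ⟨g', hg1, hg2⟩ := h2.exists_isPrim_univ
      have hv'2 : MemLp v' 2 := (memLp_univ v).ae_eq hv2
      have hg'2 : MemLp g' 2 := (memLp_univ g).ae_eq hg2
      have hp := hv1.star.mul_complex hg1
      have i1 := integrable_conj_mul (memLp_univ w) hg'2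
      have i2 := integrable_conj_mul hv'2 (memLp_univ (-f))
      have key := hp.integral_eq_zero (integrable_conj_mul hv'2 hg'2) (i1.add i2)
      rw [integral_add i1 i2] at key
      have hneg : ((-f : L2 univ) : ℝ → ℂ) =ᵐ[volume] -f :=
        ae_of_ae_restrict_univ (Lp.coeFn_neg f)
      rw [inner_univ_eq, inner_univ_eq]
      have e1 : ∫ x, conj (w x) * g x = ∫ x, conj (w x) * g' x :=
        integral_congr_ae (hg2.mono fun x hx => by simp only [hx])
      have e2 : ∫ x, conj (v x) * f x = -∫ x, conj (v' x) * (-f : L2 univ) x := by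
        rw [← integral_neg]
        refine integral_congr_ae ?_
        filter_upwards [hv2, hneg] with x h3 h4
        rw [h3, h4, Pi.neg_apply]
        ring
      change ∫ x, conj (w x) * g x = ∫ x, conj (v x) * f x
      rw [e1, e2]
      exact eq_neg_of_add_eq_zero_left key
    · rintro ⟨g, h1, h2⟩
      refine ⟨g, h1, fun φ hφ hc _ => ?_⟩
      have := h2 _ _ (testL2_hasWeakDeriv (U := univ) hφ hc)
      rw [← integral_test_eq_inner, ← integral_test_eq_inner] at this
      rw [this, ← integral_neg]
      refine integral_congr_ae ?_
      filter_upwards [Lp.coeFn_neg f] with x hx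
      change φ x • f x = -(φ x • (-f : L2 univ) x)
      rw [hx, Pi.neg_apply, smul_neg, neg_neg]
  rw [negLaplacian, neumannLaplacian, this]

end RDM

namespace RDM

open MeasureTheory Set Filter Topology

/-! ### The Neumann ground state through the Riccati equation -/

/-- `p` is the logarithmic derivative of a positive Neumann solution of `-φ'' + V φ = E φ` on the
unit cell: it solves the Riccati equation `p' = V - E - p²` there and vanishes at both ends.
It is extended by zero to the whole line. -/
structure IsRiccati (V : ℝ → ℝ) (E : ℝ) (p : ℝ → ℝ) : Prop where
  isPrim : IsPrim p (unitCell.indicator fun x => V x - E - p x ^ 2)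
  eq_zero : ∀ x ∉ unitCell, p x = 0

/-- The square of a number truncated to `[-M, M]`: a bounded Lipschitz version of `x ↦ x ^ 2`. -/
def truncSq (M x : ℝ) : ℝ := max (-M) (min M x) ^ 2

section Truncation

variable {M : ℝ}

lemma abs_trunc_le (hM : 0 ≤ M) (x : ℝ) : |max (-M) (min M x)| ≤ M :=
  abs_le.2 ⟨le_max_left _ _, max_le (by linarith) (min_le_left _ _)⟩

lemma truncSq_nonneg (M x : ℝ) : 0 ≤ truncSq M x := sq_nonneg _

lemma truncSq_le (hM : 0 ≤ M) (x : ℝ) : truncSq M x ≤ M ^ 2 :=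
  sq_le_sq' (abs_le.1 (abs_trunc_le hM x)).1 (abs_le.1 (abs_trunc_le hM x)).2

lemma truncSq_eq (hx : |x| ≤ M) : truncSq M x = x ^ 2 := by
  rw [truncSq, min_eq_right (abs_le.1 hx).2, max_eq_right (abs_le.1 hx).1]

lemma continuous_truncSq (M : ℝ) : Continuous (truncSq M) := by
  unfold truncSq; fun_prop

lemma abs_truncSq_sub_le (hM : 0 ≤ M) (x y : ℝ) :
    |truncSq M x - truncSq M y| ≤ 2 * M * |x - y| := by
  have h1 : |max (-M) (min M x) - max (-M) (min M y)| ≤ |x - y| :=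
    (abs_max_sub_max_le_max _ _ _ _).trans (max_le (by simp) ((abs_min_sub_min_le_max _ _ _ _).trans
      (by simp)))
  have h2 : |max (-M) (min M x) + max (-M) (min M y)| ≤ 2 * M :=
    (abs_add_le _ _).trans (by linarith [abs_trunc_le hM x, abs_trunc_le hM y])
  rw [truncSq, truncSq, sq_sub_sq, abs_mul]
  gcongr

/-- The truncated square is `x` times a bounded continuous function. -/
lemma truncSq_eq_mul (hM : 0 < M) (x : ℝ) :
    truncSq M x = x * M ^ 2 / max (x ^ 2) (M ^ 2) * x := by
  rcases le_total (x ^ 2) (M ^ 2) with h | h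
  · rw [truncSq_eq (abs_le_of_sq_le_sq h hM.le), max_eq_right h]
    field_simp
  · rw [max_eq_left h]
    have hx : x ≠ 0 := by
      rintro rfl
      nlinarith
    have h1 : M ≤ |x| := by
      rw [← abs_of_pos hM]
      exact sq_le_sq.1 h
    have h2 : truncSq M x = M ^ 2 := by
      rcases le_abs.1 h1 with h | h
      · rw [truncSq, min_eq_left h, max_eq_right (by linarith)]
      · rw [truncSq, min_eq_right (by linarith), max_eq_left (by linarith), neg_sq]
    rw [h2]
    field_simp

end Truncation

lemma intervalIntegrable_of_bounded {V : ℝ → ℝ} {C : ℝ} (hV : Measurable V)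
    (hC : ∀ x, |V x| ≤ C) (a b : ℝ) : IntervalIntegrable V volume a b :=
  (intervalIntegrable_const (c := C)).mono_fun hV.aestronglyMeasurable
    (.of_forall fun x => by
      change |V x| ≤ |C|
      exact (hC x).trans (le_abs_self C))

/-- Solutions of the truncated Riccati equation `p' = V - E - truncSq M p`, `p (-1/2) = 0`,
depending continuously on `E`. Subtracting the primitive of `V - E` turns it into an
equation with continuous coefficients, so that Picard–Lindelöf applies. -/
lemma exists_truncated_riccati {V : ℝ → ℝ} {C M : ℝ} (hV : Measurable V) (hC : ∀ x, |V x| ≤ C)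
    (hM : 0 < M) : ∃ p : ℝ → ℝ → ℝ, Continuous (fun E => p E (1 / 2)) ∧ ∀ E,
      Continuous (p E) ∧
      ∀ x ∈ Icc (-1 / 2 : ℝ) (1 / 2), p E x = ∫ t in (-1 / 2)..x, (V t - E - truncSq M (p E t)) := by
  have hVi := intervalIntegrable_of_bounded hV hC
  set w : ℝ → ℝ := fun x => ∫ t in (-1 / 2)..x, V t
  have hw : Continuous w := intervalIntegral.continuous_primitive hVi _
  let f : ℝ → ℝ → ℝ → ℝ := fun E t y => -truncSq M (y + w t - E * (t + 1 / 2))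
  have hlip : ∀ E t, LipschitzWith (2 * M).toNNReal (f E t) := fun E t =>
    LipschitzWith.of_dist_le_mul fun x y => by
      rw [Real.coe_toNNReal _ (by positivity), Real.dist_eq, Real.dist_eq]
      have := abs_truncSq_sub_le hM.le (y + w t - E * (t + 1 / 2)) (x + w t - E * (t + 1 / 2))
      rw [abs_sub_comm x y]
      convert this using 2 <;> (simp [f]; try ring_nf)
  have hf : ∀ E t y, ‖f E t y‖ ≤ M ^ 2 := fun E t y => by
    rw [norm_neg, Real.norm_eq_abs, abs_of_nonneg (truncSq_nonneg _ _)]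
    exact truncSq_le hM.le _
  have hex : ∀ E, ∃ y : ℝ → ℝ, y (-1 / 2) = 0 ∧ ∀ t ∈ Icc (-1 / 2 : ℝ) (1 / 2),
      HasDerivWithinAt y (f E t (y t)) (Icc (-1 / 2) (1 / 2)) t := by
    intro E
    have hP : IsPicardLindelof (f E) (tmin := -1 / 2) (tmax := 1 / 2)
        ⟨-1 / 2, by constructor <;> norm_num⟩ (0 : ℝ) (M ^ 2).toNNReal 0 (M ^ 2).toNNReal
        (2 * M).toNNReal := by
      refine ⟨fun t _ => (hlip E t).lipschitzOnWith, fun x _ => ?_, fun t _ x _ => ?_, ?_⟩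
      · refine Continuous.continuousOn ?_
        exact ((continuous_truncSq M).comp (by fun_prop)).neg
      · rw [Real.coe_toNNReal _ (by positivity)]
        exact hf E t x
      · norm_num
    exact hP.exists_eq_forall_mem_Icc_hasDerivWithinAt₀
  choose y hy0 hy using hex
  have hyc : ∀ E, ContinuousOn (y E) (Icc (-1 / 2) (1 / 2)) := fun E t ht =>
    (hy E t ht).continuousWithinAt
  have hle : (-1 / 2 : ℝ) ≤ 1 / 2 := by norm_num
  refine ⟨fun E t => IccExtend hle ((Icc (-1 / 2 : ℝ) (1 / 2)).domRestrict (y E)) t + w t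
    - E * (t + 1 / 2), ?_, fun E => ⟨?_, ?_⟩⟩
  · have hlipE : LipschitzWith (Real.exp (2 * M) - 1).toNNReal fun E => y E (1 / 2) := by
      refine LipschitzWith.of_dist_le_mul fun E E' => ?_
      have hright : ∀ E, ∀ t ∈ Ico (-1 / 2 : ℝ) (1 / 2),
          HasDerivWithinAt (y E) (f E t (y E t)) (Ici t) t := fun E t ht =>
        (hy E t ⟨ht.1, ht.2.le⟩).mono_of_mem_nhdsWithin
          (mem_of_superset (Icc_mem_nhdsGE ht.2) (Icc_subset_Icc_left ht.1))
      have := dist_le_of_approx_trajectories_ODE (v := f E) (K := (2 * M).toNNReal)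
        (f := y E) (g := y E') (a := -1 / 2) (b := 1 / 2) (εf := 0) (εg := 2 * M * |E - E'|)
        (δ := 0) (f' := fun t => f E t (y E t)) (g' := fun t => f E' t (y E' t)) (hlip E)
        (hyc E) (hright E) (fun t _ => by simp) (hyc E') (hright E') (fun t ht => by
          rw [Real.dist_eq]
          have := abs_truncSq_sub_le hM.le (y E' t + w t - E * (t + 1 / 2))
            (y E' t + w t - E' * (t + 1 / 2))
          have e : y E' t + w t - E * (t + 1 / 2) - (y E' t + w t - E' * (t + 1 / 2))
            = -((E - E') * (t + 1 / 2)) := by ring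
          rw [e, abs_neg, abs_mul, abs_of_nonneg (by linarith [ht.1] : 0 ≤ t + 1 / 2)] at this
          have h1 : |E - E'| * (t + 1 / 2) ≤ |E - E'| * 1 := by
            gcongr
            linarith [ht.2]
          have h2 : |f E' t (y E' t) - f E t (y E' t)|
              = |truncSq M (y E' t + w t - E * (t + 1 / 2))
                - truncSq M (y E' t + w t - E' * (t + 1 / 2))| := by
            simp only [f]
            ring_nf
          rw [h2]
          refine this.trans ?_
          gcongr
          linarith) (by simp [hy0]) (1 / 2) (right_mem_Icc.2 hle)
      rw [gronwallBound_of_K_ne_0 (by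
        rw [Real.coe_toNNReal _ (by positivity)]; positivity)] at this
      rw [Real.coe_toNNReal _ (by positivity)] at this
      rw [Real.coe_toNNReal _ (by
        rw [sub_nonneg]; exact Real.one_le_exp (by positivity))]
      refine this.trans (le_of_eq ?_)
      rw [Real.dist_eq]
      have : (1 / 2 - -1 / 2 : ℝ) = 1 := by norm_num
      rw [this]
      field_simp
      ring
    have e : ∀ E, IccExtend hle ((Icc (-1 / 2 : ℝ) (1 / 2)).domRestrict (y E)) (1 / 2)
        = y E (1 / 2) := fun E => by
      rw [IccExtend_of_mem hle _ (right_mem_Icc.2 hle)]; rfl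
    simp only [e]
    have := hlipE.continuous
    fun_prop
  · have := (continuousOn_iff_continuous_domRestrict.1 (hyc E)).Icc_extend' (h := hle)
    fun_prop
  · intro x hx
    have e : ∀ t ∈ Icc (-1 / 2 : ℝ) (1 / 2),
        IccExtend hle ((Icc (-1 / 2 : ℝ) (1 / 2)).domRestrict (y E)) t = y E t := fun t ht => by
      rw [IccExtend_of_mem hle _ ht]; rfl
    have hsub : Icc (-1 / 2) x ⊆ Icc (-1 / 2 : ℝ) (1 / 2) := Icc_subset_Icc_right hx.2
    have hcf : ContinuousOn (fun t => f E t (y E t)) (Icc (-1 / 2) x) := by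
      refine ((continuous_truncSq M).comp_continuousOn ?_).neg
      exact (((hyc E).mono hsub).add hw.continuousOn).sub (by fun_prop)
    have h1 : ∫ t in (-1 / 2)..x, f E t (y E t) = y E x := by
      rw [intervalIntegral.integral_eq_sub_of_hasDeriv_right_of_le hx.1 ((hyc E).mono hsub)
        (f' := fun t => f E t (y E t)) (fun t ht => ?_) ?_, hy0, sub_zero]
      · exact ContinuousOn.intervalIntegrable (by rwa [uIcc_of_le hx.1])
      · exact (hy E t (hsub ⟨ht.1.le, ht.2.le⟩)).mono_of_mem_nhdsWithin (mem_of_superset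
          (Icc_mem_nhdsGT_of_mem ⟨ht.1.le, ht.2.trans_le hx.2⟩) Subset.rfl)
    have h2 : ∫ t in (-1 / 2)..x, (V t - E - truncSq M (IccExtend hle
        ((Icc (-1 / 2 : ℝ) (1 / 2)).domRestrict (y E)) t + w t - E * (t + 1 / 2)))
        = ∫ t in (-1 / 2)..x, ((V t - E) + f E t (y E t)) := by
      refine intervalIntegral.integral_congr fun t ht => ?_
      rw [uIcc_of_le hx.1] at ht
      simp only [e t (hsub ht), f]
      ring
    beta_reduce
    rw [e x hx, h2, intervalIntegral.integral_add ((hVi _ _).sub intervalIntegrable_const), h1,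
      intervalIntegral.integral_sub (hVi _ _) intervalIntegrable_const,
      intervalIntegral.integral_const]
    · simp only [smul_eq_mul]
      ring
    · exact ContinuousOn.intervalIntegrable (by rwa [uIcc_of_le hx.1])

lemma integral_le_mul_sub_of_le {g : ℝ → ℝ} {K a b : ℝ} (hab : a ≤ b)
    (hg : ∀ x ∈ Icc a b, g x ≤ K) (hi : IntervalIntegrable g volume a b) :
    ∫ x in a..b, g x ≤ K * (b - a) := by
  refine (intervalIntegral.integral_mono_on hab hi intervalIntegrable_const hg).trans ?_
  simp [mul_comm]

/-- Every bounded potential on the unit cell has a positive Neumann solution, at some energy. The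
energy is found by the intermediate value theorem, from the value of the truncated solution at the
right end; the truncation is inactive at that energy. -/
theorem exists_isRiccati {V : ℝ → ℝ} {C : ℝ} (hV : Measurable V) (hC : ∀ x, |V x| ≤ C) :
    ∃ E p, IsRiccati V E p := by
  have hC0 : 0 ≤ C := (abs_nonneg _).trans (hC 0)
  set M := 2 * C + 1
  have hM : 0 < M := by positivity
  obtain ⟨p, hpc, hp⟩ := exists_truncated_riccati hV hC hM
  have hVi := intervalIntegrable_of_bounded hV hC
  have hs : ∀ E a b, IntervalIntegrable (fun t => V t - E - truncSq M (p E t)) volume a b :=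
    fun E a b => ((hVi a b).sub intervalIntegrable_const).sub
      (((continuous_truncSq M).comp (hp E).1).intervalIntegrable a b)
  have hmem : (1 / 2 : ℝ) ∈ Icc (-1 / 2 : ℝ) (1 / 2) := by constructor <;> norm_num
  have hle : (-1 / 2 : ℝ) ≤ 1 / 2 := by norm_num
  have hp_top : p C (1 / 2) ≤ 0 := by
    rw [(hp C).2 _ hmem]
    refine (integral_le_mul_sub_of_le (K := 0) hle (fun x _ => ?_) (hs _ _ _)).trans (by simp)
    linarith [(abs_le.1 (hC x)).2, truncSq_nonneg M (p C x)]
  -- since `V + C ≥ 0`, the integrating factor `exp B` makes `p (-C)` times `exp B` nondecreasing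
  have hp_bot : 0 ≤ p (-C) (1 / 2) := by
    set P : ℝ → ℝ := fun x => ∫ t in (-1 / 2)..x, (V t - (-C) - truncSq M (p (-C) t))
    have hP : IsPrim P (fun t => V t - (-C) - truncSq M (p (-C) t)) :=
      IsPrim.primitive (hs (-C)) _
    set b : ℝ → ℝ := fun x => p (-C) x * M ^ 2 / max (p (-C) x ^ 2) (M ^ 2)
    have hb : Continuous b := by
      have := (hp (-C)).1
      refine Continuous.div (by fun_prop) (by fun_prop) fun x => ?_
      have : 0 < M ^ 2 := by positivity
      exact (lt_max_of_lt_right this).ne'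
    set B : ℝ → ℝ := fun x => ∫ t in (-1 / 2)..x, b t
    have hB : ∀ x, HasDerivAt B (b x) x := fun x =>
      intervalIntegral.integral_hasDerivAt_right (hb.intervalIntegrable _ _)
        hb.aestronglyMeasurable.stronglyMeasurableAtFilter hb.continuousAt
    have hBc : Continuous B := continuous_iff_continuousAt.2 fun x => (hB x).continuousAt
    have hexp : IsPrim (fun x => Real.exp (B x)) (fun x => Real.exp (B x) * b x) :=
      IsPrim.of_hasDerivAt (fun x => (hB x).exp) (by fun_prop)
    have key := (hP.mul hexp).integral_eq (-1 / 2) (1 / 2)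
    have hnn : 0 ≤ ∫ x in (-1 / 2)..(1 / 2), ((V x - (-C) - truncSq M (p (-C) x)) * Real.exp (B x)
        + P x * (Real.exp (B x) * b x)) := by
      refine intervalIntegral.integral_nonneg hle fun x hx => ?_
      have e1 : P x = p (-C) x := ((hp (-C)).2 x hx).symm
      have e2 := truncSq_eq_mul hM (p (-C) x)
      have e3 : (V x - (-C) - truncSq M (p (-C) x)) * Real.exp (B x)
        + P x * (Real.exp (B x) * b x) = (V x + C) * Real.exp (B x) := by
        rw [e1, e2]
        ring
      rw [e3]
      have := (abs_le.1 (hC x)).1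
      exact mul_nonneg (by linarith) (Real.exp_pos _).le
    rw [key] at hnn
    have e0 : P (-1 / 2) = 0 := intervalIntegral.integral_same
    have e1 : P (1 / 2) = p (-C) (1 / 2) := ((hp (-C)).2 _ hmem).symm
    rw [e0, e1, zero_mul, sub_zero] at hnn
    exact nonneg_of_mul_nonneg_left hnn (Real.exp_pos _)
  obtain ⟨E, hE, hE0⟩ := intermediate_value_Icc' (neg_le_self hC0) hpc.continuousOn
    (show (0 : ℝ) ∈ _ from ⟨hp_top, hp_bot⟩)
  change p E (1 / 2) = 0 at hE0
  have hsC : ∀ x, V x - E - truncSq M (p E x) ≤ 2 * C := fun x => by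
    linarith [(abs_le.1 (hC x)).2, truncSq_nonneg M (p E x), hE.1]
  have hbound : ∀ x ∈ Icc (-1 / 2 : ℝ) (1 / 2), |p E x| ≤ M := by
    intro x hx
    have h1 : p E x ≤ 2 * C * (x - -1 / 2) := by
      rw [(hp E).2 x hx]
      exact integral_le_mul_sub_of_le hx.1 (fun x _ => hsC x) (hs _ _ _)
    have h2 : -p E x ≤ 2 * C * (1 / 2 - x) := by
      have e : -p E x = ∫ t in x..(1 / 2), (V t - E - truncSq M (p E t)) := by
        rw [← intervalIntegral.integral_interval_sub_left (hs E _ _) (hs E (-1 / 2) x),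
          ← (hp E).2 x hx, ← (hp E).2 _ hmem, hE0, zero_sub]
      rw [e]
      exact integral_le_mul_sub_of_le hx.2 (fun x _ => hsC x) (hs _ _ _)
    have := hx.1
    have := hx.2
    exact abs_le.2 ⟨by simp only [M]; nlinarith, by simp only [M]; nlinarith⟩
  set P : ℝ → ℝ := unitCell.indicator (p E)
  set s : ℝ → ℝ := unitCell.indicator fun x => V x - E - P x ^ 2
  have hs_eq : s = unitCell.indicator fun t => V t - E - truncSq M (p E t) := by
    ext x
    by_cases hx : x ∈ unitCell
    · simp only [s, P, indicator_of_mem hx]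
      rw [truncSq_eq (hbound x (Ioo_subset_Icc_self hx))]
    · simp only [s, indicator_of_notMem hx]
  have hsi : ∀ a b, IntervalIntegrable s volume a b := fun a b => by
    rw [hs_eq]
    have := hs E a b
    rw [intervalIntegrable_iff] at this ⊢
    exact this.indicator measurableSet_Ioo
  have hPeq : P = fun x => ∫ t in (-1 / 2)..x, s t := by
    have hleft : ∀ x ≤ (-1 / 2 : ℝ), ∫ t in (-1 / 2)..x, s t = 0 := fun x hx => by
      refine intervalIntegral.integral_zero_ae (.of_forall fun t ht => ?_)
      rw [uIoc_of_ge hx] at ht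
      exact indicator_of_notMem (fun h => absurd h.1 (not_lt.2 ht.2)) _
    have hmid : ∀ x ∈ Icc (-1 / 2 : ℝ) (1 / 2), ∫ t in (-1 / 2)..x, s t = p E x := fun x hx => by
      rw [(hp E).2 x hx]
      refine intervalIntegral.integral_congr_ae ?_
      have : ∀ᵐ t : ℝ, t ≠ 1 / 2 := by simp [ae_iff]
      filter_upwards [this] with t ht1 ht
      rw [uIoc_of_le hx.1] at ht
      rw [hs_eq, indicator_of_mem]
      exact ⟨ht.1, lt_of_le_of_ne (ht.2.trans hx.2) ht1⟩
    ext x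
    by_cases hx : x ∈ unitCell
    · rw [hmid x (Ioo_subset_Icc_self hx)]
      exact indicator_of_mem hx _
    · rw [show P x = 0 from indicator_of_notMem hx _]
      rcases le_or_gt x (-1 / 2) with h | h
      · exact (hleft x h).symm
      · have hx2 : 1 / 2 ≤ x := by
          by_contra hlt
          exact hx ⟨h, not_le.1 hlt⟩
        have e2 : ∫ t in (1 / 2)..x, s t = 0 := by
          refine intervalIntegral.integral_zero_ae (.of_forall fun t ht => ?_)
          rw [uIoc_of_le hx2] at ht
          exact indicator_of_notMem (fun h => absurd h.2 (not_lt.2 ht.1.le)) _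
        rw [← intervalIntegral.integral_add_adjacent_intervals (hsi _ (1 / 2)) (hsi _ _), e2,
          hmid _ hmem, hE0, add_zero]
  refine ⟨E, P, ?_, fun x hx => indicator_of_notMem hx _⟩
  have := IsPrim.primitive hsi (-1 / 2)
  rwa [← hPeq] at this

end RDM

namespace RDM

open MeasureTheory Set Filter Topology
open scoped ContDiff ComplexConjugate

/-! ### Jacobi's completion of the square -/

section Jacobi

lemma IsPrim.norm_sq {u g : ℝ → ℂ} (hu : IsPrim u g) :
    IsPrim (fun x => ‖u x‖ ^ 2) (fun x => 2 * (conj (u x) * g x).re) := by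
  have := (hu.star.mul_complex hu).re
  convert this using 2 with x x
  · rw [Complex.conj_mul', ← Complex.ofReal_pow, Complex.ofReal_re]
  · simp only [Complex.add_re, Complex.mul_re, Complex.conj_re, Complex.conj_im]
    ring

/-- Completing the square: `∫ |u' - P u|² ≥ 0` bounds the form of `P' + P²` from below by
boundary terms. -/
lemma boundary_le_form {P s : ℝ → ℝ} {u g : ℝ → ℂ} (hP : IsPrim P s) (hu : IsPrim u g)
    {a b : ℝ} (hab : a ≤ b) (hg : IntervalIntegrable (fun x => ‖g x‖ ^ 2) volume a b) :
    P b * ‖u b‖ ^ 2 - P a * ‖u a‖ ^ 2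
      ≤ ∫ x in a..b, (‖g x‖ ^ 2 + (s x + P x ^ 2) * ‖u x‖ ^ 2) := by
  have h1 := hP.mul hu.norm_sq
  have hPc := hP.continuous
  have huc := hu.continuous
  rw [← h1.integral_eq a b]
  refine intervalIntegral.integral_mono_on hab (h1.intervalIntegrable a b) ?_ fun x _ => ?_
  · refine hg.add ?_
    refine IntervalIntegrable.mul_continuousOn ?_ (by fun_prop)
    exact (hP.intervalIntegrable a b).add (Continuous.intervalIntegrable (by fun_prop) _ _)
  · have h2 : 0 ≤ ‖g x - P x * u x‖ ^ 2 := sq_nonneg _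
    rw [← Complex.normSq_eq_norm_sq, Complex.normSq_apply] at h2
    rw [← Complex.normSq_eq_norm_sq, ← Complex.normSq_eq_norm_sq, Complex.normSq_apply,
      Complex.normSq_apply]
    simp only [Complex.sub_re, Complex.sub_im, Complex.mul_re, Complex.mul_im, Complex.ofReal_re,
      Complex.ofReal_im, Complex.conj_re, Complex.conj_im] at h2 ⊢
    nlinarith

end Jacobi

/-! ### The Neumann problem on the unit cell -/

lemma norm_sq_L2 {U : Set ℝ} (u : L2 U) : ‖u‖ ^ 2 = ∫ x in U, ‖u x‖ ^ 2 := by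
  have h1 : ‖u‖ ^ 2 = (inner ℂ u u : ℂ).re := (inner_self_eq_norm_sq (𝕜 := ℂ) u).symm
  rw [h1, L2.inner_def]
  have : ∫ x in U, inner ℂ (u x) (u x) = ∫ x in U, ((‖u x‖ ^ 2 : ℝ) : ℂ) := by
    refine integral_congr_ae (.of_forall fun x => ?_)
    simp only [RCLike.inner_apply]
    rw [Complex.mul_conj']
    push_cast
    rfl
  rw [this, integral_complex_ofReal, Complex.ofReal_re]

lemma integral_unitCell {E : Type*} [NormedAddCommGroup E] [NormedSpace ℝ E] (f : ℝ → E) :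
    ∫ x in unitCell, f x = ∫ x in (-1 / 2)..(1 / 2), f x := by
  rw [intervalIntegral.integral_of_le (by norm_num), unitCell, integral_Ioc_eq_integral_Ioo]

/-- Almost every point of the closed cell is interior. -/
lemma ae_mem_unitCell : ∀ᵐ x : ℝ, x ∈ uIoc (-1 / 2 : ℝ) (1 / 2) → x ∈ unitCell := by
  have : ∀ᵐ t : ℝ, t ≠ 1 / 2 := by simp [ae_iff]
  filter_upwards [this] with t ht1 ht
  rw [uIoc_of_le (by norm_num)] at ht
  exact ⟨ht.1, lt_of_le_of_ne ht.2 ht1⟩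

lemma isOpen_unitCell : IsOpen unitCell := isOpen_Ioo

instance : IsFiniteMeasure (volume.restrict unitCell) :=
  ⟨by rw [Measure.restrict_apply_univ]; exact measure_Ioo_lt_top⟩

lemma memLp_unitCell {f : ℝ → ℂ} (hf : Continuous f) :
    MemLp f 2 (volume.restrict unitCell) := by
  obtain ⟨C, hC⟩ := isCompact_Icc.exists_bound_of_continuousOn
    (hf.continuousOn (s := Icc (-1 / 2 : ℝ) (1 / 2)))
  refine MemLp.of_bound hf.aestronglyMeasurable C ?_
  filter_upwards [ae_restrict_mem measurableSet_Ioo] with x hx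
  exact hC x (Ioo_subset_Icc_self hx)

lemma isPrim_exp_integral {p : ℝ → ℝ} (hp : Continuous p) (a : ℝ) :
    IsPrim (fun x => Real.exp (∫ t in a..x, p t)) (fun x => p x * Real.exp (∫ t in a..x, p t)) := by
  have hd : ∀ x, HasDerivAt (fun x => ∫ t in a..x, p t) (p x) x := fun x =>
    intervalIntegral.integral_hasDerivAt_right (hp.intervalIntegrable _ _)
      hp.aestronglyMeasurable.stronglyMeasurableAtFilter hp.continuousAt
  have hc : Continuous (fun x => ∫ t in a..x, p t) :=
    continuous_iff_continuousAt.2 fun x => (hd x).continuousAt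
  refine IsPrim.of_hasDerivAt (fun x => ?_) (by fun_prop)
  simpa [mul_comm] using (hd x).exp

namespace IsRiccati

variable {V : ℝ → ℝ} {E : ℝ} {p : ℝ → ℝ}

lemma continuous (h : IsRiccati V E p) : Continuous p := h.isPrim.continuous

lemma left (h : IsRiccati V E p) : p (-1 / 2) = 0 := h.eq_zero _ fun h => lt_irrefl _ h.1

lemma right (h : IsRiccati V E p) : p (1 / 2) = 0 := h.eq_zero _ fun h => lt_irrefl _ h.2

/-- The energy of a positive Neumann solution bounds the form from below. -/
lemma form_bound (h : IsRiccati V E p) {C : ℝ} (hV : Measurable V) (hC : ∀ x, |V x| ≤ C)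
    {u g : L2 unitCell} (hu : HasWeakDeriv unitCell u g) :
    E * ‖u‖ ^ 2 ≤ ‖g‖ ^ 2 + ∫ x in unitCell, V x * ‖u x‖ ^ 2 := by
  obtain ⟨v, hv1, hv2⟩ := hu.exists_isPrim isOpen_unitCell ordConnected_Ioo ⟨0, by norm_num [unitCell]⟩
  have hvc := hv1.continuous
  have hg2 : Integrable (fun x => ‖g x‖ ^ 2) (volume.restrict unitCell) :=
    (Lp.memLp g).integrable_norm_pow two_ne_zero
  have hvi : IntegrableOn (fun x => ‖v x‖ ^ 2) unitCell :=
    ((by fun_prop : Continuous fun x => ‖v x‖ ^ 2).integrableOn_Icc).mono_set Ioo_subset_Icc_self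
  have hVv : IntegrableOn (fun x => V x * ‖v x‖ ^ 2) unitCell :=
    hvi.bdd_mul hV.aestronglyMeasurable (c := C) (.of_forall hC)
  have hG : IntervalIntegrable (fun x => ‖unitCell.indicator g x‖ ^ 2) volume (-1 / 2) (1 / 2) := by
    rw [intervalIntegrable_iff_integrableOn_Ioo_of_le (by norm_num)]
    refine hg2.congr ?_
    filter_upwards [ae_restrict_mem measurableSet_Ioo] with x hx
    rw [indicator_of_mem (show x ∈ unitCell from hx)]
  have key := boundary_le_form h.isPrim hv1 (by norm_num : (-1 / 2 : ℝ) ≤ 1 / 2) hG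
  rw [h.left, h.right, zero_mul, zero_mul, sub_zero, ← integral_unitCell] at key
  have e1 : ∫ x in unitCell, (‖unitCell.indicator g x‖ ^ 2
      + (unitCell.indicator (fun x => V x - E - p x ^ 2) x + p x ^ 2) * ‖v x‖ ^ 2)
      = ∫ x in unitCell, ((‖g x‖ ^ 2 + V x * ‖v x‖ ^ 2) - E * ‖v x‖ ^ 2) := by
    refine setIntegral_congr_fun measurableSet_Ioo fun x hx => ?_
    simp only [indicator_of_mem (show x ∈ unitCell from hx)]
    ring
  have e2 : ∫ x in unitCell, V x * ‖u x‖ ^ 2 = ∫ x in unitCell, V x * ‖v x‖ ^ 2 :=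
    integral_congr_ae (hv2.mono fun x hx => by simp only [hx])
  have e3 : ∫ x in unitCell, ‖u x‖ ^ 2 = ∫ x in unitCell, ‖v x‖ ^ 2 :=
    integral_congr_ae (hv2.mono fun x hx => by simp only [hx])
  rw [e1, integral_sub (hg2.fun_add hVv) (hvi.const_mul E), integral_add hg2 hVv,
    integral_const_mul] at key
  rw [norm_sq_L2, norm_sq_L2, e2, e3]
  linarith

/-- The positive Neumann solution, normalized to be `1` at the left end. -/
lemma isPrim_exp (h : IsRiccati V E p) :
    IsPrim (fun x => Real.exp (∫ t in (-1 / 2)..x, p t))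
      (fun x => p x * Real.exp (∫ t in (-1 / 2)..x, p t)) :=
  isPrim_exp_integral h.continuous _

/-- The energy of a positive Neumann solution is an eigenvalue. -/
lemma mem_realSpectrum (h : IsRiccati V E p) {C : ℝ} (hV : Measurable V) (hC : ∀ x, |V x| ≤ C) :
    E ∈ realSpectrum (neumannLaplacian unitCell + mulOp unitCell V) := by
  have h1 := h.isPrim_exp
  set φ : ℝ → ℝ := fun x => Real.exp (∫ t in (-1 / 2)..x, p t)
  have h2 : IsPrim (fun x => p x * φ x)
      (fun x => unitCell.indicator (fun x => V x - E - p x ^ 2) x * φ x + p x * (p x * φ x)) :=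
    h.isPrim.mul h1
  have hφ : Continuous φ := h1.continuous
  have hp := h.continuous
  set Φ : L2 unitCell := MemLp.toLp (fun x => (φ x : ℂ)) (memLp_unitCell (by fun_prop))
  set Ψ : L2 unitCell := MemLp.toLp (fun x => ((p x * φ x : ℝ) : ℂ)) (memLp_unitCell (by fun_prop))
  have hΦ : Φ =ᵐ[volume.restrict unitCell] fun x => (φ x : ℂ) := MemLp.coeFn_toLp _
  have hΨ : Ψ =ᵐ[volume.restrict unitCell] fun x => ((p x * φ x : ℝ) : ℂ) := MemLp.coeFn_toLp _
  obtain ⟨M, hM1, hM2, -⟩ := exists_mulOp_eq (U := unitCell) (V := V) (C := C)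
    hV.aestronglyMeasurable (.of_forall hC)
  refine mem_realSpectrum_of_approx fun ε hε => ⟨(Φ, (E : ℂ) • Φ), ?_, ?_, ?_⟩
  · rw [mem_graph_add_mulOp hM1, neumannLaplacian_graph isOpen_unitCell]
    refine ⟨Ψ, h1.ofReal.hasWeakDeriv hΦ hΨ, fun v w hvw => ?_⟩
    obtain ⟨v', hv1, hv2⟩ := hvw.exists_isPrim isOpen_unitCell ordConnected_Ioo
      ⟨0, by norm_num [unitCell]⟩
    have h3 := hv1.star.mul_complex h2.ofReal
    have h4 := h3.integral_eq (-1 / 2) (1 / 2)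
    rw [h.left, h.right] at h4
    simp only [zero_mul, Complex.ofReal_zero, mul_zero, sub_zero] at h4
    rw [← integral_unitCell] at h4
    rw [← sub_eq_zero, L2.inner_def, L2.inner_def, ← integral_sub, ← h4]
    rotate_left
    · exact L2.integrable_inner w Ψ
    · exact L2.integrable_inner v _
    refine integral_congr_ae ?_
    filter_upwards [ae_restrict_mem measurableSet_Ioo, hΨ, hΦ, hv2, hM2 Φ,
      Lp.coeFn_sub ((E : ℂ) • Φ) (M Φ), Lp.coeFn_smul (E : ℂ) Φ] with x hx e1 e2 e3 e4 e5 e6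
    change inner ℂ (w x) (Ψ x) - inner ℂ (v x) (((E : ℂ) • Φ - M Φ : L2 unitCell) x) = _
    rw [e5, Pi.sub_apply, e6, e4, Pi.smul_apply, e1, e2, e3]
    simp only [indicator_of_mem (show x ∈ unitCell from hx), RCLike.inner_apply, smul_eq_mul]
    push_cast
    ring
  · simp only [sub_self, norm_zero]
    positivity
  · intro h0
    have h5 : ‖Φ‖ ^ 2 = 0 := by simp [show Φ = 0 from h0]
    rw [norm_sq_L2, integral_congr_ae (g := fun x => φ x ^ 2)
      (hΦ.mono fun x hx => by simp [hx]), integral_unitCell] at h5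
    have h6 : 0 < ∫ x in (-1 / 2)..(1 / 2), φ x ^ 2 :=
      intervalIntegral.intervalIntegral_pos_of_pos (Continuous.intervalIntegrable (by fun_prop) _ _)
        (fun x => by positivity) (by norm_num)
    exact h6.ne' h5

/-- The energy of a positive Neumann solution is the lowest point of the spectrum. -/
lemma sInf_realSpectrum (h : IsRiccati V E p) {C : ℝ} (hV : Measurable V) (hC : ∀ x, |V x| ≤ C) :
    sInf (realSpectrum (neumannLaplacian unitCell + mulOp unitCell V)) = E :=
  IsLeast.csInf_eq ⟨h.mem_realSpectrum hV hC, fun t ht => by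
    by_contra hlt
    exact not_mem_realSpectrum_of_form_bound isOpen_unitCell hV.aestronglyMeasurable
      (.of_forall hC) (fun u g hu => h.form_bound hV hC hu) (not_le.1 hlt) ht⟩

/-- Reflection of the cell. -/
lemma reflect (h : IsRiccati V E p) : IsRiccati (fun x => V (-x)) E (fun x => -p (-x)) where
  isPrim := by
    have := h.isPrim.comp_neg.neg
    convert this using 2 with x
    rw [neg_neg]
    have hmem : -x ∈ unitCell ↔ x ∈ unitCell := by
      simp only [unitCell, mem_Ioo]
      constructor <;> rintro ⟨h1, h2⟩ <;> constructor <;> linarith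
    by_cases hx : x ∈ unitCell
    · rw [indicator_of_mem hx, indicator_of_mem (hmem.2 hx)]
      ring
    · rw [indicator_of_notMem hx, indicator_of_notMem (mt hmem.1 hx)]
  eq_zero x hx := by
    rw [h.eq_zero, neg_zero]
    intro h2
    apply hx
    have h1 := h2.1
    have h3 := h2.2
    exact ⟨by linarith, by linarith⟩

lemma integral_reflect (p : ℝ → ℝ) :
    ∫ x in (-1 / 2)..(1 / 2), -p (-x) = -∫ x in (-1 / 2)..(1 / 2), p x := by
  rw [intervalIntegral.integral_neg, intervalIntegral.integral_comp_neg]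
  norm_num

/-- The Neumann solution satisfies the energy identity. -/
lemma integral_energy (h : IsRiccati V E p) :
    ∫ x in (-1 / 2)..(1 / 2), ((p x * Real.exp (∫ t in (-1 / 2)..x, p t)) ^ 2
      + (V x - E) * Real.exp (∫ t in (-1 / 2)..x, p t) ^ 2) = 0 := by
  have h1 := h.isPrim_exp
  have h2 := ((h.isPrim.mul h1).mul h1).integral_eq (-1 / 2) (1 / 2)
  simp only [h.left, h.right, zero_mul, sub_zero] at h2
  rw [← h2]
  refine intervalIntegral.integral_congr_ae ?_
  filter_upwards [ae_mem_unitCell] with x hx hx2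
  rw [indicator_of_mem (hx hx2)]
  ring

end IsRiccati

end RDM

namespace RDM

open MeasureTheory Set Filter Topology
open scoped ContDiff ComplexConjugate

/-! ### Estimates in a single cell -/

namespace IsRiccati

variable {V : ℝ → ℝ} {E : ℝ} {p : ℝ → ℝ}

/-- Strict gain over the energy `E₀` in a single cell, up to boundary terms. There is room for a
gain if the cell energy exceeds `E₀`, or if the boundary weights `wl`, `wr` grow, compared to the
square of the positive Neumann solution. The square is completed with `p - ε H` instead of `p`, where
`H` interpolates the weights and satisfies `H' + 2 p H = γ`: the potential term improves by
`E - E₀ + ε γ - ε² H²`, which is positive for small `ε > 0` since `γ > 0` in the second case. -/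
lemma eventually_cell_gap (h : IsRiccati V E p) {C : ℝ} (hV : Measurable V)
    (hC : ∀ x, |V x| ≤ C) {E₀ wl wr : ℝ} (hE : E₀ ≤ E)
    (hor : E₀ < E ∨ wl < wr * Real.exp (2 * ∫ x in (-1 / 2)..(1 / 2), p x)) :
    ∀ᶠ ε in 𝓝[>] (0 : ℝ), ∀ᶠ δ in 𝓝[>] (0 : ℝ), ∀ u g : ℝ → ℂ, IsPrim u g →
      IntervalIntegrable (fun x => ‖g x‖ ^ 2) volume (-1 / 2) (1 / 2) →
      -ε * (wr * ‖u (1 / 2)‖ ^ 2 - wl * ‖u (-1 / 2)‖ ^ 2)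
        ≤ ∫ x in (-1 / 2)..(1 / 2), (‖g x‖ ^ 2 + (V x - E₀ - δ) * ‖u x‖ ^ 2) := by
  have hp := h.continuous
  have hd : ∀ x, HasDerivAt (fun x => ∫ t in (-1 / 2)..x, p t) (p x) x := fun x =>
    intervalIntegral.integral_hasDerivAt_right (hp.intervalIntegrable _ _)
      hp.aestronglyMeasurable.stronglyMeasurableAtFilter hp.continuousAt
  set w : ℝ → ℝ := fun x => Real.exp (2 * ∫ t in (-1 / 2)..x, p t)
  have hw : ∀ x, HasDerivAt w (2 * p x * w x) x := fun x => by
    have := ((hd x).const_mul 2).exp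
    rwa [mul_comm] at this
  have hwc : Continuous w := continuous_iff_continuousAt.2 fun x => (hw x).continuousAt
  have hwpos : ∀ x, 0 < w x := fun x => Real.exp_pos _
  set κ := ∫ x in (-1 / 2)..(1 / 2), w x
  have hκ : 0 < κ := intervalIntegral.intervalIntegral_pos_of_pos (hwc.intervalIntegrable _ _)
    hwpos (by norm_num)
  set γ := (wr * w (1 / 2) - wl) / κ
  -- the solution of `H' + 2 p H = γ` with the prescribed boundary values
  set H : ℝ → ℝ := fun x => (wl + γ * ∫ t in (-1 / 2)..x, w t) / w x
  have hH : ∀ x, HasDerivAt H (γ - 2 * p x * H x) x := fun x => by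
    have h1 : HasDerivAt (fun x => wl + γ * ∫ t in (-1 / 2)..x, w t) (γ * w x) x :=
      ((intervalIntegral.integral_hasDerivAt_right (hwc.intervalIntegrable _ _)
        hwc.aestronglyMeasurable.stronglyMeasurableAtFilter hwc.continuousAt).const_mul
        γ).const_add _
    have h2 := h1.div (hw x) (hwpos x).ne'
    refine h2.congr_deriv ?_
    have := (hwpos x).ne'
    simp only [H]
    field_simp
  have hHc : Continuous H := continuous_iff_continuousAt.2 fun x => (hH x).continuousAt
  have hH0 : H (-1 / 2) = wl := by simp [H, w]
  have hH1 : H (1 / 2) = wr := by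
    have := (hwpos (1 / 2)).ne'
    have := hκ.ne'
    change (wl + γ * κ) / w (1 / 2) = wr
    simp only [γ]
    field_simp
    ring
  have hHP : IsPrim H (fun x => γ - 2 * p x * H x) := IsPrim.of_hasDerivAt hH (by fun_prop)
  obtain ⟨B, hB⟩ := isCompact_Icc.exists_bound_of_continuousOn
    (hHc.continuousOn (s := Icc (-1 / 2 : ℝ) (1 / 2)))
  have hpos : ∀ᶠ ε in 𝓝[>] (0 : ℝ), 0 < E - E₀ + ε * γ - ε ^ 2 * B ^ 2 := by
    rcases hor with h1 | h1
    · have : Tendsto (fun ε : ℝ => E - E₀ + ε * γ - ε ^ 2 * B ^ 2) (𝓝 0) (𝓝 (E - E₀)) := by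
        have hc : Continuous fun ε : ℝ => E - E₀ + ε * γ - ε ^ 2 * B ^ 2 := by fun_prop
        simpa using hc.tendsto 0
      exact (this.eventually (lt_mem_nhds (sub_pos.2 h1))).filter_mono nhdsWithin_le_nhds
    · have hγ : 0 < γ := div_pos (sub_pos.2 h1) hκ
      have : Tendsto (fun ε : ℝ => γ - ε * B ^ 2) (𝓝 0) (𝓝 γ) := by
        have hc : Continuous fun ε : ℝ => γ - ε * B ^ 2 := by fun_prop
        simpa using hc.tendsto 0
      filter_upwards [(this.eventually (lt_mem_nhds hγ)).filter_mono nhdsWithin_le_nhds,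
        self_mem_nhdsWithin] with ε h2 h3
      have := mul_pos (show (0 : ℝ) < ε from h3) h2
      nlinarith
  filter_upwards [hpos] with ε hε
  filter_upwards [Ioo_mem_nhdsGT hε] with δ hδ u g hu hg
  have key := boundary_le_form (h.isPrim.sub (hHP.const_mul ε)) hu
    (by norm_num : (-1 / 2 : ℝ) ≤ 1 / 2) hg
  simp only [h.left, h.right, hH0, hH1] at key
  have huc := hu.continuous
  have hVu : IntervalIntegrable (fun x => (V x - E₀ - δ) * ‖u x‖ ^ 2) volume (-1 / 2) (1 / 2) :=
    (((intervalIntegrable_of_bounded hV hC _ _).sub intervalIntegrable_const).sub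
      intervalIntegrable_const).mul_continuousOn (by fun_prop)
  have hmono : ∫ x in (-1 / 2)..(1 / 2), (‖g x‖ ^ 2 + (V x - E - ε * γ + ε ^ 2 * H x ^ 2) * ‖u x‖ ^ 2)
      ≤ ∫ x in (-1 / 2)..(1 / 2), (‖g x‖ ^ 2 + (V x - E₀ - δ) * ‖u x‖ ^ 2) := by
    refine intervalIntegral.integral_mono_on (by norm_num) (hg.add ?_) (hg.add hVu) fun x hx => ?_
    · refine IntervalIntegrable.mul_continuousOn ?_ (by fun_prop)
      exact (((intervalIntegrable_of_bounded hV hC _ _).sub intervalIntegrable_const).sub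
        intervalIntegrable_const).add (Continuous.intervalIntegrable (by fun_prop) _ _)
    · have h1 : H x ^ 2 ≤ B ^ 2 := by
        have := hB x hx
        rw [Real.norm_eq_abs] at this
        exact sq_le_sq' (abs_le.1 this).1 (abs_le.1 this).2
      have h2 := mul_le_mul_of_nonneg_left h1 (sq_nonneg ε)
      have h3 := hδ.2
      gcongr
      linarith
  refine le_trans (le_of_eq_of_le (by ring) key) (le_of_eq_of_le ?_ hmono)
  refine intervalIntegral.integral_congr_ae ?_
  filter_upwards [ae_mem_unitCell] with x hx hx2
  rw [indicator_of_mem (hx hx2)]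
  ring

/-- The form bound in a single cell. -/
lemma cell_bound (h : IsRiccati V E p) {C : ℝ} (hV : Measurable V)
    (hC : ∀ x, |V x| ≤ C) {E₀ : ℝ} (hE : E₀ ≤ E) {u g : ℝ → ℂ} (hu : IsPrim u g)
    (hg : IntervalIntegrable (fun x => ‖g x‖ ^ 2) volume (-1 / 2) (1 / 2)) :
    0 ≤ ∫ x in (-1 / 2)..(1 / 2), (‖g x‖ ^ 2 + (V x - E₀) * ‖u x‖ ^ 2) := by
  have key := boundary_le_form h.isPrim hu (by norm_num : (-1 / 2 : ℝ) ≤ 1 / 2) hg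
  rw [h.left, h.right, zero_mul, zero_mul, sub_zero] at key
  have huc := hu.continuous
  have hVu : ∀ e, IntervalIntegrable (fun x => (V x - e) * ‖u x‖ ^ 2) volume (-1 / 2) (1 / 2) :=
    fun e => ((intervalIntegrable_of_bounded hV hC _ _).sub
      intervalIntegrable_const).mul_continuousOn (by fun_prop)
  have hmono : ∫ x in (-1 / 2)..(1 / 2), (‖g x‖ ^ 2 + (V x - E) * ‖u x‖ ^ 2)
      ≤ ∫ x in (-1 / 2)..(1 / 2), (‖g x‖ ^ 2 + (V x - E₀) * ‖u x‖ ^ 2) :=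
    intervalIntegral.integral_mono_on (by norm_num) (hg.add (hVu _)) (hg.add (hVu _))
      fun x _ => by gcongr
  refine key.trans (le_of_eq_of_le ?_ hmono)
  refine intervalIntegral.integral_congr_ae ?_
  filter_upwards [ae_mem_unitCell] with x hx hx2
  rw [indicator_of_mem (hx hx2)]
  ring

/-- If the positive Neumann solution `φ` of the cell with maximally displaced bump takes equal values
at both ends, then its periodic extension, cut into cells centred at the bumps, is a trial function for
the cell with the centred bump. Translating by `1/2 - r` and by `1/2 - r - 1` covers the cell; the two
pieces meet at `r`, to the right of which both potentials vanish. -/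
lemma energy_le_of_integral_eq_zero {q : ℝ → ℝ} {r E E₀ : ℝ} {p p₀ : ℝ → ℝ} {C : ℝ}
    (hq : Measurable q) (hC : ∀ x, |q x| ≤ C) (hsupp : ∀ x, r < |x| → q x = 0)
    (hr0 : 0 ≤ r) (hr : r < 1 / 2) (h : IsRiccati (fun x => q (x - (1 / 2 - r))) E p)
    (h₀ : IsRiccati q E₀ p₀) (hp : ∫ x in (-1 / 2)..(1 / 2), p x = 0) : E₀ ≤ E := by
  have h1 := h.isPrim_exp
  have hen := h.integral_energy
  set φ : ℝ → ℝ := fun x => Real.exp (∫ t in (-1 / 2)..x, p t)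
  have hφ : Continuous φ := h1.continuous
  have hpc := h.continuous
  have hφ0 : φ (-1 / 2) = 1 := by simp [φ]
  have hφ1 : φ (1 / 2) = 1 := by simp only [φ, hp, Real.exp_zero]
  set F : ℝ → ℝ := fun y => (p y * φ y) ^ 2 + (q (y - (1 / 2 - r)) - E₀) * φ y ^ 2
  have hFi : ∀ a b, IntervalIntegrable F volume a b := fun a b => by
    refine (Continuous.intervalIntegrable (by fun_prop) _ _).add
      (IntervalIntegrable.mul_continuousOn ?_ (by fun_prop))
    exact (intervalIntegrable_of_bounded (hq.comp (measurable_id.sub_const _))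
      (fun x => hC _) a b).sub intervalIntegrable_const
  have hpiece : ∀ c a b, a ≤ b → -1 / 2 ≤ a → b ≤ 1 / 2 →
      (∀ x, a < x → x < b → q x = q (x + c - (1 / 2 - r))) →
      p₀ b * φ (b + c) ^ 2 - p₀ a * φ (a + c) ^ 2 ≤ ∫ y in (a + c)..(b + c), F y := by
    intro c a b hab ha hb hq'
    have := boundary_le_form h₀.isPrim (h1.ofReal.comp_add_right c) hab
      (Continuous.intervalIntegrable (by fun_prop) _ _)
    simp only [Complex.norm_real, Real.norm_eq_abs, sq_abs] at this
    refine this.trans (le_of_eq ?_)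
    rw [← intervalIntegral.integral_comp_add_right]
    refine intervalIntegral.integral_congr_ae ?_
    have hne : ∀ᵐ t : ℝ, t ≠ b := by simp [ae_iff]
    filter_upwards [hne] with x hxb hx
    rw [uIoc_of_le hab] at hx
    have hx2 : x < b := lt_of_le_of_ne hx.2 hxb
    have hxU : x ∈ unitCell := ⟨by linarith [hx.1], by linarith⟩
    rw [indicator_of_mem hxU, hq' x hx.1 hx2]
    simp only [F]
    ring
  have k1 := hpiece (1 / 2 - r) (-1 / 2) r (by linarith) le_rfl hr.le
    (fun x _ _ => by rw [add_sub_cancel_right])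
  have k2 := hpiece (1 / 2 - r - 1) r (1 / 2) hr.le (by linarith) le_rfl (fun x h1 h2 => by
    rw [hsupp x (lt_abs.2 (Or.inl h1)), hsupp _ (lt_abs.2 (Or.inr (by linarith)))])
  have e1 : r + (1 / 2 - r) = 1 / 2 := by ring
  have e2 : r + (1 / 2 - r - 1) = -1 / 2 := by ring
  have e3 : 1 / 2 + (1 / 2 - r - 1) = -1 / 2 + (1 / 2 - r) := by ring
  rw [e1, hφ1, h₀.left] at k1
  rw [e2, hφ0, h₀.right, e3] at k2
  have hsum := intervalIntegral.integral_add_adjacent_intervals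
    (hFi (-1 / 2) (-1 / 2 + (1 / 2 - r))) (hFi (-1 / 2 + (1 / 2 - r)) (1 / 2))
  have hF : ∫ y in (-1 / 2)..(1 / 2), F y
      = (E - E₀) * ∫ y in (-1 / 2)..(1 / 2), φ y ^ 2 := by
    have hi : IntervalIntegrable (fun y => (p y * φ y) ^ 2 + (q (y - (1 / 2 - r)) - E) * φ y ^ 2)
        volume (-1 / 2) (1 / 2) := by
      refine (Continuous.intervalIntegrable (by fun_prop) _ _).add
        (IntervalIntegrable.mul_continuousOn ?_ (by fun_prop))
      exact (intervalIntegrable_of_bounded (hq.comp (measurable_id.sub_const _))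
        (fun x => hC _) _ _).sub intervalIntegrable_const
    have e : ∫ y in (-1 / 2)..(1 / 2), F y = ∫ y in (-1 / 2)..(1 / 2),
        (((p y * φ y) ^ 2 + (q (y - (1 / 2 - r)) - E) * φ y ^ 2) + (E - E₀) * φ y ^ 2) :=
      intervalIntegral.integral_congr fun y _ => by simp only [F]; ring
    rw [e, intervalIntegral.integral_add hi (Continuous.intervalIntegrable (by fun_prop) _ _), hen,
      zero_add, intervalIntegral.integral_const_mul]
  have hpos : 0 < ∫ y in (-1 / 2)..(1 / 2), φ y ^ 2 :=
    intervalIntegral.intervalIntegral_pos_of_pos (Continuous.intervalIntegrable (by fun_prop) _ _)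
      (fun x => pow_pos (Real.exp_pos _) 2) (by norm_num)
  have : 0 ≤ (E - E₀) * ∫ y in (-1 / 2)..(1 / 2), φ y ^ 2 := by
    rw [← hF, ← hsum]
    linarith
  linarith [nonneg_of_mul_nonneg_left this hpos]

end IsRiccati

end RDM

namespace RDM

open MeasureTheory Set Filter Topology
open scoped ComplexConjugate

/-! ### Periodic weights -/

lemma exists_antidifference (c : ℤ → ℝ) : ∃ σ : ℤ → ℝ, ∀ n, σ (n + 1) = σ n + c n := by
  refine ⟨fun n => ∑ j ∈ Finset.Ico 0 n, c j - ∑ j ∈ Finset.Ico n 0, c j, fun n => ?_⟩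
  rcases le_or_gt 0 n with h | h
  · have h1 : Finset.Ico 0 (n + 1) = insert n (Finset.Ico 0 n) := by ext; simp; omega
    have h2 : Finset.Ico (n + 1) 0 = ∅ := by ext; simp; omega
    have h3 : Finset.Ico n 0 = ∅ := by ext; simp; omega
    simp only [h1, h2, h3]
    rw [Finset.sum_insert (by simp)]
    simp
    ring
  · have h1 : Finset.Ico n 0 = insert n (Finset.Ico (n + 1) 0) := by ext; simp; omega
    have h2 : Finset.Ico 0 (n + 1) = ∅ := by ext; simp; omega
    have h3 : Finset.Ico 0 n = ∅ := by ext; simp; omega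
    simp only [h1, h2, h3]
    rw [Finset.sum_insert (by simp)]
    simp

lemma sum_Ico_antidifference {c σ : ℤ → ℝ} (h : ∀ n, σ (n + 1) = σ n + c n) (m : ℤ) (k : ℕ) :
    ∑ j ∈ Finset.Ico m (m + k), c j = σ (m + k) - σ m := by
  induction k with
  | zero => simp
  | succ k ih =>
    have h1 : Finset.Ico m (m + (k + 1 : ℕ)) = insert (m + k) (Finset.Ico m (m + k)) := by
      ext; simp; omega
    rw [h1, Finset.sum_insert (by simp), ih]
    push_cast
    rw [← add_assoc, h]
    ring

lemma antidifference_add_period {c σ : ℤ → ℝ} (h : ∀ n, σ (n + 1) = σ n + c n) {L : ℤ}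
    (hc : Function.Periodic c L) (n : ℤ) : σ (n + L) - σ n = σ L - σ 0 := by
  induction n using Int.induction_on with
  | zero => simp
  | succ n ih =>
    rw [h, show (n : ℤ) + 1 + L = n + L + 1 by ring, h, hc]
    linarith
  | pred n ih =>
    have h1 := h (-(n : ℤ) - 1)
    have h2 := h (-(n : ℤ) - 1 + L)
    rw [hc] at h2
    rw [show -(n : ℤ) - 1 + 1 = -n by ring] at h1
    rw [show -(n : ℤ) - 1 + L + 1 = -n + L by ring] at h2
    linarith

/-- Bounded weights growing in every step, compared to `exp (-2 c n)`, except possibly at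
exceptional places. They exist if `c` has nonzero sum `S` over a period, from the exponential
drift, or if there is an exceptional place in each period, where the weights can be reset. -/
lemma exists_periodic_weights {c : ℤ → ℝ} {bad : ℤ → Prop} {L : ℕ} (hL : 0 < L)
    (hc : Function.Periodic c L) (hbad : Function.Periodic bad L)
    (h : (∃ n, bad n) ∨ ∑ j ∈ Finset.Ico (0 : ℤ) (0 + L), c j ≠ 0) :
    ∃ w : ℤ → ℝ, Function.Periodic w L ∧
      ∀ n, bad n ∨ w n < w (n + 1) * Real.exp (2 * c n) := by
  obtain ⟨σ, hσ⟩ := exists_antidifference c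
  have hper := antidifference_add_period hσ hc
  rw [sum_Ico_antidifference hσ, zero_add] at h
  set S := σ L - σ 0
  have hL' : (0 : ℝ) < L := by exact_mod_cast hL
  by_cases hS : S = 0
  · obtain ⟨n₀, hn₀⟩ := h.resolve_right (not_not.2 hS)
    refine ⟨fun n => Real.exp (-2 * σ n) * (((n - n₀ - 1) % L : ℤ) : ℝ), fun n => ?_, fun n => ?_⟩
    · have h1 := hper n
      rw [hS] at h1
      have h2 : (n + L - n₀ - 1) % (L : ℤ) = (n - n₀ - 1) % L := by
        rw [show n + (L : ℤ) - n₀ - 1 = n - n₀ - 1 + L by ring, Int.add_emod_right]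
      simp only [h2, sub_eq_zero.1 h1]
    · by_cases hn : (L : ℤ) ∣ n - n₀
      · left
        obtain ⟨k, hk⟩ := hn
        have h1 := (hbad.int_mul k) n₀
        rw [show n = n₀ + k * L by linarith]
        simpa using h1 ▸ hn₀
      · right
        have h1 : (n + 1 - n₀ - 1) % (L : ℤ) = (n - n₀ - 1) % L + 1 := by
          rw [show n + 1 - n₀ - 1 = n - n₀ by ring]
          have hLz : (0 : ℤ) < L := by exact_mod_cast hL
          have h3 := Int.emod_lt_of_pos (n - n₀) hLz
          have h4 := Int.emod_nonneg (n - n₀) hLz.ne'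
          have h5 : (n - n₀) % (L : ℤ) ≠ 0 := fun h => hn (Int.dvd_of_emod_eq_zero h)
          have h6 : (n - n₀ - 1) % (L : ℤ) = ((n - n₀) % L - 1) % L := by
            rw [Int.emod_sub_emod]
          rw [h6, Int.emod_eq_of_lt (a := (n - n₀) % (L : ℤ) - 1) (by omega) (by omega)]
          ring
        simp only [h1, hσ]
        have h2 : Real.exp (-2 * (σ n + c n)) * (((n - n₀ - 1) % L + 1 : ℤ) : ℝ)
            * Real.exp (2 * c n)
            = Real.exp (-2 * σ n) * (((n - n₀ - 1) % L + 1 : ℤ) : ℝ) := by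
          rw [mul_right_comm, ← Real.exp_add]
          ring_nf
        rw [h2]
        refine mul_lt_mul_of_pos_left ?_ (Real.exp_pos _)
        exact_mod_cast Int.lt_succ _
  · refine ⟨fun n => SignType.sign S * Real.exp (2 * (S * n / L - σ n)), fun n => ?_,
      fun n => Or.inr ?_⟩
    · have h1 := hper n
      have h2 : S * ((n + L : ℤ) : ℝ) / L - σ (n + L) = S * n / L - σ n := by
        push_cast
        rw [mul_add, add_div, mul_div_cancel_right₀ _ hL'.ne']
        linarith
      simp only [h2]
    · have h2 : Real.exp (2 * (S * ((n + 1 : ℤ) : ℝ) / L - σ (n + 1))) * Real.exp (2 * c n)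
          = Real.exp (2 * (S * n / L - σ n)) * Real.exp (2 * (S / L)) := by
        rw [← Real.exp_add, ← Real.exp_add, hσ]
        push_cast
        ring_nf
      simp only [mul_assoc, h2]
      rcases lt_or_gt_of_ne hS with hneg | hpos
      · rw [sign_neg hneg]
        have h3 : Real.exp (2 * (S / L)) < 1 := by
          rw [Real.exp_lt_one_iff]
          have := div_neg_of_neg_of_pos hneg hL'
          linarith
        have h4 := mul_lt_mul_of_pos_left h3 (Real.exp_pos (2 * (S * n / L - σ n)))
        simp
        linarith
      · rw [sign_pos hpos]
        have h3 : 1 < Real.exp (2 * (S / L)) := by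
          rw [Real.one_lt_exp_iff]
          positivity
        have h4 := mul_lt_mul_of_pos_left h3 (Real.exp_pos (2 * (S * n / L - σ n)))
        simp
        linarith

lemma periodic_emod {α : Type*} {w : ℤ → α} {L : ℤ} (hw : Function.Periodic w L) (n : ℤ) :
    w (n % L) = w n := by
  have := (hw.int_mul (n / L)) (n % L)
  rw [← this, Int.cast_id, mul_comm, Int.emod_add_mul_ediv]

lemma bounded_of_periodic {w : ℤ → ℝ} {L : ℕ} (hL : 0 < L) (hw : Function.Periodic w L) :
    ∃ B, ∀ n, |w n| ≤ B := by
  have hLz : (0 : ℤ) < L := by exact_mod_cast hL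
  refine ⟨∑ j ∈ Finset.Ico (0 : ℤ) L, |w j|, fun n => ?_⟩
  rw [← periodic_emod hw n]
  refine Finset.single_le_sum (f := fun j => |w j|) (fun _ _ => abs_nonneg _) ?_
  exact Finset.mem_Ico.2 ⟨Int.emod_nonneg _ hLz.ne', Int.emod_lt_of_pos _ hLz⟩

/-! ### The potential and Neumann bracketing -/

namespace SingleSite

variable {q : ℝ → ℝ} {r : ℝ} {ω : ℤ → ℝ}

lemma eq_zero (hq : SingleSite q r) {x : ℝ} (hx : r < |x|) : q x = 0 := by
  refine image_eq_zero_of_notMem_tsupport fun h => ?_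
  have := hq.support_subset h
  exact absurd (abs_le.2 this) (not_le.2 hx)

lemma dmax_pos (hq : SingleSite q r) : 0 < dmax r := sub_pos.2 hq.r_lt

/-- In the open cell around `n` only the bump number `n` is seen. -/
lemma potential_eq (hq : SingleSite q r) (hω : ∀ n, ω n ∈ Icc (-dmax r) (dmax r)) {n : ℤ} {x : ℝ}
    (hx : x - n ∈ unitCell) : potential q ω x = q (x - n - ω n) := by
  refine tsum_eq_single n fun m hm => hq.eq_zero ?_
  have h1 := hω m
  have h2 := hx.1
  have h3 := hx.2
  simp only [dmax, mem_Icc] at h1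
  rcases lt_or_gt_of_ne hm with h | h
  · have : (m : ℝ) + 1 ≤ n := by exact_mod_cast h
    exact lt_abs.2 (Or.inl (by linarith))
  · have : (n : ℝ) + 1 ≤ m := by exact_mod_cast h
    exact lt_abs.2 (Or.inr (by linarith))

/-- Almost every point lies in an open cell. -/
lemma ae_mem_cell : ∀ᵐ x : ℝ, x - ⌊x + 1 / 2⌋ ∈ unitCell := by
  have h : ∀ᵐ x : ℝ, x ∉ range fun n : ℤ => (n : ℝ) - 1 / 2 :=
    (countable_range _).ae_notMem _
  filter_upwards [h] with x hx
  have h1 := Int.floor_le (x + 1 / 2)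
  have h2 := Int.lt_floor_add_one (x + 1 / 2)
  refine ⟨?_, by linarith⟩
  refine lt_of_le_of_ne (by linarith) fun he => hx ⟨⌊x + 1 / 2⌋, ?_⟩
  simp only
  linarith

lemma potential_ae_eq (hq : SingleSite q r) (hω : ∀ n, ω n ∈ Icc (-dmax r) (dmax r)) :
    potential q ω =ᵐ[volume] fun x => q (x - ⌊x + 1 / 2⌋ - ω ⌊x + 1 / 2⌋) :=
  ae_mem_cell.mono fun _ hx => hq.potential_eq hω hx

lemma aestronglyMeasurable_potential (hq : SingleSite q r)
    (hω : ∀ n, ω n ∈ Icc (-dmax r) (dmax r)) : AEStronglyMeasurable (potential q ω) := by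
  refine AEStronglyMeasurable.congr ?_ (hq.potential_ae_eq hω).symm
  refine Measurable.aestronglyMeasurable (hq.measurable.comp ?_)
  have h1 : Measurable fun x : ℝ => ⌊x + 1 / 2⌋ := Int.measurable_floor.comp (by fun_prop)
  have h2 : Measurable fun x : ℝ => ω ⌊x + 1 / 2⌋ := (measurable_from_top (f := ω)).comp h1
  have h3 : Measurable fun x : ℝ => (⌊x + 1 / 2⌋ : ℝ) :=
    (measurable_from_top (f := fun n : ℤ => (n : ℝ))).comp h1
  exact (measurable_id.sub h3).sub h2

lemma potential_bound (hq : SingleSite q r) (hω : ∀ n, ω n ∈ Icc (-dmax r) (dmax r)) {C : ℝ}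
    (hC : ∀ x, |q x| ≤ C) : ∀ᵐ x, |potential q ω x| ≤ C :=
  (hq.potential_ae_eq hω).mono fun x hx => by rw [hx]; exact hC _

lemma hamiltonian_eq : hamiltonian q ω = neumannLaplacian univ + mulOp univ (potential q ω) := by
  rw [hamiltonian, negLaplacian_eq]

/-- Neumann bracketing: lower bounds in the cells, up to boundary terms that telescope, add up to a
lower bound of the form on the line. -/
lemma form_bound_line (hq : SingleSite q r) (hω : ∀ n, ω n ∈ Icc (-dmax r) (dmax r)) {γ B : ℝ}
    {β : ℤ → ℝ} (hβ : ∀ n, |β n| ≤ B)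
    (hcell : ∀ n, ∀ u g : ℝ → ℂ, IsPrim u g →
      IntervalIntegrable (fun x => ‖g x‖ ^ 2) volume (-1 / 2) (1 / 2) →
      β (n + 1) * ‖u (1 / 2)‖ ^ 2 - β n * ‖u (-1 / 2)‖ ^ 2
        ≤ ∫ x in (-1 / 2)..(1 / 2), (‖g x‖ ^ 2 + (q (x - ω n) - γ) * ‖u x‖ ^ 2))
    {u g : L2 univ} (hu : HasWeakDeriv univ u g) :
    γ * ‖u‖ ^ 2 ≤ ‖g‖ ^ 2 + ∫ x in univ, potential q ω x * ‖u x‖ ^ 2 := by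
  obtain ⟨C, hC⟩ := hq.bounded
  obtain ⟨v, hv1, hv2⟩ := hu.exists_isPrim_univ
  have hv : MemLp v 2 := (memLp_univ u).ae_eq hv2
  have hg2 : Integrable (fun x => ‖g x‖ ^ 2) :=
    (memLp_univ g).integrable_norm_pow two_ne_zero
  have hvi : Integrable (fun x => ‖v x‖ ^ 2) := hv.integrable_norm_pow two_ne_zero
  have hVv : Integrable (fun x => potential q ω x * ‖v x‖ ^ 2) :=
    hvi.bdd_mul (hq.aestronglyMeasurable_potential hω) (hq.potential_bound hω hC)
  set F : ℝ → ℝ := fun x => ‖g x‖ ^ 2 + (potential q ω x - γ) * ‖v x‖ ^ 2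
  have hF : Integrable F := by
    have : F = fun x => ‖g x‖ ^ 2 + (potential q ω x * ‖v x‖ ^ 2 - γ * ‖v x‖ ^ 2) := by
      ext x; simp only [F]; ring
    rw [this]
    exact hg2.add (hVv.sub (hvi.const_mul γ))
  have hpiece : ∀ n : ℤ, β (n + 1) * ‖v (n + 1 / 2)‖ ^ 2 - β n * ‖v (n - 1 / 2)‖ ^ 2
      ≤ ∫ x in (n - 1 / 2 : ℝ)..(n + 1 / 2), F x := by
    intro n
    have h1 := hcell n (fun x => v (x + n)) (fun x => g (x + n)) (hv1.comp_add_right n)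
      ((hg2.comp_add_right (n : ℝ)).intervalIntegrable)
    have h2 : ∫ x in (-1 / 2)..(1 / 2), (‖g (x + n)‖ ^ 2 + (q (x - ω n) - γ) * ‖v (x + n)‖ ^ 2)
        = ∫ x in (-1 / 2)..(1 / 2), F (x + n) := by
      refine intervalIntegral.integral_congr_ae ?_
      filter_upwards [ae_mem_unitCell] with x hx hx2
      simp only [F]
      rw [hq.potential_eq hω (n := n) (by simpa using hx hx2), add_sub_cancel_right]
    rw [h2, intervalIntegral.integral_comp_add_right] at h1
    rwa [show -1 / 2 + (n : ℝ) = n - 1 / 2 by ring, show 1 / 2 + (n : ℝ) = n + 1 / 2 by ring] at h1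
  have hsum : ∀ N : ℕ, β N * ‖v (N - 1 / 2)‖ ^ 2 - β (-N) * ‖v (-N - 1 / 2)‖ ^ 2
      ≤ ∫ x in (-N - 1 / 2 : ℝ)..(N - 1 / 2), F x := by
    intro N
    have h1 := intervalIntegral.sum_integral_adjacent_intervals (n := 2 * N) (f := F) (μ := volume)
      (a := fun k : ℕ => (k : ℝ) - N - 1 / 2) (fun k _ => hF.intervalIntegrable)
    have h2 := Finset.sum_range_sub
      (fun k : ℕ => β (k - N) * ‖v ((k : ℝ) - N - 1 / 2)‖ ^ 2) (2 * N)
    have e1 : ((2 * N : ℕ) : ℝ) - N - 1 / 2 = N - 1 / 2 := by push_cast; ring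
    have e2 : ((2 * N : ℕ) : ℤ) - N = N := by push_cast; ring
    have e3 : ((0 : ℕ) : ℝ) - N - 1 / 2 = -N - 1 / 2 := by simp
    have e4 : ((0 : ℕ) : ℤ) - N = -N := by simp
    simp only [e1, e2, e3, e4] at h1 h2
    rw [← h1, ← h2]
    refine Finset.sum_le_sum fun k _ => ?_
    have h3 := hpiece (k - N)
    push_cast at h3 ⊢
    rwa [show (k : ℤ) + 1 - N = k - N + 1 by ring,
      show (k : ℝ) + 1 - N - 1 / 2 = k - N + 1 / 2 by ring]
  have hnorm := hv1.norm_sq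
  have hderiv : Integrable fun x => 2 * (conj (v x) * g x).re :=
    (integrable_conj_mul hv (memLp_univ g)).re.const_mul 2
  have hinf : Tendsto (fun N : ℕ => (N : ℝ) - 1 / 2) atTop atTop :=
    tendsto_atTop_add_const_right _ _ tendsto_natCast_atTop_atTop
  have hinf' : Tendsto (fun N : ℕ => -(N : ℝ) - 1 / 2) atTop atBot :=
    tendsto_atBot_add_const_right _ _ (tendsto_neg_atTop_atBot.comp tendsto_natCast_atTop_atTop)
  have hlim : ∀ (ν : ℕ → ℤ) (x : ℕ → ℝ), Tendsto (fun N => ‖v (x N)‖ ^ 2) atTop (𝓝 0) →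
      Tendsto (fun N => β (ν N) * ‖v (x N)‖ ^ 2) atTop (𝓝 0) := fun ν x h =>
    bdd_le_mul_tendsto_zero' B (.of_forall fun N => hβ _) h
  have h3 := (hlim (fun N => N) _ ((hnorm.tendsto_atTop hvi hderiv).comp hinf)).sub
    (hlim (fun N => -N) _ ((hnorm.tendsto_atBot hvi hderiv).comp hinf'))
  have h4 := le_of_tendsto_of_tendsto' h3 (intervalIntegral_tendsto_integral hF hinf' hinf) hsum
  have hsub : Integrable fun x => potential q ω x * ‖v x‖ ^ 2 - γ * ‖v x‖ ^ 2 :=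
    hVv.sub (hvi.const_mul γ)
  have e5 : ∫ x, F x = (∫ x, ‖g x‖ ^ 2) + ((∫ x, potential q ω x * ‖v x‖ ^ 2)
      - γ * ∫ x, ‖v x‖ ^ 2) := by
    rw [← integral_const_mul, ← integral_sub hVv (hvi.const_mul γ),
      ← integral_add hg2 hsub]
    exact integral_congr_ae (.of_forall fun x => by simp only [F]; ring)
  have e6 : ∫ x, potential q ω x * ‖u x‖ ^ 2 = ∫ x, potential q ω x * ‖v x‖ ^ 2 :=
    integral_congr_ae (hv2.mono fun x hx => by simp only [hx])
  have e7 : ∫ x, ‖u x‖ ^ 2 = ∫ x, ‖v x‖ ^ 2 :=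
    integral_congr_ae (hv2.mono fun x hx => by simp only [hx])
  rw [norm_sq_L2, norm_sq_L2, setIntegral_univ, setIntegral_univ,
    setIntegral_univ, e6, e7]
  rw [e5] at h4
  simp only [sub_zero] at h4
  linarith

end SingleSite

end RDM

namespace RDM

open MeasureTheory Set Filter Topology
open scoped ComplexConjugate

/-! ### Lower bounds for the spectrum on the line -/

/-- A choice of Neumann ground states, given by their logarithmic derivatives `p a`, for all positions
`a` of the bump, which respects the reflection between the two maximal displacements. -/
structure IsCellFamily (q : ℝ → ℝ) (r : ℝ) (p : ℝ → ℝ → ℝ) : Prop where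
  isRiccati : ∀ a, IsRiccati (fun x => q (x - a)) (neumannEnergy q a) (p a)
  reflect : ∀ x, p (-dmax r) x = -p (dmax r) (-x)

namespace SingleSite

variable {q : ℝ → ℝ} {r : ℝ}

lemma measurable_shift (hq : SingleSite q r) (a : ℝ) : Measurable fun x => q (x - a) :=
  hq.measurable.comp (measurable_id.sub_const a)

lemma neumannEnergy_eq (hq : SingleSite q r) {a E : ℝ} {p : ℝ → ℝ}
    (h : IsRiccati (fun x => q (x - a)) E p) : neumannEnergy q a = E := by
  obtain ⟨C, hC⟩ := hq.bounded
  exact h.sInf_realSpectrum (hq.measurable_shift a) fun x => hC _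

lemma exists_cellFamily (hq : SingleSite q r) : ∃ p, IsCellFamily q r p := by
  obtain ⟨C, hC⟩ := hq.bounded
  have h : ∀ a, ∃ p, IsRiccati (fun x => q (x - a)) (neumannEnergy q a) p := fun a => by
    obtain ⟨E, p, hp⟩ := exists_isRiccati (hq.measurable_shift a) (fun x => hC (x - a))
    exact ⟨p, by rwa [hq.neumannEnergy_eq hp]⟩
  choose p hp using h
  refine ⟨fun a => if a = -dmax r then fun x => -p (dmax r) (-x) else p a, fun a => ?_,
    fun x => ?_⟩
  · split_ifs with ha
    · have h1 := (hp (dmax r)).reflect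
      have e : (fun x => q (-x - dmax r)) = fun x => q (x - a) := by
        ext x
        rw [ha, ← hq.symmetric (x - -dmax r)]
        ring_nf
      rw [e] at h1
      rwa [hq.neumannEnergy_eq h1]
    · exact hp a
  · have h1 : dmax r ≠ -dmax r := by have := hq.dmax_pos; intro h; linarith
    simp [h1]

/-- Reflection symmetry of the extremal cells. -/
lemma neumannEnergy_neg_dmax (hq : SingleSite q r) :
    neumannEnergy q (-dmax r) = neumannEnergy q (dmax r) := by
  obtain ⟨p, hp⟩ := hq.exists_cellFamily
  have h1 := (hp.isRiccati (dmax r)).reflect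
  have e : (fun x => q (-x - dmax r)) = fun x => q (x - -dmax r) := by
    ext x
    rw [← hq.symmetric (x - -dmax r)]
    ring_nf
  rw [e] at h1
  exact hq.neumannEnergy_eq h1

lemma neumannEnergy_eq_of_abs (hq : SingleSite q r) {a : ℝ} (ha : a = dmax r ∨ a = -dmax r) :
    neumannEnergy q a = neumannEnergy q (dmax r) := by
  rcases ha with rfl | rfl
  · rfl
  · exact hq.neumannEnergy_neg_dmax

lemma neumannEnergy_lt (_hq : SingleSite q r) (hE : StrictExtrema q r) {a : ℝ}
    (ha : a ∈ Icc (-dmax r) (dmax r)) (h : ¬(a = dmax r ∨ a = -dmax r)) :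
    neumannEnergy q (dmax r) < neumannEnergy q a := by
  rw [not_or] at h
  exact hE.min_corners _ (by simp) a ⟨lt_of_le_of_ne ha.1 (Ne.symm h.2), lt_of_le_of_ne ha.2 h.1⟩

lemma neumannEnergy_le (hq : SingleSite q r) (hE : StrictExtrema q r) {a : ℝ}
    (ha : a ∈ Icc (-dmax r) (dmax r)) : neumannEnergy q (dmax r) ≤ neumannEnergy q a := by
  by_cases h : a = dmax r ∨ a = -dmax r
  · exact (hq.neumannEnergy_eq_of_abs h).ge
  · exact (hq.neumannEnergy_lt hE ha h).le

lemma not_mem_realSpectrum_of_cells (hq : SingleSite q r) {ω : ℤ → ℝ}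
    (hω : ∀ n, ω n ∈ Icc (-dmax r) (dmax r)) {γ B t : ℝ} {β : ℤ → ℝ} (hβ : ∀ n, |β n| ≤ B)
    (hcell : ∀ n, ∀ u g : ℝ → ℂ, IsPrim u g →
      IntervalIntegrable (fun x => ‖g x‖ ^ 2) volume (-1 / 2) (1 / 2) →
      β (n + 1) * ‖u (1 / 2)‖ ^ 2 - β n * ‖u (-1 / 2)‖ ^ 2
        ≤ ∫ x in (-1 / 2)..(1 / 2), (‖g x‖ ^ 2 + (q (x - ω n) - γ) * ‖u x‖ ^ 2))
    (ht : t < γ) : t ∉ realSpectrum (hamiltonian q ω) := by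
  obtain ⟨C, hC⟩ := hq.bounded
  rw [hamiltonian_eq]
  refine not_mem_realSpectrum_of_form_bound isOpen_univ (C := C) ?_ ?_
    (fun u g hu => hq.form_bound_line hω hβ hcell hu) ht
  · rw [Measure.restrict_univ]
    exact hq.aestronglyMeasurable_potential hω
  · rw [Measure.restrict_univ]
    exact hq.potential_bound hω hC

/-- Neumann bracketing: the spectrum lies above the lowest cell energy. -/
theorem neumannEnergy_le_of_mem_realSpectrum (hq : SingleSite q r) (hE : StrictExtrema q r)
    {ω : ℤ → ℝ} (hω : ∀ n, ω n ∈ Icc (-dmax r) (dmax r)) {t : ℝ}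
    (ht : t ∈ realSpectrum (hamiltonian q ω)) : neumannEnergy q (dmax r) ≤ t := by
  by_contra hlt
  obtain ⟨C, hC⟩ := hq.bounded
  obtain ⟨p, hp⟩ := hq.exists_cellFamily
  refine hq.not_mem_realSpectrum_of_cells hω (β := 0) (B := 0) (by simp)
    (fun n u g hu hg => ?_) (not_le.1 hlt) ht
  simp only [Pi.zero_apply, zero_mul, sub_zero]
  exact (hp.isRiccati (ω n)).cell_bound (hq.measurable_shift _) (fun x => hC _)
    (hq.neumannEnergy_le hE (hω n)) hu hg

/-- If `r < 0`, then `q = 0` and all cells have the same energy. -/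
lemma r_nonneg (hq : SingleSite q r) (hE : StrictExtrema q r) : 0 ≤ r := by
  by_contra hr
  have hd := hq.dmax_pos
  have h0 : ∀ x, q x = 0 := fun x => hq.eq_zero ((not_le.1 hr).trans_le (abs_nonneg x))
  have h1 := hE.max_zero (dmax r) ⟨by linarith, le_rfl⟩ hd.ne'
  have e : neumannHamiltonian q (dmax r) = neumannHamiltonian q 0 := by
    simp only [neumannHamiltonian, h0]
  rw [neumannEnergy, neumannEnergy, e] at h1
  exact lt_irrefl _ h1

/-- The ground state of the cell with maximally displaced bump takes different values at the two
ends; otherwise the centred bump would have at most the same energy, against the assumption that its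
energy is the strict maximum. -/
lemma integral_ne_zero (hq : SingleSite q r) (hE : StrictExtrema q r) {p : ℝ → ℝ → ℝ}
    (hp : IsCellFamily q r p) : ∫ x in (-1 / 2)..(1 / 2), p (dmax r) x ≠ 0 := by
  intro h0
  obtain ⟨C, hC⟩ := hq.bounded
  have hd := hq.dmax_pos
  have h1 := hE.max_zero (dmax r) ⟨by linarith, le_rfl⟩ hd.ne'
  have h2 := hp.isRiccati 0
  simp only [sub_zero] at h2
  exact absurd h1 (not_lt.2 (IsRiccati.energy_le_of_integral_eq_zero hq.measurable hC
    (fun x hx => hq.eq_zero hx) (hq.r_nonneg hE) hq.r_lt (hp.isRiccati (dmax r)) h2 h0))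

lemma integral_neg_dmax {p : ℝ → ℝ → ℝ} (hp : IsCellFamily q r p) :
    ∫ x in (-1 / 2)..(1 / 2), p (-dmax r) x = -∫ x in (-1 / 2)..(1 / 2), p (dmax r) x := by
  rw [← IsRiccati.integral_reflect]
  simp only [hp.reflect]

/-- A periodic configuration has energy strictly above that of a single extremal cell if some bump is
not maximally displaced, or if the growth factors of the cell ground states over one period do not
cancel. -/
theorem not_mem_realSpectrum_of_periodic (hq : SingleSite q r) (hE : StrictExtrema q r)
    {p : ℝ → ℝ → ℝ} (hp : IsCellFamily q r p) {ω : ℤ → ℝ}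
    (hω : ∀ n, ω n ∈ Icc (-dmax r) (dmax r)) {L : ℕ} (hL : 0 < L)
    (hper : Function.Periodic ω L)
    (h : (∃ n, ¬(ω n = dmax r ∨ ω n = -dmax r)) ∨
      ∑ j ∈ Finset.Ico (0 : ℤ) (0 + L), ∫ x in (-1 / 2)..(1 / 2), p (ω j) x ≠ 0) :
    neumannEnergy q (dmax r) ∉ realSpectrum (hamiltonian q ω) := by
  obtain ⟨C, hC⟩ := hq.bounded
  set E₀ := neumannEnergy q (dmax r)
  obtain ⟨w, hw, hwn⟩ := exists_periodic_weights (c := fun n => ∫ x in (-1 / 2)..(1 / 2), p (ω n) x)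
    (bad := fun n => ¬(ω n = dmax r ∨ ω n = -dmax r)) hL (fun n => by simp only [hper n])
    (fun n => by simp only [hper n]) h
  have hloc : ∀ n, ∀ᶠ ε in 𝓝[>] (0 : ℝ), ∀ᶠ δ in 𝓝[>] (0 : ℝ), ∀ u g : ℝ → ℂ, IsPrim u g →
      IntervalIntegrable (fun x => ‖g x‖ ^ 2) volume (-1 / 2) (1 / 2) →
      -ε * (w (n + 1) * ‖u (1 / 2)‖ ^ 2 - w n * ‖u (-1 / 2)‖ ^ 2)
        ≤ ∫ x in (-1 / 2)..(1 / 2), (‖g x‖ ^ 2 + (q (x - ω n) - E₀ - δ) * ‖u x‖ ^ 2) := fun n =>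
    (hp.isRiccati (ω n)).eventually_cell_gap (hq.measurable_shift _) (fun x => hC _)
      (hq.neumannEnergy_le hE (hω n)) ((hwn n).imp_left (hq.neumannEnergy_lt hE (hω n)))
  -- finitely many cells suffice, by periodicity
  have hfin := (Finset.eventually_all (Finset.Ico (0 : ℤ) L)).2 fun n _ => hloc n
  obtain ⟨ε, hε⟩ := hfin.exists
  have hfin2 := (Finset.eventually_all (Finset.Ico (0 : ℤ) L)).2 hε
  obtain ⟨δ, hδ, hδ0⟩ := (hfin2.and self_mem_nhdsWithin).exists
  obtain ⟨B, hB⟩ := bounded_of_periodic hL hw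
  have hLz : (0 : ℤ) < L := by exact_mod_cast hL
  refine hq.not_mem_realSpectrum_of_cells hω (γ := E₀ + δ) (β := fun n => -ε * w n)
    (B := |ε| * B) (fun n => ?_) (fun n u g hu hg => ?_) (lt_add_of_pos_right _ hδ0)
  · rw [abs_mul, abs_neg]
    exact mul_le_mul_of_nonneg_left (hB n) (abs_nonneg _)
  · have h1 := hδ (n % L) (Finset.mem_Ico.2 ⟨Int.emod_nonneg _ hLz.ne', Int.emod_lt_of_pos _ hLz⟩)
      u g hu hg
    have h2 : w (n % L + 1) = w (n + 1) := by
      have : Function.Periodic (fun n => w (n + 1)) L := fun n => by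
        beta_reduce
        rw [add_right_comm, hw]
      exact periodic_emod this n
    rw [h2, periodic_emod hw, periodic_emod hper] at h1
    calc _ = -ε * (w (n + 1) * ‖u (1 / 2)‖ ^ 2 - w n * ‖u (-1 / 2)‖ ^ 2) := by ring
      _ ≤ _ := h1
      _ = _ := by simp only [sub_sub]

end SingleSite

end RDM

namespace RDM

open MeasureTheory Set Filter Topology
open scoped ComplexConjugate

/-! ### Bounded positive solutions for balanced configurations -/

/-- A function that is a primitive of `f'` on each cell is a primitive of `f'` on the line. -/
lemma IsPrim.of_cells {f f' : ℝ → ℝ} (hf' : ∀ a b, IntervalIntegrable f' volume a b)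
    (h : ∀ n : ℤ, ∀ x ∈ Icc (n - 1 / 2 : ℝ) (n + 1 / 2),
      ∫ t in (n - 1 / 2 : ℝ)..x, f' t = f x - f (n - 1 / 2)) : IsPrim f f' := by
  have hG := IsPrim.primitive hf' 0
  set G : ℝ → ℝ := fun x => ∫ t in (0 : ℝ)..x, f' t
  have h1 : ∀ n : ℤ, ∀ x ∈ Icc (n - 1 / 2 : ℝ) (n + 1 / 2),
      f x - G x = f (n - 1 / 2) - G (n - 1 / 2) := fun n x hx => by
    have := h n x hx
    rw [hG.integral_eq] at this
    linarith
  have hstep : ∀ n : ℤ, f ((n + 1 : ℤ) - 1 / 2) - G ((n + 1 : ℤ) - 1 / 2)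
      = f (n - 1 / 2) - G (n - 1 / 2) := fun n => by
    refine h1 n _ ?_
    push_cast
    constructor <;> linarith
  have h2 : ∀ n : ℤ, f (n - 1 / 2) - G (n - 1 / 2) = f ((0 : ℤ) - 1 / 2) - G ((0 : ℤ) - 1 / 2) := by
    intro n
    induction n using Int.induction_on with
    | zero => rfl
    | succ n ih => rw [hstep, ih]
    | pred n ih =>
      rw [← hstep, ← ih, sub_add_cancel]
  have h3 : ∀ x, f x - G x = f ((0 : ℤ) - 1 / 2) - G ((0 : ℤ) - 1 / 2) := fun x => by
    rw [← h2 ⌊x + 1 / 2⌋]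
    refine h1 _ x ⟨?_, ?_⟩
    · linarith [Int.floor_le (x + 1 / 2)]
    · linarith [Int.lt_floor_add_one (x + 1 / 2)]
  refine ⟨hf', fun a b => ?_⟩
  rw [hG.integral_eq]
  linarith [h3 a, h3 b]

namespace SingleSite

variable {q : ℝ → ℝ} {r : ℝ}

/-- If all bumps are maximally displaced, the ground states of the cells can be glued to a positive
solution on the line; if the growth factors cancel over a period, it is bounded from above
and below. -/
lemma exists_bounded_solution (hq : SingleSite q r) {p : ℝ → ℝ → ℝ} (hp : IsCellFamily q r p)
    {ω : ℤ → ℝ} (hω : ∀ n, ω n = dmax r ∨ ω n = -dmax r) {L : ℕ} (hL : 0 < L)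
    (hper : Function.Periodic ω L)
    (hsum : ∑ j ∈ Finset.Ico (0 : ℤ) (0 + L), ∫ x in (-1 / 2)..(1 / 2), p (ω j) x = 0) :
    ∃ (Ψ Ψ' : ℝ → ℝ) (m K : ℝ), IsPrim Ψ Ψ' ∧
      IsPrim Ψ' (fun x => (potential q ω x - neumannEnergy q (dmax r)) * Ψ x) ∧
      0 < m ∧ (∀ x, m ≤ Ψ x) ∧ (∀ x, |Ψ x| ≤ K) ∧ ∀ x, |Ψ' x| ≤ K := by
  obtain ⟨C, hC⟩ := hq.bounded
  have hd := hq.dmax_pos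
  have hωI : ∀ n, ω n ∈ Icc (-dmax r) (dmax r) := fun n => by
    rcases hω n with h | h <;> rw [h] <;> constructor <;> linarith
  set E := neumannEnergy q (dmax r)
  have hR : ∀ n, IsRiccati (fun x => q (x - ω n)) E (p (ω n)) := fun n => by
    have := hp.isRiccati (ω n)
    rwa [hq.neumannEnergy_eq_of_abs (hω n)] at this
  -- a uniform bound for the logarithmic derivatives
  obtain ⟨B, hB⟩ : ∃ B, ∀ n x, |p (ω n) x| ≤ B := by
    obtain ⟨B, hB⟩ := isCompact_Icc.exists_bound_of_continuousOn
      ((hp.isRiccati (dmax r)).continuous.continuousOn (s := Icc (-1 / 2 : ℝ) (1 / 2)))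
    have hB0 : 0 ≤ B := (norm_nonneg _).trans (hB 0 (by constructor <;> norm_num))
    have h1 : ∀ x, |p (dmax r) x| ≤ B := fun x => by
      by_cases hx : x ∈ unitCell
      · exact hB x (Ioo_subset_Icc_self hx)
      · rw [(hp.isRiccati (dmax r)).eq_zero x hx, abs_zero]
        exact hB0
    refine ⟨B, fun n x => ?_⟩
    rcases hω n with h | h
    · rw [h]; exact h1 x
    · rw [h, hp.reflect, abs_neg]; exact h1 _
  set P : ℝ → ℝ := fun x => p (ω ⌊x + 1 / 2⌋) (x - ⌊x + 1 / 2⌋)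
  have hPB : ∀ x, |P x| ≤ B := fun x => hB _ _
  have hPm : Measurable P := by
    have h1 : Measurable fun x : ℝ => ⌊x + 1 / 2⌋ := Int.measurable_floor.comp (by fun_prop)
    have h3 : Measurable fun x : ℝ => (⌊x + 1 / 2⌋ : ℝ) :=
      (measurable_from_top (f := fun n : ℤ => (n : ℝ))).comp h1
    have h2 : Measurable fun z : ℤ × ℝ => p (ω z.1) z.2 :=
      measurable_from_prod_countable_right fun n => (hR n).continuous.measurable
    exact h2.comp (h1.prodMk (measurable_id.sub h3))
  have hPcell : ∀ n : ℤ, ∀ x ∈ Icc (n - 1 / 2 : ℝ) (n + 1 / 2), P x = p (ω n) (x - n) := by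
    intro n x hx
    rcases eq_or_lt_of_le hx.2 with h | h
    · have h1 : ⌊x + 1 / 2⌋ = n + 1 := by
        rw [h, Int.floor_eq_iff]
        push_cast
        constructor <;> linarith
      simp only [P]
      rw [h1, h, (hR n).eq_zero, (hR (n + 1)).eq_zero]
      · rintro ⟨h2, -⟩
        push_cast at h2
        linarith
      · rintro ⟨-, h2⟩
        linarith
    · have h1 : ⌊x + 1 / 2⌋ = n := by
        rw [Int.floor_eq_iff]
        constructor <;> linarith [hx.1]
      simp only [P, h1]
  have hVm := hq.aestronglyMeasurable_potential hωI
  have hVi : ∀ a b, IntervalIntegrable (potential q ω) volume a b := fun a b =>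
    (intervalIntegrable_const (c := C)).mono_fun hVm.restrict (ae_restrict_of_ae
      ((hq.potential_bound hωI hC).mono fun x hx => by
        change |potential q ω x| ≤ |C|
        exact hx.trans (le_abs_self C)))
  have hP2 : ∀ a b, IntervalIntegrable (fun x => P x ^ 2) volume a b :=
    intervalIntegrable_of_bounded (hPm.pow_const 2) (C := B ^ 2) fun x => by
      rw [abs_pow]
      exact pow_le_pow_left₀ (abs_nonneg _) (hPB x) 2
  have hPP : IsPrim P (fun x => potential q ω x - E - P x ^ 2) := by
    refine IsPrim.of_cells (fun a b => ((hVi a b).sub intervalIntegrable_const).sub (hP2 a b))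
      fun n x hx => ?_
    have hn : (n - 1 / 2 : ℝ) ∈ Icc (n - 1 / 2 : ℝ) (n + 1 / 2) := by constructor <;> linarith
    rw [hPcell n x hx, hPcell n _ hn, ← ((hR n).isPrim.comp_sub_right n).integral_eq]
    refine intervalIntegral.integral_congr_ae ?_
    have hne : ∀ᵐ t : ℝ, t ≠ n + 1 / 2 := by simp [ae_iff]
    filter_upwards [hne] with t ht ht2
    rw [uIoc_of_le hx.1] at ht2
    have ht3 : t < n + 1 / 2 := lt_of_le_of_ne (ht2.2.trans hx.2) ht
    have hcell : t - n ∈ unitCell := ⟨by linarith [ht2.1], by linarith⟩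
    rw [indicator_of_mem hcell, hq.potential_eq hωI hcell, hPcell n t ⟨ht2.1.le, ht3.le⟩]
  have hPc := hPP.continuous
  -- the logarithm of the solution is bounded
  set T : ℤ → ℝ := fun n => ∫ t in (-1 / 2)..(n - 1 / 2 : ℝ), P t
  have hT : ∀ n, T (n + 1) = T n + ∫ x in (-1 / 2)..(1 / 2), p (ω n) x := fun n => by
    simp only [T]
    rw [← intervalIntegral.integral_add_adjacent_intervals (b := (n - 1 / 2 : ℝ))
      (hPc.intervalIntegrable _ _) (hPc.intervalIntegrable _ _), add_right_inj]
    have e : ∫ t in (n - 1 / 2 : ℝ)..((n + 1 : ℤ) - 1 / 2 : ℝ), P t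
        = ∫ t in (n - 1 / 2 : ℝ)..((n + 1 : ℤ) - 1 / 2 : ℝ), p (ω n) (t - n) := by
      refine intervalIntegral.integral_congr fun t ht => hPcell n t ?_
      push_cast at ht
      rw [uIcc_of_le (by linarith)] at ht
      exact ⟨ht.1, by linarith [ht.2]⟩
    rw [e, intervalIntegral.integral_comp_sub_right]
    congr 1 <;> push_cast <;> ring
  have hTper : Function.Periodic T L := fun n => by
    have h1 := antidifference_add_period (L := (L : ℤ)) hT (fun n => by beta_reduce; rw [hper n]) n
    rw [sum_Ico_antidifference hT, zero_add] at hsum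
    linarith
  obtain ⟨K, hK⟩ := bounded_of_periodic hL hTper
  have hlog : ∀ x, |∫ t in (-1 / 2)..x, P t| ≤ K + B := fun x => by
    have h1 := Int.floor_le (x + 1 / 2)
    have h2 := Int.lt_floor_add_one (x + 1 / 2)
    rw [← intervalIntegral.integral_add_adjacent_intervals (b := (⌊x + 1 / 2⌋ - 1 / 2 : ℝ))
      (hPc.intervalIntegrable _ _) (hPc.intervalIntegrable _ _)]
    refine (abs_add_le _ _).trans (add_le_add (hK _) ?_)
    have h3 := intervalIntegral.norm_integral_le_of_norm_le_const
      (C := B) (f := P)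
      (a := (⌊x + 1 / 2⌋ - 1 / 2 : ℝ)) (b := x) (fun t _ => hPB t)
    rw [Real.norm_eq_abs] at h3
    refine h3.trans (mul_le_of_le_one_right ((abs_nonneg _).trans (hPB 0)) ?_)
    rw [abs_of_nonneg (by linarith)]
    linarith
  have hΨ := isPrim_exp_integral hPc (-1 / 2)
  set Ψ : ℝ → ℝ := fun x => Real.exp (∫ t in (-1 / 2)..x, P t)
  have hΨK : ∀ x, |Ψ x| ≤ Real.exp (K + B) := fun x => by
    rw [abs_of_pos (Real.exp_pos _)]
    exact Real.exp_le_exp.2 (abs_le.1 (hlog x)).2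
  have hB0 : 0 ≤ B := (abs_nonneg _).trans (hPB 0)
  refine ⟨Ψ, fun x => P x * Ψ x, Real.exp (-(K + B)), (1 + B) * Real.exp (K + B), hΨ, ?_,
    Real.exp_pos _, fun x => Real.exp_le_exp.2 (abs_le.1 (hlog x)).1, fun x => ?_, fun x => ?_⟩
  · convert hPP.mul hΨ using 2 with x
    ring
  · exact (hΨK x).trans (le_mul_of_one_le_left (Real.exp_pos _).le (by linarith))
  · rw [abs_mul]
    have h1 := mul_le_mul (hPB x) (hΨK x) (abs_nonneg _) hB0
    have h2 := Real.exp_pos (K + B)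
    linarith

end SingleSite

/-! ### Continuity of translations -/

lemma tendsto_integral_shift {q : ℝ → ℝ} (hq : MemLp q 2 volume) :
    Tendsto (fun t => ∫ x, (q (x - t) - q x) ^ 2) (𝓝 0) (𝓝 0) := by
  set Q : Lp ℝ 2 (volume : Measure ℝ) := hq.toLp q
  let g : ℝ → C(ℝ, ℝ) := (ContinuousMap.mk (fun a : ℝ × ℝ => a.2 - a.1) (by fun_prop)).curry
  have hg : Continuous g := ContinuousMap.continuous _
  have hmp : ∀ t, MeasurePreserving (g t) volume volume := fun t =>
    measurePreserving_sub_right volume t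
  have h1 : Continuous fun t => ‖Lp.compMeasurePreserving (g t) (hmp t) Q - Q‖ ^ 2 :=
    (((continuous_const (y := Q)).compMeasurePreservingLp hg hmp (by norm_num)).sub
      continuous_const).norm.pow 2
  have h2 : ∀ t, ‖Lp.compMeasurePreserving (g t) (hmp t) Q - Q‖ ^ 2
      = ∫ x, (q (x - t) - q x) ^ 2 := fun t => by
    rw [← real_inner_self_eq_norm_sq, L2.inner_def]
    refine integral_congr_ae ?_
    have h3 : Q =ᵐ[volume] q := MemLp.coeFn_toLp _
    filter_upwards [Lp.coeFn_sub (Lp.compMeasurePreserving (g t) (hmp t) Q) Q,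
      Lp.coeFn_compMeasurePreserving Q (hmp t), h3,
      (hmp t).quasiMeasurePreserving.ae_eq_comp h3] with x e1 e2 e3 e4
    rw [e1, Pi.sub_apply, e2, e3, e4, real_inner_self_eq_norm_sq, Real.norm_eq_abs, sq_abs]
    rfl
  have h3 := h1.tendsto 0
  simp only [h2] at h3
  simpa using h3

/-- On a cell, the bump depends continuously in `L²` on its position. -/
lemma SingleSite.exists_shift_bound {q : ℝ → ℝ} {r : ℝ} (hq : SingleSite q r) {η : ℝ} (hη : 0 < η) :
    ∃ ε > 0, ∀ a b, |a - b| < ε →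
      ∫ x in (-1 / 2)..(1 / 2), (q (x - a) - q (x - b)) ^ 2 ≤ η := by
  obtain ⟨C, hC⟩ := hq.bounded
  have hmem : MemLp q 2 volume := by
    have : (Icc (-r) r).indicator q = q := indicator_eq_self.2 fun x hx =>
      hq.support_subset (subset_tsupport q hx)
    rw [← this, memLp_indicator_iff_restrict measurableSet_Icc]
    exact MemLp.of_bound hq.measurable.aestronglyMeasurable C (.of_forall hC)
  have h1 := (tendsto_integral_shift hmem).eventually (ge_mem_nhds hη)
  obtain ⟨ε, hε, h2⟩ := Metric.eventually_nhds_iff.1 h1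
  refine ⟨ε, hε, fun a b hab => ?_⟩
  have h3 := h2 (y := a - b) (by rwa [Real.dist_0_eq_abs])
  have hshift : ∀ t, MemLp (fun x => q (x - t)) 2 volume := fun t =>
    hmem.comp_measurePreserving (measurePreserving_sub_right volume t)
  have h4 : Integrable fun x => (q (x - a) - q (x - b)) ^ 2 :=
    ((hshift a).sub (hshift b)).integrable_sq
  rw [intervalIntegral.integral_of_le (by norm_num)]
  refine (setIntegral_le_integral h4 (.of_forall fun x => sq_nonneg _)).trans ?_
  refine le_of_eq_of_le ?_ h3
  rw [← integral_sub_right_eq_self (fun x => (q (x - (a - b)) - q x) ^ 2) b]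
  simp only [sub_sub, add_sub_cancel]

end RDM

namespace RDM

open MeasureTheory Set Filter Topology

/-! ### Approximate eigenfunctions -/

namespace SingleSite

variable {q : ℝ → ℝ} {r : ℝ} {ω : ℤ → ℝ}

/-- Real functions with square integrable second derivative belong to the domain of `H_ω`. -/
lemma exists_mem_graph (hq : SingleSite q r) (hω : ∀ n, ω n ∈ Icc (-dmax r) (dmax r))
    {u u₁ u₂ : ℝ → ℝ} (h1 : IsPrim u u₁) (h2 : IsPrim u₁ u₂) (m0 : MemLp u 2) (m1 : MemLp u₁ 2)
    (m2 : MemLp u₂ 2) (t : ℝ) :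
    ∃ p ∈ (hamiltonian q ω).graph, ‖p.1‖ ^ 2 = ∫ x, u x ^ 2 ∧
      ‖p.2 - (t : ℂ) • p.1‖ ^ 2 = ∫ x, (-u₂ x + (potential q ω x - t) * u x) ^ 2 := by
  obtain ⟨C, hC⟩ := hq.bounded
  have key : ∀ {v : ℝ → ℝ}, MemLp v 2 → ∃ V : L2 univ, V =ᵐ[volume.restrict univ] fun x => (v x : ℂ) :=
    fun {v} hv => by
      have h : MemLp (fun x => (v x : ℂ)) 2 (volume.restrict univ) := by
        rw [Measure.restrict_univ]
        exact hv.ofReal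
      exact ⟨h.toLp, h.coeFn_toLp⟩
  obtain ⟨U, hU⟩ := key m0
  obtain ⟨U₁, hU₁⟩ := key m1
  obtain ⟨U₂, hU₂⟩ := key m2
  obtain ⟨M, hM1, hM2, -⟩ := exists_mulOp_eq (U := univ) (V := potential q ω) (C := C)
    (by rw [Measure.restrict_univ]; exact hq.aestronglyMeasurable_potential hω)
    (by rw [Measure.restrict_univ]; exact hq.potential_bound hω hC)
  refine ⟨(U, -U₂ + M U), ?_, ?_, ?_⟩
  · rw [hamiltonian, mem_graph_add_mulOp hM1, add_sub_cancel_right, negLaplacian_graph]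
    refine ⟨U₁, h1.ofReal.hasWeakDeriv hU hU₁, ?_⟩
    rw [neg_neg]
    exact h2.ofReal.hasWeakDeriv hU₁ hU₂
  · rw [norm_sq_L2, setIntegral_univ]
    refine integral_congr_ae ?_
    filter_upwards [ae_of_ae_restrict_univ hU] with x hx
    rw [hx, Complex.norm_real, Real.norm_eq_abs, sq_abs]
  · rw [norm_sq_L2, setIntegral_univ]
    refine integral_congr_ae ?_
    filter_upwards [ae_of_ae_restrict_univ hU, ae_of_ae_restrict_univ hU₂,
      ae_of_ae_restrict_univ (hM2 U),
      ae_of_ae_restrict_univ (Lp.coeFn_sub (-U₂ + M U) ((t : ℂ) • U)),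
      ae_of_ae_restrict_univ (Lp.coeFn_add (-U₂) (M U)),
      ae_of_ae_restrict_univ (Lp.coeFn_neg U₂),
      ae_of_ae_restrict_univ (Lp.coeFn_smul (t : ℂ) U)] with x e1 e2 e3 e4 e5 e6 e7
    rw [e4, Pi.sub_apply, e5, Pi.add_apply, e6, e7, Pi.neg_apply, Pi.smul_apply, e3, e2, e1,
      smul_eq_mul]
    have : -(u₂ x : ℂ) + (potential q ω x : ℂ) * (u x : ℂ) - (t : ℂ) * (u x : ℂ)
        = ((-u₂ x + (potential q ω x - t) * u x : ℝ) : ℂ) := by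
      push_cast
      ring
    rw [this, Complex.norm_real, Real.norm_eq_abs, sq_abs]

end SingleSite

/-- Cutoff functions at scale `N` around `a`, with their first two derivatives. -/
lemma exists_cutoff : ∃ K > 0, ∀ (N : ℕ) (a : ℝ), 0 < N → ∃ X X₁ X₂ : ℝ → ℝ,
    IsPrim X X₁ ∧ IsPrim X₁ X₂ ∧ Continuous X₂ ∧ (∀ x, |X x| ≤ 1) ∧
    (∀ x ∈ Icc (a - N) (a + N), X x = 1) ∧
    (∀ x, |X₁ x| ≤ K / N) ∧ (∀ x, |X₂ x| ≤ K / N) ∧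
    ∀ x, x ∉ Icc (a - 2 * N) (a + 2 * N) → X x = 0 ∧ X₁ x = 0 ∧ X₂ x = 0 := by
  let χ : ContDiffBump (0 : ℝ) := ⟨1, 2, one_pos, one_lt_two⟩
  have hχ : ContDiff ℝ 2 χ := χ.contDiff
  have hχ1 : ContDiff ℝ 1 (deriv χ) := by
    have : ContDiff ℝ (1 + 1) χ := by simpa [one_add_one_eq_two] using hχ
    exact (contDiff_succ_iff_deriv.1 this).2.2
  have hχ2 : Continuous (deriv (deriv χ)) := hχ1.continuous_deriv le_rfl
  have hc : HasCompactSupport (χ : ℝ → ℝ) := χ.hasCompactSupport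
  obtain ⟨K₁, hK₁⟩ := hχ1.continuous.bounded_above_of_compact_support hc.deriv
  obtain ⟨K₂, hK₂⟩ := hχ2.bounded_above_of_compact_support hc.deriv.deriv
  have hK₁0 : 0 ≤ K₁ := (norm_nonneg _).trans (hK₁ 0)
  have hK₂0 : 0 ≤ K₂ := (norm_nonneg _).trans (hK₂ 0)
  refine ⟨K₁ + K₂ + 1, by positivity, fun N a hN => ?_⟩
  have hN0 : (0 : ℝ) < N := by exact_mod_cast hN
  have hN1 : (1 : ℝ) ≤ N := by exact_mod_cast hN
  have hlin : ∀ x : ℝ, HasDerivAt (fun x => (x - a) / N) (1 / N) x := fun x =>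
    ((hasDerivAt_id x).sub_const a).div_const _
  refine ⟨fun x => χ ((x - a) / N), fun x => deriv χ ((x - a) / N) * (1 / N),
    fun x => deriv (deriv χ) ((x - a) / N) * (1 / N) * (1 / N), ?_, ?_, by fun_prop, fun x => ?_,
    fun x hx => ?_, fun x => ?_, fun x => ?_, fun x hx => ?_⟩
  · refine IsPrim.of_hasDerivAt (fun x => ?_)
      ((hχ1.continuous.comp (by fun_prop)).mul continuous_const)
    exact ((hχ.differentiable (by norm_num) _).hasDerivAt).comp x (hlin x)
  · refine IsPrim.of_hasDerivAt (fun x => ?_) (by fun_prop)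
    exact (((hχ1.differentiable (by norm_num) _).hasDerivAt).comp x (hlin x)).mul_const _
  · rw [abs_of_nonneg χ.nonneg]
    exact χ.le_one
  · refine χ.one_of_mem_closedBall ?_
    rw [Metric.mem_closedBall, Real.dist_0_eq_abs, abs_div, abs_of_pos hN0, div_le_one hN0, abs_le]
    constructor <;> linarith [hx.1, hx.2]
  · beta_reduce
    rw [mul_one_div, abs_div, abs_of_pos hN0]
    refine div_le_div_of_nonneg_right ?_ hN0.le
    linarith [(Real.norm_eq_abs _).symm.trans_le (hK₁ ((x - a) / N))]
  · beta_reduce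
    rw [mul_one_div, mul_one_div, abs_div, abs_div, abs_of_pos hN0]
    refine (div_le_self (by positivity) hN1).trans (div_le_div_of_nonneg_right ?_ hN0.le)
    linarith [(Real.norm_eq_abs _).symm.trans_le (hK₂ ((x - a) / N))]
  · have hout : 2 < |(x - a) / N| := by
      by_contra h
      rw [not_lt, abs_div, abs_of_pos hN0, div_le_iff₀ hN0, abs_le] at h
      exact hx ⟨by linarith [h.1], by linarith [h.2]⟩
    have hts : (x - a) / N ∉ tsupport χ := by
      rw [χ.tsupport_eq, Metric.mem_closedBall, Real.dist_0_eq_abs, not_le]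
      exact hout
    have h1 : (x - a) / N ∉ tsupport (deriv χ) := fun h => hts (tsupport_deriv_subset h)
    have h2 : (x - a) / N ∉ tsupport (deriv (deriv χ)) := fun h => h1 (tsupport_deriv_subset h)
    simp only [image_eq_zero_of_notMem_tsupport hts, image_eq_zero_of_notMem_tsupport h1,
      image_eq_zero_of_notMem_tsupport h2, zero_mul, and_self]

namespace SingleSite

variable {q : ℝ → ℝ} {r : ℝ} {ω θ : ℤ → ℝ}

/-- Two configurations that agree approximately on a window, up to a translation, have potentials that
are close in `L²` on this window. -/
lemma integral_potential_sub_le (hq : SingleSite q r) (hω : ∀ n, ω n ∈ Icc (-dmax r) (dmax r))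
    (hθ : ∀ n, θ n ∈ Icc (-dmax r) (dmax r)) {m : ℤ} {M : ℕ} {η : ℝ}
    (h : ∀ j ∈ Finset.Icc (-M : ℤ) M,
      ∫ x in (-1 / 2)..(1 / 2), (q (x - ω (m + j)) - q (x - θ j)) ^ 2 ≤ η) :
    (∀ a b, IntervalIntegrable
      (fun x => (potential q ω x - potential q θ (x - m)) ^ 2) volume a b) ∧
    ∫ x in (m - M - 1 / 2 : ℝ)..(m + M + 1 / 2), (potential q ω x - potential q θ (x - m)) ^ 2
      ≤ (2 * M + 1) * η := by
  obtain ⟨C, hC⟩ := hq.bounded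
  have hmp := measurePreserving_sub_right (volume : Measure ℝ) (m : ℝ)
  have hmeas : AEStronglyMeasurable
      fun x => (potential q ω x - potential q θ (x - m)) ^ 2 :=
    ((hq.aestronglyMeasurable_potential hω).sub
      ((hq.aestronglyMeasurable_potential hθ).comp_measurePreserving hmp)).pow 2
  have hbound : ∀ᵐ x, ‖(potential q ω x - potential q θ (x - m)) ^ 2‖ ≤ ‖(2 * C) ^ 2‖ := by
    filter_upwards [hq.potential_bound hω hC,
      hmp.quasiMeasurePreserving.ae (hq.potential_bound hθ hC)] with x h1 h2
    rw [Real.norm_eq_abs, Real.norm_eq_abs, abs_pow, abs_pow]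
    refine pow_le_pow_left₀ (abs_nonneg _) ?_ 2
    calc _ ≤ |potential q ω x| + |potential q θ (x - m)| := abs_sub _ _
      _ ≤ 2 * C := by linarith
      _ ≤ _ := le_abs_self _
  have hint : ∀ a b, IntervalIntegrable
      (fun x => (potential q ω x - potential q θ (x - m)) ^ 2) volume a b := fun a b =>
    (intervalIntegrable_const (c := (2 * C) ^ 2)).mono_fun hmeas.restrict (ae_restrict_of_ae hbound)
  refine ⟨hint, ?_⟩
  have hpiece : ∀ j ∈ Finset.Icc (-M : ℤ) M, ∫ x in (m + j - 1 / 2 : ℝ)..(m + j + 1 / 2),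
      (potential q ω x - potential q θ (x - m)) ^ 2 ≤ η := fun j hj => by
    refine le_of_eq_of_le ?_ (h j hj)
    have e : ∫ x in (-1 / 2)..(1 / 2), (q (x - ω (m + j)) - q (x - θ j)) ^ 2
        = ∫ x in (-1 / 2)..(1 / 2), (fun x => (potential q ω x - potential q θ (x - m)) ^ 2)
          (x + (m + j)) := by
      refine intervalIntegral.integral_congr_ae ?_
      filter_upwards [ae_mem_unitCell] with x hx hx2
      have hx3 := hx hx2
      rw [hq.potential_eq hω (n := m + j) (x := x + (m + j)) (by push_cast; simpa using hx3),
        hq.potential_eq hθ (n := j) (x := x + (m + j) - m) (by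
          rwa [show x + ((m : ℝ) + j) - m - j = x by ring])]
      push_cast
      ring_nf
    rw [e, intervalIntegral.integral_comp_add_right
      (fun x => (potential q ω x - potential q θ (x - m)) ^ 2)]
    congr 1 <;> ring
  have h1 := intervalIntegral.sum_integral_adjacent_intervals (n := 2 * M + 1)
    (f := fun x => (potential q ω x - potential q θ (x - m)) ^ 2) (μ := volume)
    (a := fun k : ℕ => (m + k - M - 1 / 2 : ℝ)) (fun k _ => hint _ _)
  rw [show (m + (0 : ℕ) - M - 1 / 2 : ℝ) = m - M - 1 / 2 by push_cast; ring,
    show (m + (2 * M + 1 : ℕ) - M - 1 / 2 : ℝ) = m + M + 1 / 2 by push_cast; ring] at h1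
  rw [← h1]
  refine (Finset.sum_le_card_nsmul _ _ η fun k hk => ?_).trans (le_of_eq ?_)
  · have h2 := hpiece (k - M) (Finset.mem_Icc.2 ⟨by omega, by
      have := Finset.mem_range.1 hk
      omega⟩)
    push_cast at h2 ⊢
    rwa [show (m + k - M - 1 / 2 : ℝ) = m + (k - M) - 1 / 2 by ring,
      show (m + (k + 1) - M - 1 / 2 : ℝ) = m + (k - M) + 1 / 2 by ring]
  · rw [Finset.card_range, nsmul_eq_mul]
    push_cast
    ring

/-- Let `θ` be a balanced configuration of maximally displaced bumps. If `ω` contains approximate copies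
of all finite pieces of `θ`, then translates of the bounded positive solution for `θ`, cut off at a
large scale, are approximate eigenfunctions of `H_ω`. -/
theorem mem_realSpectrum_of_balanced (hq : SingleSite q r) {p : ℝ → ℝ → ℝ}
    (hp : IsCellFamily q r p) (hθ : ∀ n, θ n = dmax r ∨ θ n = -dmax r) {L : ℕ} (hL : 0 < L)
    (hper : Function.Periodic θ L)
    (hsum : ∑ j ∈ Finset.Ico (0 : ℤ) (0 + L), ∫ x in (-1 / 2)..(1 / 2), p (θ j) x = 0)
    (hω : ∀ n, ω n ∈ Icc (-dmax r) (dmax r))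
    (happ : ∀ N : ℕ, ∀ ε > 0, ∃ m : ℤ, ∀ j ∈ Finset.Icc (-N : ℤ) N, |ω (m + j) - θ j| < ε) :
    neumannEnergy q (dmax r) ∈ realSpectrum (hamiltonian q ω) := by
  obtain ⟨C, hC⟩ := hq.bounded
  have hd := hq.dmax_pos
  have hθI : ∀ n, θ n ∈ Icc (-dmax r) (dmax r) := fun n => by
    rcases hθ n with h | h <;> rw [h] <;> constructor <;> linarith
  obtain ⟨Ψ, Ψ', c, K, hΨ, hΨ', hc, hcΨ, hK, hK'⟩ :=
    hq.exists_bounded_solution hp hθ hL hper hsum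
  set E := neumannEnergy q (dmax r)
  have hK0 : 0 < K := hc.trans_le ((hcΨ 0).trans ((le_abs_self _).trans (hK 0)))
  obtain ⟨K₁, hK₁, hcut⟩ := exists_cutoff
  refine mem_realSpectrum_of_approx fun δ hδ => ?_
  -- the error is at most `5 N (18 (K₁ K / N)² + 2 K² η)`, the norm at least `2 N c²`
  obtain ⟨N₀, hN₀⟩ := exists_nat_ge (90 * (K₁ * K) ^ 2 / (c ^ 2 * δ ^ 2))
  obtain ⟨N, hN, hN1⟩ : ∃ N : ℕ, 90 * (K₁ * K) ^ 2 / (c ^ 2 * δ ^ 2) ≤ N ∧ 0 < N :=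
    ⟨N₀ + 1, by push_cast; linarith, by omega⟩
  have hNr : (1 : ℝ) ≤ N := by exact_mod_cast hN1
  have hN0 : (0 : ℝ) < N := by linarith
  obtain ⟨ε, hε, hshift⟩ := hq.exists_shift_bound (η := c ^ 2 * δ ^ 2 / (10 * K ^ 2))
    (by positivity)
  set η := c ^ 2 * δ ^ 2 / (10 * K ^ 2)
  obtain ⟨m, hm⟩ := happ (2 * N) ε hε
  obtain ⟨hDi, hD⟩ := hq.integral_potential_sub_le hω hθI (m := m) (M := 2 * N) (η := η)
    fun j hj => hshift _ _ (hm j hj)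
  obtain ⟨X, X₁, X₂, hX, hX₁, hX₂c, hX1, hXone, hXb₁, hXb₂, hXz⟩ := hcut N m hN1
  set ψ : ℝ → ℝ := fun x => Ψ (x - m)
  set ψ₁ : ℝ → ℝ := fun x => Ψ' (x - m)
  have hψ : IsPrim ψ ψ₁ := hΨ.comp_sub_right m
  have hψ₁ : IsPrim ψ₁ fun x => (potential q θ (x - m) - E) * ψ x := hΨ'.comp_sub_right m
  have hu := hX.mul hψ
  have hu₁ := (hX₁.mul hψ).add (hX.mul hψ₁)
  have hXc := hX.continuous
  have hX₁c := hX₁.continuous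
  have hψc := hψ.continuous
  have hψ₁c := hψ₁.continuous
  have hcs : ∀ f : ℝ → ℝ, (∀ x, x ∉ Icc (m - 2 * N : ℝ) (m + 2 * N) → f x = 0) →
      Continuous f → MemLp f 2 := fun f hf hfc =>
    hfc.memLp_of_hasCompactSupport (HasCompactSupport.intro isCompact_Icc fun x hx => hf x hx)
  have m0 : MemLp (fun x => X x * ψ x) 2 :=
    hcs _ (fun x hx => by rw [(hXz x hx).1, zero_mul]) (by fun_prop)
  have m1 : MemLp (fun x => X₁ x * ψ x + X x * ψ₁ x) 2 :=
    hcs _ (fun x hx => by rw [(hXz x hx).1, (hXz x hx).2.1]; ring) (by fun_prop)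
  have m2 : MemLp (fun x => X₂ x * ψ x + X₁ x * ψ₁ x
      + (X₁ x * ψ₁ x + X x * ((potential q θ (x - m) - E) * ψ x))) 2 := by
    have hA : MemLp (fun x => X₂ x * ψ x + X₁ x * ψ₁ x + X₁ x * ψ₁ x) 2 :=
      hcs _ (fun x hx => by rw [(hXz x hx).2.1, (hXz x hx).2.2]; ring) (by fun_prop)
    have hmp := measurePreserving_sub_right (volume : Measure ℝ) (m : ℝ)
    have hW : AEStronglyMeasurable fun x => potential q θ (x - m) - E :=
      ((hq.aestronglyMeasurable_potential hθI).comp_measurePreserving hmp).sub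
        aestronglyMeasurable_const
    have hB : MemLp (fun x => (potential q θ (x - m) - E) * (X x * ψ x)) 2 := by
      refine m0.of_le_mul (c := C + |E|) (hW.mul m0.1) ?_
      filter_upwards [hmp.quasiMeasurePreserving.ae (hq.potential_bound hθI hC)] with x hx
      rw [norm_mul]
      refine mul_le_mul_of_nonneg_right ?_ (norm_nonneg _)
      exact (abs_sub _ _).trans (by linarith)
    convert hA.add hB using 1
    ext x
    simp only [Pi.add_apply]
    ring
  obtain ⟨v, hv, hv1, hv2⟩ := hq.exists_mem_graph hω hu hu₁ m0 m1 m2 E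
  have hlow : 2 * N * c ^ 2 ≤ ‖v.1‖ ^ 2 := by
    rw [hv1]
    have h1 : ∫ x in Icc (m - N : ℝ) (m + N), c ^ 2 = 2 * N * c ^ 2 := by
      rw [setIntegral_const, Real.volume_real_Icc_of_le (by linarith), smul_eq_mul]
      ring
    rw [← h1]
    refine (setIntegral_mono_on (by simp) m0.integrable_sq.integrableOn
      measurableSet_Icc fun x hx => ?_).trans
      (setIntegral_le_integral m0.integrable_sq (.of_forall fun x => sq_nonneg _))
    rw [hXone x hx, one_mul]
    exact pow_le_pow_left₀ hc.le (hcΨ _) 2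
  have hup : ‖v.2 - (E : ℂ) • v.1‖ ^ 2
      ≤ 5 * N * (18 * (K₁ * K / N) ^ 2 + 2 * K ^ 2 * η) := by
    rw [hv2, ← setIntegral_eq_integral_of_forall_compl_eq_zero
      (s := Ioc (m - 2 * N - 1 / 2 : ℝ) (m + 2 * N + 1 / 2)) fun x hx => by
        obtain ⟨z0, z1, z2⟩ := hXz x fun h => hx ⟨by linarith [h.1], by linarith [h.2]⟩
        rw [z0, z1, z2]
        ring]
    have hR : IntervalIntegrable (fun x => 18 * (K₁ * K / N) ^ 2
        + 2 * K ^ 2 * (potential q ω x - potential q θ (x - m)) ^ 2) volume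
        (m - 2 * N - 1 / 2 : ℝ) (m + 2 * N + 1 / 2) :=
      intervalIntegrable_const.add ((hDi _ _).const_mul _)
    have hle : (m - 2 * N - 1 / 2 : ℝ) ≤ m + 2 * N + 1 / 2 := by linarith
    refine (integral_mono_of_nonneg (.of_forall fun x => sq_nonneg _)
      ((intervalIntegrable_iff_integrableOn_Ioc_of_le hle).1 hR) (.of_forall fun x => ?_)).trans ?_
    · beta_reduce
      have e : -(X₂ x * ψ x + X₁ x * ψ₁ x
          + (X₁ x * ψ₁ x + X x * ((potential q θ (x - m) - E) * ψ x)))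
          + (potential q ω x - E) * (X x * ψ x)
          = -(X₂ x * ψ x + 2 * (X₁ x * ψ₁ x))
            + (potential q ω x - potential q θ (x - m)) * (X x * ψ x) := by ring
      rw [e]
      have a1 : |X₂ x * ψ x| ≤ K₁ / N * K := by
        rw [abs_mul]
        exact mul_le_mul (hXb₂ x) (hK _) (abs_nonneg _) (by positivity)
      have a2 : |X₁ x * ψ₁ x| ≤ K₁ / N * K := by
        rw [abs_mul]
        exact mul_le_mul (hXb₁ x) (hK' _) (abs_nonneg _) (by positivity)
      have a3 : |X x * ψ x| ≤ K := by
        rw [abs_mul]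
        exact (mul_le_of_le_one_left (abs_nonneg _) (hX1 x)).trans (hK _)
      have b1 : (X₂ x * ψ x + 2 * (X₁ x * ψ₁ x)) ^ 2 ≤ (3 * (K₁ * K / N)) ^ 2 := by
        refine sq_le_sq' ?_ ?_ <;> rw [mul_div_right_comm] <;>
          linarith [abs_le.1 a1, abs_le.1 a2, (abs_le.1 a1).1, (abs_le.1 a1).2, (abs_le.1 a2).1,
            (abs_le.1 a2).2]
      have b2 : (X x * ψ x) ^ 2 ≤ K ^ 2 := sq_le_sq' (abs_le.1 a3).1 (abs_le.1 a3).2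
      have b3 := mul_le_mul_of_nonneg_left b2
        (sq_nonneg (potential q ω x - potential q θ (x - m)))
      nlinarith [sq_nonneg (X₂ x * ψ x + 2 * (X₁ x * ψ₁ x)
        + (potential q ω x - potential q θ (x - m)) * (X x * ψ x))]
    · rw [← intervalIntegral.integral_of_le hle, intervalIntegral.integral_add
        intervalIntegrable_const ((hDi _ _).const_mul _), intervalIntegral.integral_const,
        intervalIntegral.integral_const_mul, smul_eq_mul]
      push_cast at hD
      have h1 := mul_le_mul_of_nonneg_left hD (show 0 ≤ 2 * K ^ 2 by positivity)
      have h2 : (4 * N + 1) * (18 * (K₁ * K / N) ^ 2 + 2 * K ^ 2 * η)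
          ≤ 5 * N * (18 * (K₁ * K / N) ^ 2 + 2 * K ^ 2 * η) :=
        mul_le_mul_of_nonneg_right (by linarith) (by positivity)
      linarith
  have hv0 : v.1 ≠ 0 := fun h => by
    rw [h, norm_zero] at hlow
    have : 0 < 2 * N * c ^ 2 := by positivity
    linarith
  refine ⟨v, hv, ?_, hv0⟩
  refine le_of_sq_le_sq ?_ (by positivity)
  rw [mul_pow]
  have h1 : 2 * K ^ 2 * η = c ^ 2 * δ ^ 2 / 5 := by
    simp only [η]
    field_simp
    ring
  have h2 : 18 * (K₁ * K / N) ^ 2 ≤ c ^ 2 * δ ^ 2 / 5 := by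
    rw [div_le_iff₀ (by positivity)] at hN
    rw [div_pow, ← mul_div_assoc, div_le_iff₀ (by positivity)]
    have h3 : (N : ℝ) * (c ^ 2 * δ ^ 2) ≤ N ^ 2 * (c ^ 2 * δ ^ 2) :=
      mul_le_mul_of_nonneg_right (by nlinarith) (by positivity)
    linarith
  calc _ ≤ 5 * N * (18 * (K₁ * K / N) ^ 2 + 2 * K ^ 2 * η) := hup
    _ ≤ 5 * N * (c ^ 2 * δ ^ 2 / 5 + c ^ 2 * δ ^ 2 / 5) := by
        refine mul_le_mul_of_nonneg_left ?_ (by positivity)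
        linarith
    _ = δ ^ 2 * (2 * N * c ^ 2) := by ring
    _ ≤ _ := mul_le_mul_of_nonneg_left hlow (sq_nonneg _)

end SingleSite

end RDM

namespace RDM

open MeasureTheory ProbabilityTheory Set Filter Topology

/-! ### Typical configurations contain approximate copies of every finite pattern -/

section Patterns

variable {ι : Type*} {Ω : Type*} [MeasurableSpace Ω]

/-- Events that involve disjoint sets of coordinates are independent. -/
lemma iIndepSet_pi (μ : Measure Ω) [IsProbabilityMeasure μ] {B : ℕ → Finset ι}
    (hB : Pairwise fun k l => Disjoint (B k) (B l)) {t : ι → Set Ω}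
    (ht : ∀ i, MeasurableSet (t i)) :
    iIndepSet (fun k => (B k : Set ι).pi t) (Measure.infinitePi fun _ => μ) := by
  classical
  refine (iIndepSet_iff_meas_biInter
    fun k => MeasurableSet.pi (B k).countable_toSet fun i _ => ht i).2 fun S => ?_
  have h1 : ⋂ k ∈ S, (B k : Set ι).pi t = (S.biUnion B : Set ι).pi t := by
    ext x
    simp only [mem_iInter, Set.mem_pi, SetLike.mem_coe, Finset.mem_biUnion]
    exact ⟨fun h i ⟨k, hk, hi⟩ => h k hk i hi, fun h k hk i hi => h i ⟨k, hk, hi⟩⟩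
  rw [h1, Measure.infinitePi_pi _ (fun i _ => ht i),
    Finset.prod_biUnion fun k _ l _ hkl => hB hkl]
  exact Finset.prod_congr rfl fun k _ => (Measure.infinitePi_pi _ fun i _ => ht i).symm

end Patterns

/-- By the second Borel–Cantelli lemma, applied to disjoint blocks, almost every configuration
contains an approximate copy of a given finite piece of `θ`. -/
lemma ae_exists_shift_near {μ : Measure ℝ} [IsProbabilityMeasure μ] {θ : ℤ → ℝ}
    (hθ : ∀ n, θ n ∈ μ.support) (N : ℕ) {ε : ℝ} (hε : 0 < ε) :
    ∀ᵐ ω ∂(Measure.infinitePi fun _ : ℤ => μ), ∃ m : ℤ, ∀ j ∈ Finset.Icc (-N : ℤ) N,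
      |ω (m + j) - θ j| < ε := by
  set B : ℕ → Finset ℤ := fun k =>
    (Finset.Icc (-N : ℤ) N).map (addLeftEmbedding ((2 * N + 1) * (k : ℤ)))
  set t : ℤ → Set ℝ := fun j => Metric.ball (θ ((j + N) % (2 * N + 1) - N)) ε
  have ht : ∀ j, MeasurableSet (t j) := fun j => measurableSet_ball
  have hBt : ∀ (k : ℕ) (j : ℤ), j ∈ Finset.Icc (-N : ℤ) N →
      t ((2 * N + 1) * (k : ℤ) + j) = Metric.ball (θ j) ε := fun k j hj => by
    simp only [t]
    rw [Finset.mem_Icc] at hj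
    rw [show (2 * N + 1) * (k : ℤ) + j + N = (j + N) + (2 * N + 1) * k by ring,
      Int.add_mul_emod_self_left, Int.emod_eq_of_lt (by omega) (by omega), add_sub_cancel_right]
  have hB : Pairwise fun k l => Disjoint (B k) (B l) := fun k l hkl => by
    beta_reduce
    rw [Finset.disjoint_left]
    intro x hx hy
    simp only [B, Finset.mem_map, Finset.mem_Icc, addLeftEmbedding_apply] at hx hy
    obtain ⟨i, hi, rfl⟩ := hx
    obtain ⟨j, hj, hij⟩ := hy
    have h1 : ∀ (k : ℕ) (j : ℤ), -N ≤ j ∧ j ≤ N →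
        ((2 * N + 1) * (k : ℤ) + j + N) / (2 * N + 1) = k := fun k j hj => by
      rw [show (2 * N + 1) * (k : ℤ) + j + N = (j + N) + (2 * N + 1) * k by ring,
        Int.add_mul_ediv_left _ _ (by omega), Int.ediv_eq_zero_of_lt (by omega) (by omega), zero_add]
    have h2 := h1 k i hi
    rw [← hij, h1 l j hj] at h2
    exact hkl (by exact_mod_cast h2.symm)
  have hind := iIndepSet_pi μ hB ht
  have hmeas : ∀ k, (Measure.infinitePi fun _ : ℤ => μ) ((B k : Set ℤ).pi t)
      = ∏ j ∈ Finset.Icc (-N : ℤ) N, μ (Metric.ball (θ j) ε) := fun k => by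
    rw [Measure.infinitePi_pi _ (fun i _ => ht i), Finset.prod_map]
    exact Finset.prod_congr rfl fun j hj => by rw [addLeftEmbedding_apply, hBt k j hj]
  have hpos : ∏ j ∈ Finset.Icc (-N : ℤ) N, μ (Metric.ball (θ j) ε) ≠ 0 :=
    Finset.prod_ne_zero_iff.2 fun j _ =>
      ((Measure.mem_support_iff_forall _).1 (hθ j) _ (Metric.ball_mem_nhds _ hε)).ne'
  have hlim := measure_limsup_eq_one
    (fun k => MeasurableSet.pi (B k).countable_toSet fun i _ => ht i) hind
    (by simp only [hmeas]; exact ENNReal.tsum_const_eq_top_of_ne_zero hpos)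
  have hlim2 := (prob_compl_eq_zero_iff₀ (MeasurableSet.measurableSet_limsup fun k =>
    MeasurableSet.pi (B k).countable_toSet fun i _ => ht i).nullMeasurableSet).2 hlim
  filter_upwards [mem_ae_iff.2 hlim2] with ω hω
  obtain ⟨k, hk⟩ := (mem_limsup_iff_frequently_mem.1 hω).exists
  refine ⟨(2 * N + 1) * k, fun j hj => ?_⟩
  have h1 := hk _ (Finset.mem_coe.2 (Finset.mem_map_of_mem _ hj))
  rwa [addLeftEmbedding_apply, hBt k j hj, Metric.mem_ball, Real.dist_eq] at h1

lemma ae_forall_exists_shift_near {μ : Measure ℝ} [IsProbabilityMeasure μ] {θ : ℤ → ℝ}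
    (hθ : ∀ n, θ n ∈ μ.support) :
    ∀ᵐ ω ∂(Measure.infinitePi fun _ : ℤ => μ), ∀ (N : ℕ), ∀ ε > 0, ∃ m : ℤ,
      ∀ j ∈ Finset.Icc (-N : ℤ) N, |ω (m + j) - θ j| < ε := by
  have h : ∀ᵐ ω ∂(Measure.infinitePi fun _ : ℤ => μ), ∀ N k : ℕ, ∃ m : ℤ,
      ∀ j ∈ Finset.Icc (-N : ℤ) N, |ω (m + j) - θ j| < 1 / ((k : ℝ) + 1) :=
    ae_all_iff.2 fun N => ae_all_iff.2 fun k => ae_exists_shift_near hθ N Nat.one_div_pos_of_nat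
  filter_upwards [h] with ω hω N ε hε
  obtain ⟨k, hk⟩ := exists_nat_one_div_lt hε
  obtain ⟨m, hm⟩ := hω N k
  exact ⟨m, fun j hj => (hm j hj).trans hk⟩

lemma ae_forall_mem_support (μ : Measure ℝ) [IsProbabilityMeasure μ] :
    ∀ᵐ ω ∂(Measure.infinitePi fun _ : ℤ => μ), ∀ n, ω n ∈ μ.support :=
  ae_all_iff.2 fun n => (measurePreserving_eval_infinitePi (fun _ : ℤ => μ) n).quasiMeasurePreserving.ae
    Measure.support_mem_ae

end RDM

namespace RDM

open MeasureTheory Set Filter Topology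

/-! ### Counting displacements -/

namespace SingleSite

variable {q : ℝ → ℝ} {r : ℝ} {ω : ℤ → ℝ}

lemma ncard_eq_card (ω : ℤ → ℝ) (P : ℝ → Prop) [DecidablePred P] (m k : ℤ) :
    {n ∈ Ico m k | P (ω n)}.ncard = {n ∈ Finset.Ico m k | P (ω n)}.card := by
  rw [← Set.ncard_coe_finset]
  congr 1
  ext
  simp

/-- The logarithmic growth of the glued cell ground states over a window is proportional to the
difference of the numbers of right and left displacements. -/
lemma sum_integral_eq (hq : SingleSite q r) {p : ℝ → ℝ → ℝ} (hp : IsCellFamily q r p)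
    (hω : ∀ n, ω n = dmax r ∨ ω n = -dmax r) (m k : ℤ) :
    ∑ j ∈ Finset.Ico m k, ∫ x in (-1 / 2)..(1 / 2), p (ω j) x
      = (({n ∈ Ico m k | 0 < ω n}.ncard : ℝ) - {n ∈ Ico m k | ω n < 0}.ncard)
        * ∫ x in (-1 / 2)..(1 / 2), p (dmax r) x := by
  classical
  have hd := hq.dmax_pos
  rw [ncard_eq_card ω (fun x => 0 < x), ncard_eq_card ω (fun x => x < 0), Finset.card_filter,
    Finset.card_filter]
  push_cast
  rw [← Finset.sum_sub_distrib, Finset.sum_mul]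
  refine Finset.sum_congr rfl fun j _ => ?_
  rcases hω j with h | h
  · rw [h, if_pos hd, if_neg hd.not_gt, sub_zero, one_mul]
  · rw [h, if_neg (by linarith), if_pos (by linarith), integral_neg_dmax hp]
    ring

lemma ncard_add_ncard (hq : SingleSite q r) (hω : ∀ n, ω n = dmax r ∨ ω n = -dmax r) (m : ℤ)
    (L : ℕ) :
    {n ∈ Ico m (m + L) | 0 < ω n}.ncard + {n ∈ Ico m (m + L) | ω n < 0}.ncard = L := by
  classical
  have hd := hq.dmax_pos
  have h1 : {n ∈ Finset.Ico m (m + L) | ω n < 0} = {n ∈ Finset.Ico m (m + L) | ¬0 < ω n} := by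
    refine Finset.filter_congr fun n _ => ?_
    rcases hω n with h | h <;> simp [h, hd, hd.le]
  rw [ncard_eq_card ω (fun x => 0 < x), ncard_eq_card ω (fun x => x < 0), h1,
    Finset.card_filter_add_card_filter_not, Int.card_Ico]
  simp

end SingleSite

end RDM

/-! ### The minimum of the spectrum -/

open RDM in
theorem theorem4 (q : ℝ → ℝ) (r : ℝ) (μ : MeasureTheory.Measure ℝ)
    [MeasureTheory.IsProbabilityMeasure μ]
    (hq : RDM.SingleSite q r) (hμ : RDM.Displacement μ r) (hE : RDM.StrictExtrema q r) :
    ∃ E₀ : ℝ, IsLeast (RDM.almostSureSpectrum q μ) E₀ ∧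
      ∀ (L : ℕ) (ω : ℤ → ℝ), 0 < L → (∀ n, ω n ∈ μ.support) → (∀ n, ω (n + L) = ω n) →
        (IsLeast (RDM.realSpectrum (RDM.hamiltonian q ω)) E₀ ↔
          (∀ n, ω n = RDM.dmax r ∨ ω n = -RDM.dmax r) ∧
          Even L ∧
          (∀ m : ℤ, {n ∈ Set.Ico m (m + L) | ω n < 0}.ncard =
            {n ∈ Set.Ico m (m + L) | 0 < ω n}.ncard)) := by
  obtain ⟨p, hp⟩ := hq.exists_cellFamily
  refine ⟨neumannEnergy q (dmax r), ⟨?_, fun E hEm => ?_⟩, fun L ω hL hsupp hper => ?_⟩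
  · -- the alternating configuration is balanced and is approximated by almost every `ω`
    set θ : ℤ → ℝ := fun n => if Even n then dmax r else -dmax r
    have hθ : ∀ n, θ n = dmax r ∨ θ n = -dmax r := fun n => by
      by_cases h : Even n
      · exact Or.inl (if_pos h)
      · exact Or.inr (if_neg h)
    have hθs : ∀ n, θ n ∈ μ.support := fun n => hμ.corners (by
      rcases hθ n with h | h <;> simp [h])
    have hθper : Function.Periodic θ (2 : ℕ) := fun n => by
      simp only [θ, Nat.cast_ofNat, Int.even_add, even_two, iff_true]
    have hsum : ∑ j ∈ Finset.Ico (0 : ℤ) (0 + (2 : ℕ)), ∫ x in (-1 / 2)..(1 / 2), p (θ j) x = 0 := by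
      have h1 : Finset.Ico (0 : ℤ) (0 + (2 : ℕ)) = {0, 1} := rfl
      rw [h1, Finset.sum_pair zero_ne_one, show θ 0 = dmax r from if_pos Even.zero,
        show θ 1 = -dmax r from if_neg Int.not_even_one, SingleSite.integral_neg_dmax hp,
        add_neg_cancel]
    change ∀ᵐ ω ∂_, _
    filter_upwards [ae_forall_mem_support μ, ae_forall_exists_shift_near hθs] with ω h1 h2
    exact hq.mem_realSpectrum_of_balanced hp hθ two_pos hθper hsum
      (fun n => hμ.support_subset (h1 n)) h2
  · obtain ⟨ω, h1, h2⟩ := ((ae_forall_mem_support μ).and hEm).exists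
    exact hq.neumannEnergy_le_of_mem_realSpectrum hE (fun n => hμ.support_subset (h1 n)) h2
  · have hω : ∀ n, ω n ∈ Set.Icc (-dmax r) (dmax r) := fun n => hμ.support_subset (hsupp n)
    have hper' : Function.Periodic ω L := hper
    constructor
    · intro hleast
      have h1 := mt (hq.not_mem_realSpectrum_of_periodic hE hp hω hL hper') (not_not.2 hleast.1)
      rw [not_or, not_exists, not_not] at h1
      have hext := fun n => not_not.1 (h1.1 n)
      have h0 := h1.2
      have hcount : ∀ m : ℤ, {n ∈ Set.Ico m (m + L) | ω n < 0}.ncard =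
          {n ∈ Set.Ico m (m + L) | 0 < ω n}.ncard := fun m => by
        -- the sum over a period does not depend on where the period starts
        have hm : ∑ j ∈ Finset.Ico m (m + L), ∫ x in (-1 / 2)..(1 / 2), p (ω j) x = 0 := by
          obtain ⟨σ, hσ⟩ := exists_antidifference fun j => ∫ x in (-1 / 2)..(1 / 2), p (ω j) x
          rw [← h0, sum_Ico_antidifference hσ, sum_Ico_antidifference hσ, zero_add]
          exact antidifference_add_period hσ (fun n => by beta_reduce; rw [hper]) m
        rw [hq.sum_integral_eq hp hext] at hm
        have h2 := (mul_eq_zero.1 hm).resolve_right (hq.integral_ne_zero hE hp)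
        exact_mod_cast (sub_eq_zero.1 h2).symm
      refine ⟨hext, ?_, hcount⟩
      have h3 := hq.ncard_add_ncard hext 0 L
      rw [hcount 0] at h3
      exact ⟨_, h3.symm⟩
    · rintro ⟨hext, -, hcount⟩
      refine ⟨?_, fun t ht => hq.neumannEnergy_le_of_mem_realSpectrum hE hω ht⟩
      refine hq.mem_realSpectrum_of_balanced hp hext hL hper' ?_ hω
        fun N ε hε => ⟨0, fun j _ => by simpa using hε⟩
      rw [hq.sum_integral_eq hp hext, hcount 0, sub_self, zero_mul]
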